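/- A \emph{linear-exponential straight-line program} (LESLP) is a sequence of assignments $\sigma = (x_0 \leftarrow \rho_0, \dots, x_n \leftarrow \rho_n)$, $n \ge 0$, in which every expression $\rho_i$ has one of the forms $0$, $x_j + x_k$, $\frac{m}{g}\cdot x_j$ or $2^{x_j}$, where $j,k \in \{0,\dots,i-1\}$ and $m, g$ are integers with $g \ge 1$. Evaluating the assignments in order assigns to every variable $x_i$ a real number $[\![\sigma]\!](x_i)$; in particular $[\![\sigma]\!](x_0) = 0$. If all these numbers are integers, $\sigma$ is called an \emph{integer} linear-exponential straight-line program (ILESLP). The bit size of $\sigma$ is the number of symbols needed to write it down over a fixed finite alphabet, with variable indices in unary and the integers $m, g$ in binary. PosILESLP is the following problem. Input: an ILESLP $\sigma = (x_0 \leftarrow \rho_0, \dots, x_n \leftarrow \rho_n)$. Question: is $[\![\sigma]\!](x_n) \ge 0$? \textbf{Lemma.} PosILESLP can be decided in polynomial time: there are a deterministic Turing machine and a polynomial $p$ such that, for every ILESLP $\sigma$, the machine started on the written form of $\sigma$ halts after at most $p(\text{bit size of } \sigma)$ steps and answers whether $[\![\sigma]\!](x_n) \ge 0$. -/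

import Mathlib

/-- The right-hand sides `0`, `x_j + x_k`, `(m / g) * x_j`, `2 ^ x_j` allowed in the assignment to
the variable `x_i`; they refer to variables of index less than `i` only.  A rational coefficient
is a pair of integers `m / g` with `g ≥ 1`, not necessarily in lowest terms. -/
inductive LESLPExpr (i : ℕ) : Type
  | zero : LESLPExpr i
  | add (j k : Fin i) : LESLPExpr i
  | scale (m : ℤ) (g : ℕ+) (j : Fin i) : LESLPExpr i
  | exp (j : Fin i) : LESLPExpr i

/-- Linear-exponential straight-line programs `(x_0 ← ρ_0, …, x_n ← ρ_n)`. -/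
structure LESLP : Type where
  n : ℕ
  ρ : (i : Fin (n + 1)) → LESLPExpr i

/-- The real number that the variable `x_i` evaluates to. -/
noncomputable def LESLP.val (σ : LESLP) (i : Fin (σ.n + 1)) : ℝ :=
  match σ.ρ i with
  | .zero => 0
  | .add j k => σ.val ⟨j, j.2.trans i.2⟩ + σ.val ⟨k, k.2.trans i.2⟩
  | .scale m g j => ((m : ℝ) / ((g : ℕ) : ℝ)) * σ.val ⟨j, j.2.trans i.2⟩
  | .exp j => (2 : ℝ) ^ σ.val ⟨j, j.2.trans i.2⟩
termination_by (i : ℕ)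
decreasing_by all_goals exact Fin.is_lt _

/-- The value of the last variable `x_n`. -/
noncomputable def LESLP.lastVal (σ : LESLP) : ℝ := σ.val (Fin.last σ.n)

/-- All variables evaluate to integers. -/
def LESLP.IsInteger (σ : LESLP) : Prop := ∀ i, ∃ z : ℤ, σ.val i = (z : ℝ)

/-- Integer linear-exponential straight-line programs. -/
def ILESLP : Type := {σ : LESLP // σ.IsInteger}

/-- The finite alphabet in which programs are written:
`x`, the unary digit, `←`, `0`, `+`, `2^`, the minus sign, `/`, `·`, the two binary digits, and the
separator `;`. -/
inductive LESLPSymbol : Type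
  | var | tick | assign | nought | plus | pow | minus | slash | times | bit (b : Bool) | semicolon
  deriving DecidableEq, Fintype

namespace LESLPSymbol

/-- The variable `x_j`, its index in unary. -/
def writeVar (j : ℕ) : List LESLPSymbol := var :: List.replicate j tick

/-- A natural number in binary, least significant bit first. -/
def writeNat (a : ℕ) : List LESLPSymbol := (Computability.encodeNat a).map bit

/-- An integer: sign and absolute value in binary. -/
def writeInt (m : ℤ) : List LESLPSymbol :=
  (if m < 0 then [minus] else []) ++ writeNat m.natAbs

end LESLPSymbol

open LESLPSymbol in
/-- The expression written as a word. -/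
def LESLPExpr.encode {i : ℕ} : LESLPExpr i → List LESLPSymbol
  | .zero => [nought]
  | .add j k => writeVar j ++ plus :: writeVar k
  | .scale m g j => writeInt m ++ slash :: (writeNat g ++ times :: writeVar j)
  | .exp j => pow :: writeVar j

open LESLPSymbol in
/-- The program written as the word `x_0 ← ρ_0 ; … ; x_n ← ρ_n ;`.  Its length is the bit size of
the program. -/
def LESLP.encode (σ : LESLP) : List LESLPSymbol :=
  (List.ofFn fun i : Fin (σ.n + 1) =>
    writeVar i ++ assign :: ((σ.ρ i).encode ++ [semicolon])).flatten

namespace LESLPSymbol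

theorem append_cons_inj {x : LESLPSymbol} {a b s t : List LESLPSymbol} (ha : x ∉ a) (hb : x ∉ b)
    (h : a ++ x :: s = b ++ x :: t) : a = b ∧ s = t := by
  induction a generalizing b with
  | nil =>
    cases b with
    | nil => exact ⟨rfl, (List.cons.inj h).2⟩
    | cons d b => exact absurd (List.cons.inj h).1 (fun e => hb (by simp [e]))
  | cons c a ih =>
    cases b with
    | nil => exact absurd (List.cons.inj h).1 (fun e => ha (by simp [e]))
    | cons d b =>
      simp only [List.cons_append, List.cons.injEq] at h
      simp only [List.mem_cons, not_or] at ha hb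
      obtain ⟨e1, e2⟩ := ih ha.2 hb.2 h.2
      exact ⟨by rw [h.1, e1], e2⟩

theorem writeNat_injective : Function.Injective writeNat := by
  intro a b h
  have h1 : Computability.encodeNat a = Computability.encodeNat b :=
    List.map_injective_iff.2 (fun x y hxy => by simpa using hxy) h
  rw [← Computability.decode_encodeNat a, h1, Computability.decode_encodeNat]

theorem writeInt_injective : Function.Injective writeInt := by
  intro a b h
  have hm : ∀ c : ℕ, minus ∉ writeNat c := by intro c; simp [writeNat]
  unfold writeInt at h
  split_ifs at h with ha hb hb
  · have := writeNat_injective (List.append_cancel_left h); omega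
  · exact absurd (show minus ∈ writeNat b.natAbs by rw [← List.nil_append (writeNat b.natAbs), ← h]; simp) (hm _)
  · exact absurd (show minus ∈ writeNat a.natAbs by rw [← List.nil_append (writeNat a.natAbs), h]; simp) (hm _)
  · have := writeNat_injective (List.append_cancel_left h); omega

theorem writeVar_injective : Function.Injective writeVar := by
  intro a b h
  simpa [writeVar] using congrArg List.length h

end LESLPSymbol

open LESLPSymbol in
theorem LESLPExpr.encode_injective {i : ℕ} :
    Function.Injective (LESLPExpr.encode : LESLPExpr i → List LESLPSymbol) := by
  have hs : ∀ m : ℤ, ∀ s, (s = slash ∨ s = plus ∨ s = pow ∨ s = nought) → s ∉ writeInt m := by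
    intro m s hs
    rcases hs with rfl | rfl | rfl | rfl <;> simp [writeInt, writeNat]
  intro a b h
  have h1 := congrArg (plus ∈ ·) h
  have h2 := congrArg (slash ∈ ·) h
  have h3 := congrArg (pow ∈ ·) h
  cases a <;> cases b <;>
    simp [encode, writeVar, writeNat, hs] at h1 h2 h3
  · rfl
  · rename_i j k j' k'
    obtain ⟨e1, e2⟩ := append_cons_inj (by simp [writeVar])
      (by simp [writeVar]) h
    rw [Fin.ext (writeVar_injective e1), Fin.ext (writeVar_injective e2)]
  · rename_i m g j m' g' j'
    obtain ⟨e1, e2⟩ := append_cons_inj (hs m _ (.inl rfl))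
      (hs m' _ (.inl rfl)) h
    obtain ⟨e2, e3⟩ := append_cons_inj (by simp [writeNat])
      (by simp [writeNat]) e2
    rw [writeInt_injective e1, PNat.coe_injective (writeNat_injective e2),
      Fin.ext (writeVar_injective e3)]
  · have e := (List.cons.inj h).2
    rw [Fin.ext (writeVar_injective e)]

open LESLPSymbol in
/-- A program can be recovered from the word that encodes it. -/
theorem LESLP.encode_injective : Function.Injective LESLP.encode := by
  have key : ∀ l l' : List (List LESLPSymbol), (∀ w ∈ l, semicolon ∉ w) →
      (∀ w ∈ l', semicolon ∉ w) →
      (l.map (· ++ [semicolon])).flatten = (l'.map (· ++ [semicolon])).flatten → l = l' := by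
    intro l
    induction l with
    | nil => intro l' _ _ h; cases l' <;> simp at h ⊢
    | cons a l ih =>
      intro l' hl hl' h
      cases l' with
      | nil => simp at h
      | cons b l' =>
        simp only [List.map_cons, List.flatten_cons, List.append_assoc,
          List.singleton_append] at h
        obtain ⟨e1, e2⟩ := append_cons_inj (hl a (by simp))
          (hl' b (by simp)) h
        rw [e1, ih l' (fun w hw => hl w (by simp [hw])) (fun w hw => hl' w (by simp [hw])) e2]
  have hexpr : ∀ {i : ℕ} (e : LESLPExpr i), semicolon ∉ e.encode := by
    intro i e
    cases e <;> simp [LESLPExpr.encode, writeVar, writeNat, writeInt]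
  have henc : ∀ σ : LESLP, σ.encode = ((List.ofFn fun i : Fin (σ.n + 1) =>
      writeVar i ++ assign :: (σ.ρ i).encode).map (· ++ [semicolon])).flatten := by
    intro σ
    simp [LESLP.encode, List.map_ofFn, Function.comp_def]
  have hmem : ∀ σ : LESLP, ∀ w ∈ (List.ofFn fun i : Fin (σ.n + 1) =>
      writeVar i ++ assign :: (σ.ρ i).encode), semicolon ∉ w := by
    intro σ w hw
    obtain ⟨i, rfl⟩ := List.mem_ofFn.1 hw
    simp [writeVar, hexpr]
  intro σ τ h
  rw [henc, henc] at h
  have h := key _ _ (hmem σ) (hmem τ) h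
  obtain ⟨n, ρ⟩ := σ
  obtain ⟨n', ρ'⟩ := τ
  obtain rfl : n = n' := by simpa using congrArg List.length h
  have hf := List.ofFn_injective h
  congr
  funext i
  have hi := congrFun hf i
  exact LESLPExpr.encode_injective (List.cons.inj (List.append_cancel_left hi)).2

/-- A decision problem `P` on instances of type `α`, presented as words over `Γ` by `enc`, is
decidable in polynomial time: some deterministic multi-stack Turing machine (whose label and
state sets are finite, so that it only ever pushes finitely many different symbols) started on `enc a` halts with output `true`
or `false` according to whether `P a` holds, after a number of steps bounded by a fixed polynomial
in the length of `enc a`. -/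
def DecidableInPolyTime {α Γ : Type} (enc : α → List Γ) (P : α → Prop) : Prop :=
  open scoped Classical in
  Nonempty (Turing.TM2ComputableInPolyTime enc Computability.encodeBool
    (fun a => decide (P a)))

/-- The question asked about an integer linear-exponential straight-line program: does its last
variable evaluate to a non-negative number? -/
def PosILESLP (σ : ILESLP) : Prop := 0 ≤ σ.1.lastVal

/-!
The sign of the last variable cannot be found by evaluation, since the values are towers of powers
of two. The linear assignments, however, express every variable as a rational linear combination
of the variables that are defined as powers of two and of the constant `1`, with
coefficients of polynomially many digits. So `x_p - x_q` is, up to a positive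
factor `D`, a sum `∑ c_t * 2 ^ e_t` whose exponents `e_t` are values of variables
(`foldl_elimStep_spec`). With the powers sorted by decreasing exponents, Horner's scheme evaluates
the sum from the top (`foldl_hornerStep_spec`), multiplying by `2 ^ (e_t - e_(t+1))` in between.
The differences of exponents may be huge, but they matter only up to a bound `B` that is linear in
the length of the program: when a nonzero intermediate value meets a gap of at least `B`, the
remaining summands are too small to change its sign, and then `|x_p - x_q|` is at least `B` as
well.

Therefore a comparison of `x_p` and `x_q` that knows the sorted list of powers together with the
gaps `2 ^ min (e_t - e_(t+1)) B` yields the sign of `x_p - x_q` and, if it is nonnegative, the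
number `2 ^ min (x_p - x_q) B` (`compareVars_spec`). That is what is needed in order to insert the
next power `2 ^ x_v` into the sorted list, `x_v` being compared with the exponents in the list
(`insertPow_spec`). Integrality makes the exponents natural numbers: if `x_v` and `2 ^ x_v` are
integers, then `x_v` is nonnegative. After all assignments have been treated, one more comparison,
with `x_0 = 0`, answers the question (`rowsNonneg_eq`, `lastNonneg_encode`). A polynomial number
of arithmetic operations on numbers with polynomially many digits is carried out.

For the running time, structured programs on finitely many stacks are compiled into multi-stack
Turing machines (`StackProg.Exec.iterate_step`). All data are binary trees in prefix notation on
one stack, and `PolyTime f` says that some program replaces the tree of `x` by that of `f x` in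
polynomial time. This class of functions is closed under composition, pairing and case
distinction, and under folds over lists as long as the intermediate values have polynomial size
(`PolyTime.foldl`); the procedure is built from these operations (`PolyTime.lastNonneg`).
-/

/-! ### Structured programs on stacks and their compilation to Turing machines -/

/-- Structured programs acting on a family of stacks with alphabets `Γ k` and on a register of
type `σ`.  The tests of `ite` and `loop` read the register only. -/
inductive StackProg {K : Type} (Γ : K → Type) (σ : Type) : Type
  | push (k : K) (f : σ → Γ k) : StackProg Γ σ
  | pop (k : K) (f : σ → Option (Γ k) → σ) : StackProg Γ σ
  | load (f : σ → σ) : StackProg Γ σ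
  | seq (p q : StackProg Γ σ) : StackProg Γ σ
  | ite (c : σ → Bool) (p q : StackProg Γ σ) : StackProg Γ σ
  | loop (c : σ → Bool) (p : StackProg Γ σ) : StackProg Γ σ

namespace StackProg

open Turing

variable {K : Type} {Γ : K → Type} {σ Λ : Type}

/-- The program points of a program. -/
def Label : StackProg Γ σ → Type
  | push _ _ => Unit
  | pop _ _ => Unit
  | load _ => Unit
  | seq p q => p.Label ⊕ q.Label
  | ite _ p q => Option (p.Label ⊕ q.Label)
  | loop _ p => Option p.Label

/-- The program point at which execution starts. -/
def entry : (p : StackProg Γ σ) → p.Label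
  | push _ _ => ()
  | pop _ _ => ()
  | load _ => ()
  | seq p _ => Sum.inl p.entry
  | ite _ _ _ => none
  | loop _ _ => none

instance finite_label : (p : StackProg Γ σ) → Finite p.Label
  | push _ _ => inferInstanceAs (Finite Unit)
  | pop _ _ => inferInstanceAs (Finite Unit)
  | load _ => inferInstanceAs (Finite Unit)
  | seq p q =>
    have := finite_label p
    have := finite_label q
    inferInstanceAs (Finite (p.Label ⊕ q.Label))
  | ite _ p q =>
    have := finite_label p
    have := finite_label q
    inferInstanceAs (Finite (Option (p.Label ⊕ q.Label)))
  | loop _ p =>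
    have := finite_label p
    inferInstanceAs (Finite (Option p.Label))

/-- The statement placed at each program point, when the points are named through `i` and the
program jumps to `e` on completion. -/
def code : (p : StackProg Γ σ) → (p.Label → Λ) → Λ → p.Label → TM2.Stmt Γ Λ σ
  | push k f, _, e, _ => .push k f (.goto fun _ => e)
  | pop k f, _, e, _ => .pop k f (.goto fun _ => e)
  | load f, _, e, _ => .load f (.goto fun _ => e)
  | seq p q, i, _, .inl l => p.code (fun a => i (.inl a)) (i (.inr q.entry)) l
  | seq _ q, i, e, .inr l => q.code (fun a => i (.inr a)) e l
  | ite c p q, i, _, none =>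
    .branch c (.goto fun _ => i (some (.inl p.entry))) (.goto fun _ => i (some (.inr q.entry)))
  | ite _ p _, i, e, some (.inl l) => p.code (fun a => i (some (.inl a))) e l
  | ite _ _ q, i, e, some (.inr l) => q.code (fun a => i (some (.inr a))) e l
  | loop c p, i, e, none => .branch c (.goto fun _ => i (some p.entry)) (.goto fun _ => e)
  | loop _ p, i, _, some l => p.code (fun a => i (some a)) (i none) l

variable [DecidableEq K]

/-- `p.Exec v S v' S' t`: started with register `v` and stacks `S`, the program `p` stops after
`t` steps with register `v'` and stacks `S'`. -/
inductive Exec : StackProg Γ σ → σ → (∀ k, List (Γ k)) → σ → (∀ k, List (Γ k)) → ℕ → Prop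
  | push {k f v S} : Exec (push k f) v S v (Function.update S k (f v :: S k)) 1
  | pop {k f v S} :
    Exec (pop k f) v S (f v (S k).head?) (Function.update S k (S k).tail) 1
  | load {f v S} : Exec (load f) v S (f v) S 1
  | seq {p q v S v' S' v'' S'' t t'} (hp : Exec p v S v' S' t) (hq : Exec q v' S' v'' S'' t') :
    Exec (seq p q) v S v'' S'' (t' + t)
  | ite_true {c p q v S v' S' t} (hc : c v = true) (hp : Exec p v S v' S' t) :
    Exec (ite c p q) v S v' S' (t + 1)
  | ite_false {c p q v S v' S' t} (hc : c v = false) (hq : Exec q v S v' S' t) :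
    Exec (ite c p q) v S v' S' (t + 1)
  | loop_false {c p v S} (hc : c v = false) : Exec (loop c p) v S v S 1
  | loop_true {c p v S v' S' v'' S'' t t'} (hc : c v = true) (hp : Exec p v S v' S' t)
    (hl : Exec (loop c p) v' S' v'' S'' t') : Exec (loop c p) v S v'' S'' (t' + (t + 1))

/-- A machine that contains the compiled code of `p` simulates `p` step by step. -/
theorem Exec.iterate_step {p : StackProg Γ σ} {v v' S S' t} (h : Exec p v S v' S' t)
    (M : Λ → TM2.Stmt Γ Λ σ) (i : p.Label → Λ) (e : Λ) (hM : ∀ l, M (i l) = p.code i e l) :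
    (flip bind (TM2.step M))^[t] (some ⟨some (i p.entry), v, S⟩) = some ⟨some e, v', S'⟩ := by
  have first : ∀ (q : StackProg Γ σ) (j : q.Label → Λ) (e : Λ), (∀ l, M (j l) = q.code j e l) →
      ∀ v S, flip bind (TM2.step M) (some ⟨some (j q.entry), v, S⟩) =
        some (TM2.stepAux (q.code j e q.entry) v S) := by
    intro q j e hM v S
    rw [← hM]; rfl
  induction h generalizing e with
  | push => exact first _ i e hM _ _
  | pop => exact first _ i e hM _ _
  | load => exact first _ i e hM _ _
  | seq _ _ ihp ihq =>
    rw [Function.iterate_add_apply]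
    exact (congrArg _ (ihp (fun a => i (.inl a)) _ fun l => hM (.inl l))).trans
      (ihq (fun a => i (.inr a)) _ fun l => hM (.inr l))
  | ite_true hc _ ih =>
    rw [Function.iterate_add_apply, Function.iterate_one, first _ i e hM, entry, code,
      TM2.stepAux, hc]
    exact ih (fun a => i (some (.inl a))) e fun l => hM (some (.inl l))
  | ite_false hc _ ih =>
    rw [Function.iterate_add_apply, Function.iterate_one, first _ i e hM, entry, code,
      TM2.stepAux, hc]
    exact ih (fun a => i (some (.inr a))) e fun l => hM (some (.inr l))
  | loop_false hc =>
    rw [Function.iterate_one, first _ i e hM, entry, code, TM2.stepAux, hc]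
    rfl
  | loop_true hc _ _ ihp ihl =>
    rw [Function.iterate_add_apply, Function.iterate_add_apply, Function.iterate_one,
      first _ i e hM, entry, code, TM2.stepAux, hc]
    exact (congrArg _ (ihp (fun a => i (some a)) (i none) fun l => hM (some l))).trans
      (ihl i e hM)

/-- A program adds at most one symbol to a stack in each step. -/
theorem Exec.length_le {p : StackProg Γ σ} {v v' S S' t} (h : Exec p v S v' S' t) (k : K) :
    (S' k).length ≤ (S k).length + t := by
  induction h with
  | @push k' f v S =>
    by_cases hk : k = k'
    · subst hk; simp
    · simp [Function.update_of_ne hk]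
  | @pop k' f v S =>
    by_cases hk : k = k'
    · subst hk; simp; omega
    · simp [Function.update_of_ne hk]
  | load => simp
  | seq _ _ h1 h2 => omega
  | ite_true _ _ h1 => omega
  | ite_false _ _ h1 => omega
  | loop_false => omega
  | loop_true _ _ _ h1 h2 => omega

end StackProg

/-! ### Binary trees on a stack -/

/-- Binary trees, the universal data type of the computations below. -/
inductive BinTree : Type
  | leaf : BinTree
  | node (l r : BinTree) : BinTree

/-- A tree in prefix notation, `true` standing for a node and `false` for a leaf. -/
def BinTree.word : BinTree → List Bool
  | leaf => [false]
  | node l r => true :: (l.word ++ r.word)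

/-- The stacks used for trees: the stack `main` holds the prefix notations of trees, the others are
scratch space. -/
inductive WorkStack : Type
  | main | tmp | aux | cnt
  deriving DecidableEq

instance : Fintype WorkStack := ⟨{.main, .tmp, .aux, .cnt}, fun w => by cases w <;> simp⟩

/-- The alphabets of the input stack `none` and of the work stacks. -/
abbrev StackAlphabet : Option WorkStack → Type
  | none => LESLPSymbol
  | some _ => Bool

/-- The register remembers the symbol popped last from the input stack and the one popped last from
a work stack. -/
abbrev Register : Type := Option LESLPSymbol × Option Bool

/-- Programs with an input stack and work stacks. -/
abbrev WorkProg : Type := StackProg StackAlphabet Register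

/-- The contents of all stacks, put together from those of the input and work stacks. -/
def stackFam (i : List LESLPSymbol) (s : WorkStack → List Bool) : ∀ k, List (StackAlphabet k)
  | none => i
  | some w => s w

/-- The contents of the work stacks, listed one by one. -/
def work (m t u c : List Bool) : WorkStack → List Bool
  | .main => m
  | .tmp => t
  | .aux => u
  | .cnt => c

section Update

variable (i : List LESLPSymbol) (s : WorkStack → List Bool) (m t u c x : List Bool)

theorem update_stackFam_some (w : WorkStack) :
    Function.update (stackFam i s) (some w) x = stackFam i (Function.update s w x) := by
  funext k
  rcases k with _ | k
  · rfl
  · by_cases h : k = w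
    · subst h; simp [stackFam]
    · simp [stackFam, h]

theorem update_stackFam_none (j : List LESLPSymbol) :
    Function.update (stackFam i s) none j = stackFam j s := by
  funext k
  rcases k with _ | k <;> rfl

@[simp] theorem update_work_main : Function.update (work m t u c) .main x = work x t u c := by
  funext k; cases k <;> rfl

@[simp] theorem update_work_tmp : Function.update (work m t u c) .tmp x = work m x u c := by
  funext k; cases k <;> rfl

@[simp] theorem update_work_aux : Function.update (work m t u c) .aux x = work m t x c := by
  funext k; cases k <;> rfl

@[simp] theorem update_work_cnt : Function.update (work m t u c) .cnt x = work m t u x := by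
  funext k; cases k <;> rfl

end Update

namespace WorkProg

open StackProg

/-- `Run p v S v' S' T`: the program stops within `T` steps, taking register and stacks from `v`,
`S` to `v'`, `S'`. -/
def Run (p : WorkProg) (v : Register) (S : ∀ k, List (StackAlphabet k)) (v' : Register)
    (S' : ∀ k, List (StackAlphabet k)) (T : ℕ) : Prop :=
  ∃ t ≤ T, p.Exec v S v' S' t

variable {p q : WorkProg} {v v' v'' : Register} {S S' S'' : ∀ k, List (StackAlphabet k)}
  {T T' : ℕ} {i : List LESLPSymbol} {s : WorkStack → List Bool} {m d u c : List Bool}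

theorem Run.mono (h : Run p v S v' S' T) (hT : T ≤ T') : Run p v S v' S' T' :=
  let ⟨t, ht, e⟩ := h
  ⟨t, ht.trans hT, e⟩

theorem Run.seq (h : Run p v S v' S' T) (h' : Run q v' S' v'' S'' T') :
    Run (.seq p q) v S v'' S'' (T + T') :=
  let ⟨_, ht, e⟩ := h
  let ⟨_, ht', e'⟩ := h'
  ⟨_, by omega, .seq e e'⟩

theorem Run.ite_true {c : Register → Bool} (hc : c v = true) (h : Run p v S v' S' T) :
    Run (.ite c p q) v S v' S' (T + 1) :=
  let ⟨_, ht, e⟩ := h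
  ⟨_, by omega, .ite_true hc e⟩

theorem Run.ite_false {c : Register → Bool} (hc : c v = false) (h : Run q v S v' S' T) :
    Run (.ite c p q) v S v' S' (T + 1) :=
  let ⟨_, ht, e⟩ := h
  ⟨_, by omega, .ite_false hc e⟩

theorem Run.loop_false {c : Register → Bool} (hc : c v = false) :
    Run (.loop c p) v S v S 1 :=
  ⟨_, le_rfl, .loop_false hc⟩

theorem Run.loop_true {c : Register → Bool} (hc : c v = true) (h : Run p v S v' S' T)
    (h' : Run (.loop c p) v' S' v'' S'' T') : Run (.loop c p) v S v'' S'' (T' + (T + 1)) :=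
  let ⟨_, ht, e⟩ := h
  let ⟨_, ht', e'⟩ := h'
  ⟨_, by omega, .loop_true hc e e'⟩

theorem Run.load (f : Register → Register) : Run (.load f) v S (f v) S 1 :=
  ⟨_, le_rfl, .load⟩

/-- Push a fixed bit. -/
def pushBit (w : WorkStack) (b : Bool) : WorkProg := .push (some w) fun _ => b

/-- Push the bit in the register. -/
def pushReg (w : WorkStack) : WorkProg := .push (some w) fun v => v.2.getD false

/-- Pop a bit into the register. -/
def popBit (w : WorkStack) : WorkProg := .pop (some w) fun v x => (v.1, x)

/-- Whether the last `popBit` has found a bit. -/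
def hasBit (v : Register) : Bool := v.2.isSome

/-- Whether the bit in the register is `true`. -/
def bitTrue (v : Register) : Bool := v.2.getD false

theorem run_pushBit (w : WorkStack) (b : Bool) : Run (pushBit w b) v (stackFam i s) v
    (stackFam i (Function.update s w (b :: s w))) 1 := by
  rw [← update_stackFam_some]
  exact ⟨1, le_rfl, .push⟩

theorem run_pushBit_main (b : Bool) : Run (pushBit .main b) v (stackFam i (work m d u c)) v
    (stackFam i (work (b :: m) d u c)) 1 := by
  simpa [work] using run_pushBit (v := v) (i := i) (s := work m d u c) .main b

theorem run_pushReg (w : WorkStack) : Run (pushReg w) v (stackFam i s) v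
    (stackFam i (Function.update s w (v.2.getD false :: s w))) 1 := by
  rw [← update_stackFam_some]
  exact ⟨1, le_rfl, .push⟩

theorem run_popBit (w : WorkStack) : Run (popBit w) v (stackFam i s) (v.1, (s w).head?)
    (stackFam i (Function.update s w (s w).tail)) 1 := by
  rw [← update_stackFam_some]
  exact ⟨1, le_rfl, .pop⟩

/-- Move the contents of a stack onto another one, reversing their order. -/
def pour (w w' : WorkStack) : WorkProg :=
  .seq (popBit w) (.loop hasBit (.seq (pushReg w') (popBit w)))

theorem run_pour {w w' : WorkStack} (h : w ≠ w') : Run (pour w w') v (stackFam i s) (v.1, none)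
    (stackFam i (Function.update (Function.update s w []) w' ((s w).reverse ++ s w')))
    (3 * (s w).length + 2) := by
  have loop : ∀ (l : List Bool) (s : WorkStack → List Bool), s w = l.tail →
      Run (.loop hasBit (.seq (pushReg w') (popBit w))) (v.1, l.head?) (stackFam i s) (v.1, none)
      (stackFam i (Function.update (Function.update s w []) w' (l.reverse ++ s w')))
      (3 * l.length + 1) := by
    intro l
    induction l with
    | nil =>
      intro s hs
      have e : Function.update (Function.update s w []) w' ([].reverse ++ s w') = s := by
        simp only [List.tail_nil] at hs
        funext x
        by_cases hx : x = w <;> by_cases hx' : x = w' <;> simp_all [Function.update_apply]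
      rw [e]
      exact Run.loop_false rfl
    | cons b l ih =>
      intro s hs
      refine (Run.loop_true rfl ((run_pushReg w').seq (run_popBit w)) ?_).mono
        (T := 3 * l.length + 1 + (1 + 1 + 1)) (by simp; omega)
      have hs' : s w = l := hs
      simp only [Function.update_of_ne h, hs']
      have H := ih (Function.update (Function.update s w' (b :: s w')) w l.tail) (by simp)
      have e : Function.update (Function.update s w []) w' ((b :: l).reverse ++ s w') =
          Function.update (Function.update (Function.update (Function.update s w' (b :: s w')) w
            l.tail) w []) w' (l.reverse ++
              Function.update (Function.update s w' (b :: s w')) w l.tail w') := by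
        funext x
        by_cases hx : x = w <;> by_cases hx' : x = w' <;> simp_all [Function.update_apply]
      rw [e]
      exact H
  have H := (run_popBit (v := v) (i := i) w).seq
    (loop (s w) (Function.update s w (s w).tail) (by simp))
  rw [Function.update_idem, Function.update_of_ne h.symm] at H
  exact H.mono (by omega)

/-- Empty a stack. -/
def clear (w : WorkStack) : WorkProg :=
  .seq (popBit w) (.loop hasBit (popBit w))

theorem run_clear {w : WorkStack} : Run (clear w) v (stackFam i s) (v.1, none)
    (stackFam i (Function.update s w [])) (2 * (s w).length + 2) := by
  have loop : ∀ (l : List Bool) (s : WorkStack → List Bool), s w = l.tail →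
      Run (.loop hasBit (popBit w)) (v.1, l.head?) (stackFam i s) (v.1, none)
      (stackFam i (Function.update s w [])) (2 * l.length + 1) := by
    intro l
    induction l with
    | nil =>
      intro s hs
      have e : Function.update s w [] = s := by
        simp only [List.tail_nil] at hs
        simp [← hs]
      rw [e]
      exact Run.loop_false rfl
    | cons b l ih =>
      intro s hs
      refine (Run.loop_true rfl (run_popBit w) ?_).mono
        (T := 2 * l.length + 1 + (1 + 1)) (by simp; omega)
      have hs' : s w = l := hs
      simpa [hs'] using ih (Function.update s w l.tail) (by simp)
  have H := (run_popBit (v := v) (i := i) w).seq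
    (loop (s w) (Function.update s w (s w).tail) (by simp))
  rw [Function.update_idem] at H
  exact H.mono (by omega)

/-- Copy the contents of the scratch stack `tmp` to the main stack and to `aux`. -/
def pourBoth : WorkProg :=
  .seq (popBit .tmp) (.loop hasBit (.seq (pushReg .main) (.seq (pushReg .aux) (popBit .tmp))))

theorem run_pourBoth : Run pourBoth v (stackFam i (work m d u c)) (v.1, none)
    (stackFam i (work (d.reverse ++ m) [] (d.reverse ++ u) c)) (4 * d.length + 2) := by
  have loop : ∀ (l m u : List Bool),
      Run (.loop hasBit (.seq (pushReg .main) (.seq (pushReg .aux) (popBit .tmp)))) (v.1, l.head?)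
      (stackFam i (work m l.tail u c)) (v.1, none)
      (stackFam i (work (l.reverse ++ m) [] (l.reverse ++ u) c)) (4 * l.length + 1) := by
    intro l
    induction l with
    | nil => exact fun m u => Run.loop_false rfl
    | cons b l ih =>
      intro m u
      refine (Run.loop_true rfl
        ((run_pushReg .main).seq ((run_pushReg .aux).seq (run_popBit .tmp))) ?_).mono
        (T := 4 * l.length + 1 + (1 + (1 + 1) + 1)) (by simp; omega)
      simpa [work] using ih (b :: m) (b :: u)
  have := (run_popBit (v := v) (i := i) (s := work m d u c) .tmp).seq
    (by simpa [work] using loop d m u)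
  exact this.mono (by omega)

/-- Move symbols from the main stack to `tmp` until a whole tree has been moved. The stack `cnt`
holds one symbol for each subtree that remains to be read after the current one, and the register
holds a bit as long as there is a current one. -/
def readLoop : WorkProg :=
  .loop hasBit (.seq (popBit .main) (.seq (pushReg .tmp) (.seq
    (.ite bitTrue (.seq (pushBit .cnt true) (pushBit .cnt true)) (.load id)) (popBit .cnt))))

/-- Reading the tree `t` takes the loop to the state in which it goes on with the subtrees recorded
on the stack `cnt`. -/
theorem run_readLoop (t : BinTree) {a : Option LESLPSymbol} {b : Bool}
    (h : Run readLoop (a, c.head?) (stackFam i (work m (t.word.reverse ++ d) u c.tail)) v' S' T) :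
    Run readLoop (a, some b) (stackFam i (work (t.word ++ m) d u c)) v' S'
      (T + 7 * t.word.length) := by
  induction t generalizing m d c b T with
  | leaf =>
    have H := Run.loop_true (v := (a, some b)) (c := hasBit) rfl ((run_popBit .main).seq
      ((run_pushReg .tmp).seq ((Run.ite_false (c := bitTrue)
        (p := .seq (pushBit .cnt true) (pushBit .cnt true)) ?_ (Run.load id)).seq
          (run_popBit .cnt)))) (S := stackFam i (work (BinTree.leaf.word ++ m) d u c))
      (v'' := v') (S'' := S') (T' := T) ?_
    · exact H.mono (by simp [BinTree.word])
    · rfl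
    · simpa [BinTree.word, work, readLoop] using h
  | node l r hl hr =>
    have H := Run.loop_true (v := (a, some b)) (c := hasBit) rfl ((run_popBit .main).seq
      ((run_pushReg .tmp).seq ((Run.ite_true (c := bitTrue) (q := .load id)
        ?_ ((run_pushBit .cnt true).seq (run_pushBit .cnt true))).seq
          (run_popBit .cnt)))) (S := stackFam i (work ((BinTree.node l r).word ++ m) d u c))
      (v'' := v') (S'' := S') (T' := T + 7 * r.word.length + 7 * l.word.length) ?_
    · exact H.mono (by simp [BinTree.word]; omega)
    · rfl
    · have := hl (m := r.word ++ m) (d := true :: d) (c := true :: c) (b := true)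
        (hr (m := m) (d := l.word.reverse ++ true :: d) (c := c) (b := true)
          (by simpa [BinTree.word] using h))
      simpa [BinTree.word, work, readLoop] using this

/-- Move the topmost tree from the main stack to `tmp`. -/
def read : WorkProg := .seq (.load fun v => (v.1, some true)) readLoop

theorem run_read (t : BinTree) : Run read v (stackFam i (work (t.word ++ m) d u [])) (v.1, none)
    (stackFam i (work m (t.word.reverse ++ d) u [])) (7 * t.word.length + 2) :=
  ((Run.load _).seq (run_readLoop t (Run.loop_false rfl))).mono (by omega)

/-- Duplicate the topmost tree. -/
def dup : WorkProg := .seq read (.seq pourBoth (.seq (pour .aux .tmp) (pour .tmp .main)))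

theorem run_dup (t : BinTree) : Run dup v (stackFam i (work (t.word ++ m) [] [] [])) (v.1, none)
    (stackFam i (work (t.word ++ (t.word ++ m)) [] [] [])) (17 * t.word.length + 8) := by
  have h1 := run_read (v := v) (i := i) (m := m) (d := []) (u := []) t
  have h2 := run_pourBoth (v := (v.1, none)) (i := i) (m := m) (d := t.word.reverse ++ []) (u := [])
    (c := [])
  have h3 := run_pour (v := (v.1, none)) (i := i) (w := .aux) (w' := .tmp)
    (s := work (t.word ++ m) [] t.word []) (by decide)
  have h4 := run_pour (v := (v.1, none)) (i := i) (w := .tmp) (w' := .main)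
    (s := work (t.word ++ m) t.word.reverse [] []) (by decide)
  simp [work] at h2 h3 h4 h1
  exact (h1.seq (h2.seq (h3.seq h4))).mono (by omega)

/-- Remove the topmost tree. -/
def drop : WorkProg := .seq read (clear .tmp)

theorem run_drop (t : BinTree) : Run drop v (stackFam i (work (t.word ++ m) [] [] [])) (v.1, none)
    (stackFam i (work m [] [] [])) (9 * t.word.length + 4) := by
  have h1 := run_read (v := v) (i := i) (m := m) (d := []) (u := []) t
  have h2 := run_clear (v := (v.1, none)) (i := i) (w := .tmp)
    (s := work m (t.word.reverse ++ []) [] [])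
  simp [work] at h1 h2
  exact (h1.seq h2).mono (by omega)

/-- Exchange the two topmost trees. -/
def swap : WorkProg :=
  .seq read (.seq (pour .tmp .aux) (.seq read (.seq (pour .aux .cnt)
    (.seq (pour .cnt .main) (pour .tmp .main)))))

theorem run_swap (t t' : BinTree) :
    Run swap v (stackFam i (work (t.word ++ (t'.word ++ m)) [] [] [])) (v.1, none)
    (stackFam i (work (t'.word ++ (t.word ++ m)) [] [] []))
    (16 * t.word.length + 10 * t'.word.length + 12) := by
  have h1 := run_read (v := v) (i := i) (m := t'.word ++ m) (d := []) (u := []) t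
  have h2 := run_pour (v := (v.1, none)) (i := i) (w := .tmp) (w' := .aux)
    (s := work (t'.word ++ m) t.word.reverse [] []) (by decide)
  have h3 := run_read (v := (v.1, none)) (i := i) (m := m) (d := []) (u := t.word) t'
  have h4 := run_pour (v := (v.1, none)) (i := i) (w := .aux) (w' := .cnt)
    (s := work m t'.word.reverse t.word []) (by decide)
  have h5 := run_pour (v := (v.1, none)) (i := i) (w := .cnt) (w' := .main)
    (s := work m t'.word.reverse [] t.word.reverse) (by decide)
  have h6 := run_pour (v := (v.1, none)) (i := i) (w := .tmp) (w' := .main)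
    (s := work (t.word ++ m) t'.word.reverse [] []) (by decide)
  simp [work] at h1 h2 h3 h4 h5 h6
  exact (h1.seq (h2.seq (h3.seq (h4.seq (h5.seq h6))))).mono (by omega)

end WorkProg

/-! ### Functions computable in polynomial time on trees -/

/-- A type whose elements are represented by binary trees. -/
class TreeCode (α : Type) where
  /-- The tree representing an element. -/
  enc : α → BinTree

open TreeCode (enc)

/-- The length of the prefix notation of the tree that represents `x`. -/
def codeSize {α : Type} [TreeCode α] (x : α) : ℕ := (enc x).word.length

instance : TreeCode Bool := ⟨fun b => bif b then .node .leaf .leaf else .leaf⟩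

instance {α β : Type} [TreeCode α] [TreeCode β] : TreeCode (α × β) :=
  ⟨fun x => .node (enc x.1) (enc x.2)⟩

/-- A list is represented by the right comb of its elements. -/
def encList {α : Type} [TreeCode α] : List α → BinTree
  | [] => .leaf
  | a :: l => .node (enc a) (encList l)

instance {α : Type} [TreeCode α] : TreeCode (List α) := ⟨encList⟩

section Size

variable {α β : Type} [TreeCode α] [TreeCode β]

theorem one_le_codeSize (x : α) : 1 ≤ codeSize x := by
  unfold codeSize
  cases enc x <;> simp [BinTree.word]

theorem codeSize_prod (x : α × β) : codeSize x = codeSize x.1 + codeSize x.2 + 1 := by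
  simp [codeSize, enc, BinTree.word]

@[simp] theorem codeSize_mk (a : α) (b : β) : codeSize (a, b) = codeSize a + codeSize b + 1 :=
  codeSize_prod _

@[simp] theorem codeSize_nil : codeSize ([] : List α) = 1 := rfl

@[simp] theorem codeSize_cons (a : α) (l : List α) :
    codeSize (a :: l) = codeSize a + codeSize l + 1 := by
  simp [codeSize, enc, encList, BinTree.word]

theorem codeSize_bool_le (b : Bool) : codeSize b ≤ 3 := by
  cases b <;> simp [codeSize, enc, BinTree.word]

theorem codeSize_append (l l' : List α) :
    codeSize (l ++ l') + 1 = codeSize l + codeSize l' := by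
  induction l with
  | nil => simp [add_comm]
  | cons a l ih => simp only [List.cons_append, codeSize_cons]; omega

theorem codeSize_reverse (l : List α) :
    codeSize l.reverse = codeSize l := by
  induction l with
  | nil => rfl
  | cons e l ih =>
    have := codeSize_append l.reverse [e]
    simp only [List.reverse_cons, codeSize_cons, codeSize_nil] at *
    omega

theorem length_le_codeSize (l : List α) : l.length ≤ codeSize l := by
  induction l with
  | nil => simp
  | cons a l ih => simp; omega

theorem codeSize_le_of_mem {a : α} {l : List α} (h : a ∈ l) : codeSize a ≤ codeSize l := by
  induction h with
  | head => simp; omega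
  | tail _ _ ih => simp; omega

theorem codeSize_list_le {l : List α} {B : ℕ} (h : ∀ a ∈ l, codeSize a ≤ B) :
    codeSize l ≤ l.length * (B + 1) + 1 := by
  induction l with
  | nil => simp
  | cons a l ih =>
    have := ih fun x hx => h x (by simp [hx])
    have := h a (by simp)
    simp only [codeSize_cons, List.length_cons, add_mul, one_mul] at *
    omega

end Size

/-- The quantity `T x` is bounded by a polynomial in the size of `x`. -/
def PolyBdd {α : Type} [TreeCode α] (T : α → ℕ) : Prop :=
  ∃ P : Polynomial ℕ, ∀ x, T x ≤ P.eval (codeSize x)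

theorem Polynomial.eval_mono_nat (P : Polynomial ℕ) : Monotone fun n => P.eval n := by
  intro a b h
  simp only [Polynomial.eval_eq_sum_range]
  gcongr

namespace PolyBdd

variable {α : Type} [TreeCode α] {T T' : α → ℕ}

theorem mono (h : PolyBdd T) (hT : ∀ x, T' x ≤ T x) : PolyBdd T' :=
  let ⟨P, hP⟩ := h
  ⟨P, fun x => (hT x).trans (hP x)⟩

theorem const (n : ℕ) : PolyBdd fun _ : α => n := ⟨Polynomial.C n, fun x => by simp⟩

theorem id : PolyBdd fun x : α => codeSize x := ⟨Polynomial.X, fun x => by simp⟩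

theorem add (h : PolyBdd T) (h' : PolyBdd T') : PolyBdd fun x => T x + T' x :=
  let ⟨P, hP⟩ := h
  let ⟨P', hP'⟩ := h'
  ⟨P + P', fun x => by simpa using add_le_add (hP x) (hP' x)⟩

theorem mul (h : PolyBdd T) (h' : PolyBdd T') : PolyBdd fun x => T x * T' x :=
  let ⟨P, hP⟩ := h
  let ⟨P', hP'⟩ := h'
  ⟨P * P', fun x => by simpa using Nat.mul_le_mul (hP x) (hP' x)⟩

theorem eval (h : PolyBdd T) (Q : Polynomial ℕ) : PolyBdd fun x => Q.eval (T x) :=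
  let ⟨P, hP⟩ := h
  ⟨Q.comp P, fun x => by simpa using Q.eval_mono_nat (hP x)⟩

end PolyBdd

/-- `Turns p l l' T`: whatever lies below, the program replaces the word `l` on top of the main
stack by `l'` within `T` steps, leaving the other stacks as they are. -/
def Turns (p : WorkProg) (l l' : List Bool) (T : ℕ) : Prop :=
  ∀ v i m, ∃ v', WorkProg.Run p v (stackFam i (work (l ++ m) [] [] [])) v'
    (stackFam i (work (l' ++ m) [] [] [])) T

namespace Turns

open WorkProg

variable {p q : WorkProg} {l l' l'' : List Bool} {T T' : ℕ}

theorem mono (h : Turns p l l' T) (hT : T ≤ T') : Turns p l l' T' := fun v i m =>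
  let ⟨v', h⟩ := h v i m
  ⟨v', h.mono hT⟩

theorem seq (h : Turns p l l' T) (h' : Turns q l' l'' T') : Turns (.seq p q) l l'' (T + T') :=
  fun v i m =>
  let ⟨v', h⟩ := h v i m
  let ⟨v'', h'⟩ := h' v' i m
  ⟨v'', h.seq h'⟩

theorem append (h : Turns p l l' T) (r : List Bool) : Turns p (l ++ r) (l' ++ r) T :=
  fun v i m => by simpa using h v i (r ++ m)

theorem skip (l : List Bool) : Turns (.load id) l l 1 := fun v _ _ => ⟨v, Run.load _⟩

theorem push (b : Bool) (l : List Bool) : Turns (pushBit .main b) l (b :: l) 1 := fun v _ _ =>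
  ⟨v, run_pushBit_main b⟩

theorem pop (b : Bool) (l : List Bool) : Turns (popBit .main) (b :: l) l 1 := fun v i m =>
  ⟨_, by simpa [work] using run_popBit (v := v) (i := i) (s := work (b :: l ++ m) [] [] []) .main⟩

theorem dup (t : BinTree) : Turns WorkProg.dup t.word (t.word ++ t.word) (17 * t.word.length + 8) :=
  fun _ _ _ => ⟨_, by simpa using run_dup t⟩

theorem drop (t : BinTree) : Turns WorkProg.drop t.word [] (9 * t.word.length + 4) :=
  fun _ _ _ => ⟨_, by simpa using run_drop t⟩

theorem swap (t t' : BinTree) : Turns WorkProg.swap (t.word ++ t'.word) (t'.word ++ t.word)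
    (16 * t.word.length + 10 * t'.word.length + 12) :=
  fun _ _ _ => ⟨_, by simpa using run_swap t t'⟩

/-- Pop a bit and branch on it. -/
def popIte (p q : WorkProg) : WorkProg := .seq (popBit .main) (.ite bitTrue p q)

theorem popIte_true (q : WorkProg) (h : Turns p l l' T) :
    Turns (popIte p q) (true :: l) l' (T + 2) :=
  fun v i m => by
    obtain ⟨v', h⟩ := h (v.1, some true) i m
    have := run_popBit (v := v) (i := i) (s := work (true :: l ++ m) [] [] []) .main
    refine ⟨v', (this.seq (Run.ite_true rfl ?_)).mono (Nat.le_of_eq (add_comm 1 _))⟩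
    simpa [work] using h

theorem popIte_false (p : WorkProg) (h : Turns q l l' T) :
    Turns (popIte p q) (false :: l) l' (T + 2) :=
  fun v i m => by
    obtain ⟨v', h⟩ := h (v.1, some false) i m
    have := run_popBit (v := v) (i := i) (s := work (false :: l ++ m) [] [] []) .main
    refine ⟨v', (this.seq (Run.ite_false rfl ?_)).mono (Nat.le_of_eq (add_comm 1 _))⟩
    simpa [work] using h

theorem length_le (h : Turns p l l' T) : l'.length ≤ l.length + T := by
  obtain ⟨v', t, ht, h⟩ := h (none, none) [] []
  have := h.length_le (some .main)
  simp only [stackFam, work, List.append_nil] at this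
  omega

end Turns

/-- `f` is computed in polynomial time by a program that replaces the tree of `x` on top of the main
stack by the tree of `f x`. -/
@[fun_prop]
def PolyTime {α β : Type} [TreeCode α] [TreeCode β] (f : α → β) : Prop :=
  ∃ (p : WorkProg) (P : Polynomial ℕ), ∀ x,
    Turns p (enc x).word (enc (f x)).word (P.eval (codeSize x))

namespace PolyTime

open WorkProg

variable {α β γ δ : Type} [TreeCode α] [TreeCode β] [TreeCode γ] [TreeCode δ]

theorem intro {f : α → β} (p : WorkProg) {T : α → ℕ} (hT : PolyBdd T)
    (h : ∀ x, Turns p (enc x).word (enc (f x)).word (T x)) : PolyTime f :=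
  let ⟨P, hP⟩ := hT
  ⟨p, P, fun x => (h x).mono (hP x)⟩

theorem polyBdd {f : α → β} (h : PolyTime f) : PolyBdd fun x => codeSize (f x) :=
  let ⟨_, P, h⟩ := h
  (PolyBdd.id.add (PolyBdd.id.eval P)).mono fun x => (h x).length_le

/-- A function that does not change the tree. -/
theorem of_enc_eq {f : α → β} (h : ∀ x, enc (f x) = enc x) : PolyTime f :=
  intro (.load _root_.id) (PolyBdd.const 1) fun x => by rw [h]; exact Turns.skip _

@[fun_prop]
theorem id : PolyTime fun x : α => x := of_enc_eq fun _ => rfl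

@[fun_prop]
theorem comp {f : β → γ} {g : α → β} (hf : PolyTime f) (hg : PolyTime g) :
    PolyTime fun x => f (g x) := by
  have hb := hg.polyBdd
  obtain ⟨p, P, hf⟩ := hf
  obtain ⟨q, Q, hg⟩ := hg
  exact intro (.seq q p) ((PolyBdd.id.eval Q).add (hb.eval P)) fun x => (hg x).seq (hf (g x))

/-- Push the tree `t`. -/
def pushTree : BinTree → WorkProg
  | .leaf => pushBit .main false
  | .node l r => .seq (pushTree r) (.seq (pushTree l) (pushBit .main true))

theorem turns_pushTree (t : BinTree) : Turns (pushTree t) [] t.word t.word.length := by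
  induction t with
  | leaf => exact Turns.push false []
  | node l r hl hr =>
    refine (hr.seq ((hl.append r.word).seq (Turns.push true _))).mono ?_
    simp [BinTree.word]; omega

@[fun_prop]
theorem const (b : β) : PolyTime fun _ : α => b :=
  intro (.seq drop (pushTree (enc b))) (T := fun x => 9 * codeSize x + 4 + codeSize b)
    ((((PolyBdd.const 9).mul .id).add (.const 4)).add (.const _))
    fun _ => (Turns.drop _).seq (turns_pushTree _)

@[fun_prop]
theorem prodMk {f : α → β} {g : α → γ} (hf : PolyTime f) (hg : PolyTime g) :
    PolyTime fun x => (f x, g x) := by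
  have bf := hf.polyBdd
  have bg := hg.polyBdd
  obtain ⟨p, P, hf⟩ := hf
  obtain ⟨q, Q, hg⟩ := hg
  refine intro (.seq dup (.seq p (.seq swap (.seq q (.seq swap (pushBit .main true))))))
    (T := fun x => 17 * codeSize x + 8 + (P.eval (codeSize x) +
      (16 * codeSize (f x) + 10 * codeSize x + 12 + (Q.eval (codeSize x) +
        (16 * codeSize (g x) + 10 * codeSize (f x) + 12 + 1))))) ?_ fun x => ?_
  · exact (((PolyBdd.const 17).mul .id).add (.const 8)).add ((PolyBdd.id.eval P).add
      (((((PolyBdd.const 16).mul bf).add ((PolyBdd.const 10).mul .id)).add (.const 12)).add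
      ((PolyBdd.id.eval Q).add (((((PolyBdd.const 16).mul bg).add
        ((PolyBdd.const 10).mul bf)).add (.const 12)).add (.const 1)))))
  · exact (Turns.dup _).seq (((hf x).append _).seq ((Turns.swap _ _).seq
      (((hg x).append _).seq ((Turns.swap _ _).seq (Turns.push true _)))))

@[fun_prop]
theorem fst {f : α → β × γ} (hf : PolyTime f) : PolyTime fun x => (f x).1 := by
  refine comp (f := Prod.fst) ?_ hf
  refine intro (.seq (popBit .main) (.seq swap drop))
    (T := fun x => 1 + (26 * codeSize x + 12 + (9 * codeSize x + 4)))
    ((PolyBdd.const 1).add ((((PolyBdd.const 26).mul .id).add (.const 12)).add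
      (((PolyBdd.const 9).mul .id).add (.const 4)))) fun x => ?_
  have := (Turns.pop true _).seq ((Turns.swap (enc x.1) (enc x.2)).seq
    ((Turns.drop (enc x.2)).append (enc x.1).word))
  refine this.mono ?_
  have := codeSize_prod x
  simp only [codeSize] at *
  omega

@[fun_prop]
theorem snd {f : α → β × γ} (hf : PolyTime f) : PolyTime fun x => (f x).2 := by
  refine comp (f := Prod.snd) ?_ hf
  refine intro (.seq (popBit .main) drop)
    (T := fun x => 1 + (9 * codeSize x + 4))
    ((PolyBdd.const 1).add (((PolyBdd.const 9).mul .id).add (.const 4))) fun x => ?_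
  have := (Turns.pop true _).seq ((Turns.drop (enc x.1)).append (enc x.2).word)
  refine this.mono ?_
  have := codeSize_prod x
  simp only [codeSize] at *
  omega

@[fun_prop]
theorem cond {c : α → Bool} {f g : α → β} (hc : PolyTime c) (hf : PolyTime f) (hg : PolyTime g) :
    PolyTime fun x => bif c x then f x else g x := by
  obtain ⟨r, R, hc⟩ := hc
  obtain ⟨p, P, hf⟩ := hf
  obtain ⟨q, Q, hg⟩ := hg
  refine intro (.seq dup (.seq r (Turns.popIte
    (.seq (popBit .main) (.seq (popBit .main) p)) q)))
    (T := fun x => 17 * codeSize x + 8 + (R.eval (codeSize x) +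
      (P.eval (codeSize x) + Q.eval (codeSize x) + 4))) ?_ fun x => ?_
  · exact (((PolyBdd.const 17).mul .id).add (.const 8)).add ((PolyBdd.id.eval R).add
      (((PolyBdd.id.eval P).add (PolyBdd.id.eval Q)).add (.const 4)))
  · refine (Turns.dup _).seq (((hc x).append _).seq ?_)
    cases c x
    · exact (Turns.popIte_false _ (hg x)).mono (by omega)
    · exact (Turns.popIte_true _ ((Turns.pop false _).seq
        ((Turns.pop false _).seq (hf x)))).mono (by omega)

/-- Case distinction on a list. -/
theorem listCases {h : α → List β} {f : α → γ} {g : α × β × List β → γ} (hh : PolyTime h)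
    (hf : PolyTime f) (hg : PolyTime g) :
    PolyTime fun x => match h x with
      | [] => f x
      | b :: l => g (x, b, l) := by
  have bh := hh.polyBdd
  obtain ⟨r, R, hh⟩ := hh
  obtain ⟨p, P, hf⟩ := hf
  obtain ⟨q, Q, hg⟩ := hg
  refine intro (.seq dup (.seq r (Turns.popIte (.seq (pushBit .main true)
    (.seq swap (.seq (pushBit .main true) q))) p)))
    (T := fun x => 17 * codeSize x + 8 + (R.eval (codeSize x) +
      (16 * codeSize (h x) + 10 * codeSize x + 16 + (P.eval (codeSize x) +
        Q.eval (codeSize x + codeSize (h x) + 1))))) ?_ fun x => ?_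
  · exact (((PolyBdd.const 17).mul .id).add (.const 8)).add ((PolyBdd.id.eval R).add
      (((((PolyBdd.const 16).mul bh).add ((PolyBdd.const 10).mul .id)).add (.const 16)).add
      ((PolyBdd.id.eval P).add (((PolyBdd.id.add bh).add (.const 1)).eval Q))))
  · refine (Turns.dup _).seq (((hh x).append _).seq ?_)
    cases e : h x with
    | nil => exact (Turns.popIte_false _ (hf x)).mono (by omega)
    | cons b l =>
      have e1 : (enc (b :: l)).word ++ (enc x).word =
          true :: ((enc b).word ++ ((enc l).word ++ (enc x).word)) := by
        simp [enc, encList, BinTree.word]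
      have e2 : true :: ((enc b).word ++ ((enc l).word ++ (enc x).word)) =
          (enc (b, l)).word ++ (enc x).word := by
        simp [enc, BinTree.word]
      have H := Turns.popIte_true p (((Turns.push true _).mono le_rfl).seq (e2 ▸
        (Turns.swap (enc (b, l)) (enc x)).seq ((Turns.push true _).seq (hg (x, b, l)))))
      rw [e1]
      refine H.mono ?_
      have : codeSize (x, b, l) = codeSize x + codeSize (b :: l) + 1 := by simp
      rw [this]
      have : (enc (b, l)).word.length = codeSize (b :: l) := by
        rw [codeSize_cons, ← codeSize_mk]; rfl
      rw [this]
      simp only [codeSize]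
      omega

/-- Unpacking a pair whose first component is a list leaves in the register whether the list is
nonempty. -/
theorem run_popBit_popBit (l : List α) (v : Register) (i : List LESLPSymbol) (r : List Bool) :
    Run (.seq (popBit .main) (popBit .main)) v
      (stackFam i (work (true :: ((enc l).word ++ r)) [] [] [])) (v.1, some !l.isEmpty)
      (stackFam i (work ((enc l).word.tail ++ r) [] [] [])) 2 := by
  have h₂ := run_popBit (v := v) (i := i) (s := work (true :: ((enc l).word ++ r)) [] [] []) .main
  have h₃ := run_popBit (v := (v.1, some true)) (i := i)
    (s := work ((enc l).word ++ r) [] [] []) .main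
  refine Run.seq (T := 1) (T' := 1) (v' := (v.1, some true))
    (S' := stackFam i (work ((enc l).word ++ r) [] [] [])) ?_ ?_
  · simpa [work] using h₂
  · cases l <;> simpa [work, enc, encList, BinTree.word] using h₃

/-- A fold over a list is computable in polynomial time if the intermediate values of the
accumulator have polynomial size. -/
theorem foldl {f : α → γ → β → γ} {b : α → γ} {l : α → List β} {S : α → ℕ}
    (hf : PolyTime fun p : α × γ × β => f p.1 p.2.1 p.2.2) (hb : PolyTime b) (hl : PolyTime l)
    (hS : PolyBdd S) (h : ∀ x l₁ l₂, l x = l₁ ++ l₂ → codeSize (l₁.foldl (f x) (b x)) ≤ S x) :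
    PolyTime fun x => (l x).foldl (f x) (b x) := by
  have hinit : PolyTime fun x => (l x, b x, x) := by fun_prop
  have hstep : PolyTime fun p : (β × List β) × γ × α =>
      (p.1.2, f p.2.2 p.2.1 p.1.1, p.2.2) := by
    refine prodMk (by fun_prop) (prodMk (comp (f := fun p : α × γ × β => f p.1 p.2.1 p.2.2)
      (g := fun p : (β × List β) × γ × α => (p.2.2, p.2.1, p.1.1)) hf (by fun_prop)) (by fun_prop))
  have hfin : PolyTime fun p : γ × α => p.1 := by fun_prop
  have bl := hl.polyBdd
  obtain ⟨pi, I, hinit⟩ := hinit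
  obtain ⟨ps, P, hstep⟩ := hstep
  obtain ⟨pf, F, hfin⟩ := hfin
  -- The loop runs with the list, the accumulator and `x` on the stack, the first symbol of the
  -- list, which tells whether it is empty, being kept in the register.
  let body : WorkProg := .seq (pushBit .main true) (.seq (pushBit .main true)
    (.seq ps (.seq (popBit .main) (popBit .main))))
  let B : α → ℕ := fun x => P.eval (codeSize (l x) + (S x + codeSize x + 1) + 1) + 5
  have hloop : ∀ x (l₂ l₁ : List β), l x = l₁ ++ l₂ → ∀ v : Register, bitTrue v = !l₂.isEmpty →
      ∀ i m, ∃ v', Run (.loop bitTrue body) v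
        (stackFam i (work ((enc l₂).word.tail ++
          ((enc (l₁.foldl (f x) (b x), x)).word ++ m)) [] [] [])) v'
        (stackFam i (work ((enc ((l x).foldl (f x) (b x), x)).word ++ m) [] [] []))
        (l₂.length * B x + 1) := by
    intro x l₂
    induction l₂ with
    | nil =>
      intro l₁ hx v hv i m
      rw [hx]
      exact ⟨v, by simpa [enc, encList, BinTree.word] using Run.loop_false hv⟩
    | cons a l₂ ih =>
      intro l₁ hx v hv i m
      set g := l₁.foldl (f x) (b x) with hg
      obtain ⟨v₁, h₁⟩ := hstep ((a, l₂), (g, x)) v i m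
      have h₂ := run_popBit_popBit l₂ v₁ i ((enc (f x g a, x)).word ++ m)
      have e₁ : true :: ((enc l₂).word ++ ((enc (f x g a, x)).word ++ m)) =
          (enc (l₂, f x g a, x)).word ++ m := by
        simp [enc, BinTree.word]
      have e₂ : (enc ((a, l₂), g, x)).word ++ m =
          true :: true :: ((enc (a :: l₂)).word.tail ++ ((enc (g, x)).word ++ m)) := by
        simp [enc, encList, BinTree.word]
      rw [e₁] at h₂
      rw [e₂] at h₁
      have h₃ := (run_pushBit_main true).seq ((run_pushBit_main true).seq (h₁.seq h₂))
      have hP : P.eval (codeSize ((a, l₂), g, x)) ≤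
          P.eval (codeSize (l x) + (S x + codeSize x + 1) + 1) := by
        refine P.eval_mono_nat ?_
        have : codeSize g ≤ S x := h x l₁ (a :: l₂) hx
        have := codeSize_append l₁ (a :: l₂)
        have := one_le_codeSize l₁
        rw [← hx] at *
        simp only [codeSize_cons, codeSize_mk] at *
        omega
      obtain ⟨v', hv'⟩ := ih (l₁ ++ [a]) (by simp [hx]) (v₁.1, some !l₂.isEmpty) rfl i m
      rw [List.foldl_append, List.foldl_cons, List.foldl_nil, ← hg] at hv'
      refine ⟨v', (Run.loop_true hv (h₃.mono (T' := B x - 1) ?_) hv').mono ?_⟩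
      · simp only [B]
        omega
      · have : 5 ≤ B x := by simp [B]
        simp only [List.length_cons, add_mul, one_mul]
        omega
  refine intro (.seq pi (.seq (.seq (popBit .main) (popBit .main)) (.seq (.loop bitTrue body) pf)))
    (T := fun x => I.eval (codeSize x) + (2 + (codeSize (l x) * B x + 1 +
      F.eval (S x + codeSize x + 1)))) ?_ fun x v i m => ?_
  · exact (PolyBdd.id.eval I).add ((PolyBdd.const 2).add
      (((bl.mul ((((bl.add ((hS.add .id).add (.const 1))).add (.const 1)).eval P).add
        (.const 5))).add (.const 1)).add (((hS.add .id).add (.const 1)).eval F)))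
  · obtain ⟨v₁, h₁⟩ := hinit x v i m
    have h₂ := run_popBit_popBit (l x) v₁ i ((enc (b x, x)).word ++ m)
    obtain ⟨v₂, h₄⟩ := hloop x (l x) [] rfl (v₁.1, some !(l x).isEmpty) rfl i m
    obtain ⟨v₃, h₅⟩ := hfin ((l x).foldl (f x) (b x), x) v₂ i m
    have e : true :: ((enc (l x)).word ++ ((enc (b x, x)).word ++ m)) =
        (enc (l x, b x, x)).word ++ m := by
      simp [enc, BinTree.word]
    rw [e] at h₂
    refine ⟨v₃, (h₁.seq (h₂.seq (h₄.seq h₅))).mono ?_⟩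
    · have h₁ := h x (l x) [] (by simp)
      gcongr
      · exact length_le_codeSize _
      · refine F.eval_mono_nat ?_
        simpa using h₁

end PolyTime

/-! ### Lists and Booleans -/

namespace PolyTime

variable {α β γ : Type} [TreeCode α] [TreeCode β] [TreeCode γ]

@[fun_prop]
theorem cons {f : α → β} {g : α → List β} (hf : PolyTime f) (hg : PolyTime g) :
    PolyTime fun x => f x :: g x :=
  comp (f := fun p : β × List β => p.1 :: p.2) (of_enc_eq fun _ => rfl) (hf.prodMk hg)

@[fun_prop]
theorem tail {f : α → List β} (hf : PolyTime f) : PolyTime fun x => (f x).tail := by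
  have := listCases (g := fun p : α × β × List β => p.2.2) hf (const []) (by fun_prop)
  convert this using 2 with x
  cases f x <;> rfl

@[fun_prop]
theorem headD {f : α → List β} {g : α → β} (hf : PolyTime f) (hg : PolyTime g) :
    PolyTime fun x => (f x).headD (g x) := by
  have := listCases (g := fun p : α × β × List β => p.2.1) hf hg (by fun_prop)
  convert this using 2 with x
  cases f x <;> rfl

@[fun_prop]
theorem isEmpty {f : α → List β} (hf : PolyTime f) : PolyTime fun x => (f x).isEmpty := by
  have := listCases (g := fun p : α × β × List β => false) hf (const true) (by fun_prop)
  convert this using 2 with x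
  cases f x <;> rfl

@[fun_prop]
theorem not {f : α → Bool} (hf : PolyTime f) : PolyTime fun x => !f x := by
  have := hf.cond (const false) (const true)
  convert this using 2 with x
  cases f x <;> rfl

@[fun_prop]
theorem and {f g : α → Bool} (hf : PolyTime f) (hg : PolyTime g) :
    PolyTime fun x => f x && g x := by
  have := hf.cond hg (const false)
  convert this using 2 with x
  cases f x <;> rfl

@[fun_prop]
theorem or {f g : α → Bool} (hf : PolyTime f) (hg : PolyTime g) :
    PolyTime fun x => f x || g x := by
  have := hf.cond (const true) hg
  convert this using 2 with x
  cases f x <;> rfl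

@[fun_prop]
theorem xor {f g : α → Bool} (hf : PolyTime f) (hg : PolyTime g) :
    PolyTime fun x => f x ^^ g x := by
  have := hf.cond hg.not hg
  convert this using 2 with x
  cases f x <;> simp

/-- A fold whose accumulator grows by a polynomially bounded amount in each step. -/
theorem foldl_of_le_add {f : α → γ → β → γ} {b : α → γ} {l : α → List β} {S : α → ℕ}
    (hf : PolyTime fun p : α × γ × β => f p.1 p.2.1 p.2.2) (hb : PolyTime b) (hl : PolyTime l)
    (hS : PolyBdd S) (h : ∀ x c a, a ∈ l x → codeSize (f x c a) ≤ codeSize c + codeSize a + S x) :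
    PolyTime fun x => (l x).foldl (f x) (b x) := by
  refine foldl (S := fun x => codeSize (b x) + codeSize (l x) + codeSize (l x) * S x) hf hb hl
    ((hb.polyBdd.add hl.polyBdd).add (hl.polyBdd.mul hS)) fun x l₁ l₂ hx => ?_
  have key : ∀ (l' : List β) (c : γ), (∀ a ∈ l', a ∈ l x) →
      codeSize (l'.foldl (f x) c) ≤ codeSize c + codeSize l' + l'.length * S x := by
    intro l'
    induction l' with
    | nil => intro c _; simp
    | cons a l' ih =>
      intro c hl'
      have h₁ := ih (f x c a) fun a' ha' => hl' a' (by simp [ha'])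
      have h₂ := h x c a (hl' a (by simp))
      simp only [List.foldl_cons, codeSize_cons, List.length_cons, add_mul, one_mul]
      omega
  have h₁ := key l₁ (b x) (by simp +contextual [hx])
  have h₂ : codeSize l₁ ≤ codeSize (l x) := by
    have := codeSize_append l₁ l₂
    have := one_le_codeSize l₂
    rw [hx]; omega
  have h₃ : l₁.length * S x ≤ codeSize (l x) * S x := by
    gcongr
    exact (length_le_codeSize _).trans h₂
  omega

@[fun_prop]
theorem reverse {f : α → List β} (hf : PolyTime f) : PolyTime fun x => (f x).reverse := by
  have := foldl_of_le_add (f := fun (_ : α) (c : List β) (a : β) => a :: c) (S := fun _ => 1)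
    (b := fun _ => []) (by fun_prop) (by fun_prop) hf (.const 1)
    fun x c a _ => by simp; omega
  convert this using 2 with x
  simp

@[fun_prop]
theorem append {f g : α → List β} (hf : PolyTime f) (hg : PolyTime g) :
    PolyTime fun x => f x ++ g x := by
  have := foldl_of_le_add (f := fun (_ : α) (c : List β) (a : β) => a :: c) (S := fun _ => 1)
    (b := g) (l := fun x => (f x).reverse) (by fun_prop) hg (by fun_prop) (.const 1)
    fun x c a _ => by simp; omega
  convert this using 2 with x
  simp

theorem map {f : α → β → γ} {l : α → List β} (hf : PolyTime fun p : α × β => f p.1 p.2)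
    (hl : PolyTime l) : PolyTime fun x => (l x).map (f x) := by
  obtain ⟨P, hP⟩ := hf.polyBdd
  have := foldl_of_le_add (f := fun (x : α) (c : List γ) (a : β) => f x a :: c)
    (S := fun x => P.eval (codeSize x + codeSize (l x) + 1) + 1)
    (b := fun _ => []) ?_ (by fun_prop) hl
    ((((PolyBdd.id.add hl.polyBdd).add (.const 1)).eval P).add (.const 1)) fun x c a ha => ?_
  · have H := this.reverse
    convert H using 2 with x
    rw [← List.foldr_reverse, List.foldr_cons_eq_append]
    simp
  · exact (comp (f := fun p : α × β => f p.1 p.2) (g := fun p : α × List γ × β => (p.1, p.2.2)) hf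
      (by fun_prop)).cons (by fun_prop)
  · have h₁ : codeSize (f x a) ≤ P.eval (codeSize (x, a)) := hP (x, a)
    have h₂ : P.eval (codeSize (x, a)) ≤ P.eval (codeSize x + codeSize (l x) + 1) :=
      P.eval_mono_nat (by simpa using codeSize_le_of_mem ha)
    simp only [codeSize_cons]
    omega

end PolyTime

/-! ### Arithmetic of binary numbers -/

/-- The number with the given binary digits, the least significant one coming first. -/
def bitsVal (l : List Bool) : ℕ := l.foldr Nat.bit 0

theorem bitsVal_cons (b : Bool) (l : List Bool) : bitsVal (b :: l) = b.toNat + 2 * bitsVal l := by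
  simp [bitsVal, Nat.bit_val, add_comm]

@[simp] theorem bitsVal_nil : bitsVal [] = 0 := rfl

theorem bitsVal_eq (l : List Bool) :
    bitsVal l = (l.headD false).toNat + 2 * bitsVal l.tail := by
  cases l
  · rfl
  · exact bitsVal_cons _ _

theorem bitsVal_append (l l' : List Bool) :
    bitsVal (l ++ l') = bitsVal l + 2 ^ l.length * bitsVal l' := by
  induction l with
  | nil => simp
  | cons b l ih => simp only [List.cons_append, bitsVal_cons, ih, List.length_cons]; ring

theorem bitsVal_bits (n : ℕ) : bitsVal n.bits = n := by
  induction n using Nat.binaryRec' with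
  | zero => simp
  | bit b n h ih => rw [Nat.bits_append_bit _ _ h, bitsVal_cons, ih, Nat.bit_val, add_comm]

theorem bitsVal_lt (l : List Bool) : bitsVal l < 2 ^ l.length := by
  induction l with
  | nil => simp
  | cons b l ih =>
    rw [bitsVal_cons, List.length_cons, pow_succ]
    have := Bool.toNat_le b
    omega

/-- Natural numbers are represented in binary, the least significant digit coming first. -/
instance : TreeCode ℕ := ⟨fun n => enc n.bits⟩

theorem codeSize_nat_le {n k : ℕ} (h : n < 2 ^ k) : codeSize n ≤ 4 * k + 1 := by
  have h₁ : codeSize n.bits ≤ n.bits.length * (3 + 1) + 1 :=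
    codeSize_list_le fun b _ => codeSize_bool_le b
  rw [Nat.size_eq_bits_len] at h₁
  have h₂ := Nat.size_le.2 h
  change codeSize n.bits ≤ _
  omega

theorem lt_two_pow_codeSize (n : ℕ) : n < 2 ^ codeSize n := by
  have h₁ : n.bits.length ≤ codeSize n.bits := length_le_codeSize _
  rw [Nat.size_eq_bits_len] at h₁
  exact (Nat.lt_size_self n).trans_le (Nat.pow_le_pow_right (by norm_num) h₁)

namespace PolyTime

variable {α : Type} [TreeCode α] {f g : α → ℕ}

@[fun_prop]
theorem bits (hf : PolyTime f) : PolyTime fun x => (f x).bits :=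
  comp (f := Nat.bits) (of_enc_eq fun _ => rfl) hf

@[fun_prop]
theorem bitsVal {f : α → List Bool} (hf : PolyTime f) : PolyTime fun x => bitsVal (f x) := by
  -- The code of a number has no leading zeros, so they are dropped from the list of digits.
  have h := foldl_of_le_add
    (f := fun (_ : α) (c : List Bool) (b : Bool) => bif !b && c.isEmpty then c else b :: c)
    (S := fun _ => 1) (b := fun _ => []) (l := fun x => (f x).reverse) (by fun_prop)
    (by fun_prop) (by fun_prop) (.const 1) fun x c a _ => by
      cases !a && c.isEmpty <;> simp <;> omega
  have e : ∀ l : List Bool, l.foldr (fun b c => bif !b && c.isEmpty then c else b :: c) [] =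
      (_root_.bitsVal l).bits := by
    intro l
    induction l with
    | nil => simp
    | cons b l ih =>
      have hb : _root_.bitsVal (b :: l) = Nat.bit b (_root_.bitsVal l) := rfl
      rw [List.foldr_cons, ih, hb]
      by_cases h0 : _root_.bitsVal l = 0 ∧ b = false
      · simp [h0]
      · rw [Nat.bits_append_bit _ _ fun h => by simpa [h] using h0]
        have : (!b && (_root_.bitsVal l).bits.isEmpty) = false := by
          cases hn : (_root_.bitsVal l).bits with
          | nil =>
            have := bitsVal_bits (_root_.bitsVal l)
            rw [hn] at this
            cases b
            · exact absurd ⟨this.symm, rfl⟩ h0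
            · rfl
          | cons => simp
        simp [this]
  simp only [List.foldl_reverse, e] at h
  obtain ⟨p, P, h⟩ := h
  exact ⟨p, P, h⟩

end PolyTime

/-- One step of the addition with carry: the state consists of the carry, the remaining digits of
both summands, and the digits of the sum, the most significant one coming first. -/
def addStep (s : Bool × List Bool × List Bool × List Bool) :
    Bool × List Bool × List Bool × List Bool :=
  ((s.2.1.headD false && s.2.2.1.headD false) ||
      (s.1 && (s.2.1.headD false ^^ s.2.2.1.headD false)),
    s.2.1.tail, s.2.2.1.tail, ((s.2.1.headD false ^^ s.2.2.1.headD false) ^^ s.1) :: s.2.2.2)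

/-- The sum that the state stands for is invariant under the steps of the addition. -/
theorem foldl_addStep {δ : Type} (l : List δ) (s : Bool × List Bool × List Bool × List Bool) :
    let s' := l.foldl (fun s _ => addStep s) s
    s'.2.1 = s.2.1.drop l.length ∧ s'.2.2.1 = s.2.2.1.drop l.length ∧
      bitsVal s'.2.2.2.reverse + 2 ^ s'.2.2.2.length *
        (s'.1.toNat + bitsVal s'.2.1 + bitsVal s'.2.2.1) =
      bitsVal s.2.2.2.reverse + 2 ^ s.2.2.2.length *
        (s.1.toNat + bitsVal s.2.1 + bitsVal s.2.2.1) := by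
  induction l generalizing s with
  | nil => simp
  | cons d l ih =>
    obtain ⟨h₁, h₂, h₃⟩ := ih (addStep s)
    refine ⟨h₁.trans (by simp [addStep, ← List.drop_one, add_comm]),
      h₂.trans (by simp [addStep, ← List.drop_one, add_comm]), h₃.trans ?_⟩
    obtain ⟨c, a, b, o⟩ := s
    simp only [addStep, List.reverse_cons, bitsVal_append, List.length_cons, List.length_reverse,
      bitsVal_cons, bitsVal_nil]
    rw [bitsVal_eq a, bitsVal_eq b]
    cases c <;> cases a.headD false <;> cases b.headD false <;> simp [pow_succ] <;> ring

theorem add_eq_foldl_addStep (m n : ℕ) :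
    let s := (m.bits ++ n.bits).foldl (fun s _ => addStep s) (false, m.bits, n.bits, [])
    m + n = bitsVal (s.1 :: s.2.2.2).reverse := by
  obtain ⟨h₁, h₂, h₃⟩ := foldl_addStep (m.bits ++ n.bits) (false, m.bits, n.bits, [])
  intro s
  simp only [List.length_append, List.drop_eq_nil_of_le, Nat.le_add_right, Nat.le_add_left] at h₁ h₂
  rw [h₁, h₂] at h₃
  simp only [bitsVal_bits, bitsVal_nil, List.reverse_nil, Bool.toNat_false, List.length_nil,
    zero_add, pow_zero, one_mul, add_zero] at h₃
  rw [List.reverse_cons, bitsVal_append, List.length_reverse, bitsVal_cons, bitsVal_nil, ← h₃]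
  rfl

/-- One step of the comparison of two numbers: the state consists of the remaining digits of both
numbers and of the result of the comparison so far. -/
def leStep (s : List Bool × List Bool × Bool) : List Bool × List Bool × Bool :=
  (s.1.tail, s.2.1.tail, bif s.1.headD false ^^ s.2.1.headD false then s.2.1.headD false else s.2.2)

/-- The truth value of the comparison that the state stands for is invariant under its steps. -/
theorem foldl_leStep {δ : Type} (l : List δ) (s : List Bool × List Bool × Bool) :
    let s' := l.foldl (fun s _ => leStep s) s
    s'.1 = s.1.drop l.length ∧ s'.2.1 = s.2.1.drop l.length ∧
      ((bitsVal s'.1 < bitsVal s'.2.1 ∨ bitsVal s'.1 = bitsVal s'.2.1 ∧ s'.2.2 = true) ↔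
        (bitsVal s.1 < bitsVal s.2.1 ∨ bitsVal s.1 = bitsVal s.2.1 ∧ s.2.2 = true)) := by
  induction l generalizing s with
  | nil => simp
  | cons d l ih =>
    obtain ⟨h₁, h₂, h₃⟩ := ih (leStep s)
    refine ⟨h₁.trans (by simp [leStep, ← List.drop_one, add_comm]),
      h₂.trans (by simp [leStep, ← List.drop_one, add_comm]), h₃.trans ?_⟩
    obtain ⟨a, b, r⟩ := s
    simp only [leStep]
    rw [bitsVal_eq a, bitsVal_eq b]
    cases r <;> cases a.headD false <;> cases b.headD false <;> simp <;> omega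

theorem ble_eq_foldl_leStep (m n : ℕ) :
    m.ble n = ((m.bits ++ n.bits).foldl (fun s _ => leStep s) (m.bits, n.bits, true)).2.2 := by
  obtain ⟨h₁, h₂, h₃⟩ := foldl_leStep (m.bits ++ n.bits) (m.bits, n.bits, true)
  simp only [List.length_append, List.drop_eq_nil_of_le, Nat.le_add_right, Nat.le_add_left] at h₁ h₂
  rw [h₁, h₂] at h₃
  rw [Bool.eq_iff_iff, Nat.ble_eq, le_iff_lt_or_eq]
  simpa [bitsVal_bits] using h₃.symm

theorem mul_eq_foldl (m n : ℕ) :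
    m * n = n.bits.reverse.foldl (fun c b => c + c + bif b then m else 0) 0 := by
  rw [List.foldl_reverse]
  conv_lhs => rw [← bitsVal_bits n]
  induction n.bits with
  | nil => simp
  | cons b l ih =>
    rw [bitsVal_cons, List.foldr_cons, ← ih]
    cases b <;> simp <;> ring

namespace PolyTime

variable {α : Type} [TreeCode α] {f g : α → ℕ}

@[fun_prop]
theorem add (hf : PolyTime f) (hg : PolyTime g) : PolyTime fun x => f x + g x := by
  have := foldl_of_le_add (f := fun (_ : α) s (_ : Bool) => addStep s) (S := fun _ => 10)
    (b := fun x => (false, (f x).bits, (g x).bits, [])) (l := fun x => (f x).bits ++ (g x).bits)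
    (by unfold addStep; fun_prop) (by fun_prop) (by fun_prop) (.const 10) fun x c a _ => by
      obtain ⟨c, u, v, w⟩ := c
      have h (b : Bool) := codeSize_bool_le b
      have h' (l : List Bool) : codeSize l.tail ≤ codeSize l := by cases l <;> simp; omega
      have h₁ := h' u
      have h₂ := h' v
      simp only [addStep, codeSize_mk, codeSize_cons]
      refine (add_le_add_left (add_le_add (h _) (add_le_add_left (add_le_add h₁ (add_le_add_left
        (add_le_add h₂ (add_le_add_left (add_le_add_left (h _) _) _)) _)) _)) _).trans ?_
      omega
  simp only [add_eq_foldl_addStep]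
  fun_prop

theorem ble (hf : PolyTime f) (hg : PolyTime g) : PolyTime fun x => (f x).ble (g x) := by
  have := foldl_of_le_add (f := fun (_ : α) s (_ : Bool) => leStep s) (S := fun _ => 10)
    (b := fun x => ((f x).bits, (g x).bits, true)) (l := fun x => (f x).bits ++ (g x).bits)
    (by unfold leStep; fun_prop) (by fun_prop) (by fun_prop) (.const 10) fun x c a _ => by
      obtain ⟨u, v, w⟩ := c
      have h' (l : List Bool) : codeSize l.tail ≤ codeSize l := by cases l <;> simp; omega
      have h₁ := h' u
      have h₂ := h' v
      have h₃ := codeSize_bool_le (leStep (u, v, w)).2.2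
      simp only [leStep, codeSize_mk] at h₃ ⊢
      omega
  simp only [ble_eq_foldl_leStep]
  fun_prop

@[fun_prop]
theorem decide_le (hf : PolyTime f) (hg : PolyTime g) : PolyTime fun x => decide (f x ≤ g x) := by
  convert ble hf hg using 2 with x
  rw [Bool.eq_iff_iff]
  simp

@[fun_prop]
theorem decide_lt (hf : PolyTime f) (hg : PolyTime g) : PolyTime fun x => decide (f x < g x) := by
  convert (decide_le hg hf).not using 2 with x
  rw [Bool.eq_iff_iff]
  simp

@[fun_prop]
theorem decide_eq (hf : PolyTime f) (hg : PolyTime g) : PolyTime fun x => decide (f x = g x) := by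
  convert (decide_le hf hg).and (decide_le hg hf) using 2 with x
  rw [Bool.eq_iff_iff]
  simp [le_antisymm_iff]

@[fun_prop]
theorem mul (hf : PolyTime f) (hg : PolyTime g) : PolyTime fun x => f x * g x := by
  simp only [mul_eq_foldl]
  refine foldl (f := fun x c b => c + c + bif b then f x else 0) (b := fun _ => 0)
    (S := fun x => 4 * (codeSize (f x) + codeSize (g x)) + 1)
    ?_ (by fun_prop) (by fun_prop)
    (((PolyBdd.const 4).mul (hf.polyBdd.add hg.polyBdd)).add (.const 1)) fun x l₁ l₂ hl => ?_
  · exact ((show PolyTime fun p : α × ℕ × Bool => p.2.1 from by fun_prop).add (by fun_prop)).add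
      (cond (by fun_prop) (comp hf (by fun_prop)) (const 0))
  · -- The intermediate values are products of `f x` with a number given by leading digits of `g x`.
    refine codeSize_nat_le ?_
    have h₁ : l₁.foldl (fun c b => c + c + bif b then f x else 0) 0 =
        f x * _root_.bitsVal l₁.reverse := by
      rw [← l₁.reverse_reverse, List.foldl_reverse, List.reverse_reverse]
      induction l₁.reverse with
      | nil => simp
      | cons b l ih =>
        rw [bitsVal_cons, List.foldr_cons, ih]
        cases b <;> simp <;> ring
    have h₂ : l₁.length ≤ codeSize (g x) := by
      have h := length_le_codeSize (g x).bits
      have h' := congrArg List.length hl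
      simp only [List.length_reverse, List.length_append] at h'
      change (g x).bits.length ≤ codeSize (g x) at h
      omega
    rw [h₁, pow_add]
    refine Nat.mul_lt_mul'' (lt_two_pow_codeSize _) ((bitsVal_lt _).trans_le ?_)
    rw [List.length_reverse]
    exact Nat.pow_le_pow_right (by norm_num) h₂

end PolyTime

/-! ### Linear rows, power entries and terms -/

/-- Pairs of natural numbers stand for their difference. -/
def pairVal (c : ℕ × ℕ) : ℤ := c.1 - c.2

/-- Addition of integers represented by pairs. -/
def pairAdd (c d : ℕ × ℕ) : ℕ × ℕ := (c.1 + d.1, c.2 + d.2)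

/-- Multiplication of an integer represented by a pair with a natural number. -/
def pairScale (g : ℕ) (c : ℕ × ℕ) : ℕ × ℕ := (g * c.1, g * c.2)

/-- Multiplication of integers represented by pairs. -/
def pairMul (c d : ℕ × ℕ) : ℕ × ℕ := (c.1 * d.1 + c.2 * d.2, c.1 * d.2 + c.2 * d.1)

/-- A statement about variables: `x_idx = 2 ^ x_j` if `isExp` holds, and
`den * x_idx = a * x_j + b * x_k` otherwise. -/
structure Row where
  idx : ℕ
  isExp : Bool
  j : ℕ
  a : ℕ × ℕ
  k : ℕ
  b : ℕ × ℕ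
  den : ℕ

/-- An entry of the list of powers of two, sorted by decreasing exponents: `x_idx = 2 ^ x_exp`, and
`gap` is the quotient of the preceding entry and this one, cut off at a large power of two. -/
structure PowEntry where
  idx : ℕ
  exp : ℕ
  gap : ℕ

/-- A summand `coef * x_idx` of a linear combination of variables, together with the gap in front
of `x_idx` in the list of powers. -/
structure Term where
  idx : ℕ
  gap : ℕ
  coef : ℕ × ℕ

instance : TreeCode Unit := ⟨fun _ => .leaf⟩

instance : TreeCode Row := ⟨fun r => enc (r.idx, r.isExp, r.j, r.a, r.k, r.b, r.den)⟩

instance : TreeCode PowEntry := ⟨fun e => enc (e.idx, e.exp, e.gap)⟩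

instance : TreeCode Term := ⟨fun t => enc (t.idx, t.gap, t.coef)⟩

theorem codeSize_row (r : Row) : codeSize r = codeSize r.idx + codeSize r.isExp + codeSize r.j +
    codeSize r.a + codeSize r.k + codeSize r.b + codeSize r.den + 6 := by
  change codeSize (r.idx, r.isExp, r.j, r.a, r.k, r.b, r.den) = _
  simp only [codeSize_mk]
  omega

theorem codeSize_powEntry (e : PowEntry) :
    codeSize e = codeSize e.idx + codeSize e.exp + codeSize e.gap + 2 := by
  change codeSize (e.idx, e.exp, e.gap) = _
  simp only [codeSize_mk]
  omega

theorem codeSize_term (t : Term) :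
    codeSize t = codeSize t.idx + codeSize t.gap + codeSize t.coef + 2 := by
  change codeSize (t.idx, t.gap, t.coef) = _
  simp only [codeSize_mk]
  omega

namespace PolyTime

variable {α : Type} [TreeCode α]

section Pair

variable {f g : α → ℕ × ℕ} {n : α → ℕ}

@[fun_prop]
theorem pairAdd (hf : PolyTime f) (hg : PolyTime g) : PolyTime fun x => pairAdd (f x) (g x) := by
  unfold _root_.pairAdd; fun_prop

@[fun_prop]
theorem pairScale (hn : PolyTime n) (hf : PolyTime f) :
    PolyTime fun x => pairScale (n x) (f x) := by
  unfold _root_.pairScale; fun_prop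

@[fun_prop]
theorem pairMul (hf : PolyTime f) (hg : PolyTime g) : PolyTime fun x => pairMul (f x) (g x) := by
  unfold _root_.pairMul; fun_prop

end Pair

section Row

variable {f : α → Row}

theorem rowFields (hf : PolyTime f) : PolyTime fun x =>
    ((f x).idx, (f x).isExp, (f x).j, (f x).a, (f x).k, (f x).b, (f x).den) :=
  comp (f := fun r : Row => (r.idx, r.isExp, r.j, r.a, r.k, r.b, r.den))
    (of_enc_eq fun _ => rfl) hf

@[fun_prop]
theorem row_idx (hf : PolyTime f) : PolyTime fun x => (f x).idx := hf.rowFields.fst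

@[fun_prop]
theorem row_isExp (hf : PolyTime f) : PolyTime fun x => (f x).isExp := hf.rowFields.snd.fst

@[fun_prop]
theorem row_j (hf : PolyTime f) : PolyTime fun x => (f x).j := hf.rowFields.snd.snd.fst

@[fun_prop]
theorem row_a (hf : PolyTime f) : PolyTime fun x => (f x).a := hf.rowFields.snd.snd.snd.fst

@[fun_prop]
theorem row_k (hf : PolyTime f) : PolyTime fun x => (f x).k := hf.rowFields.snd.snd.snd.snd.fst

@[fun_prop]
theorem row_b (hf : PolyTime f) : PolyTime fun x => (f x).b :=
  hf.rowFields.snd.snd.snd.snd.snd.fst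

@[fun_prop]
theorem row_den (hf : PolyTime f) : PolyTime fun x => (f x).den :=
  hf.rowFields.snd.snd.snd.snd.snd.snd

@[fun_prop]
theorem row_mk {i j k g : α → ℕ} {e : α → Bool} {a b : α → ℕ × ℕ} (hi : PolyTime i)
    (he : PolyTime e) (hj : PolyTime j) (ha : PolyTime a) (hk : PolyTime k) (hb : PolyTime b)
    (hg : PolyTime g) :
    PolyTime fun x => Row.mk (i x) (e x) (j x) (a x) (k x) (b x) (g x) :=
  (comp (f := fun p : ℕ × Bool × ℕ × (ℕ × ℕ) × ℕ × (ℕ × ℕ) × ℕ =>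
    Row.mk p.1 p.2.1 p.2.2.1 p.2.2.2.1 p.2.2.2.2.1 p.2.2.2.2.2.1 p.2.2.2.2.2.2)
    (of_enc_eq fun _ => rfl)
    (hi.prodMk (he.prodMk (hj.prodMk (ha.prodMk (hk.prodMk (hb.prodMk hg)))))) :)

end Row

section PowEntry

variable {f : α → PowEntry}

theorem powEntryFields (hf : PolyTime f) : PolyTime fun x => ((f x).idx, (f x).exp, (f x).gap) :=
  comp (f := fun r : PowEntry => (r.idx, r.exp, r.gap)) (of_enc_eq fun _ => rfl) hf

@[fun_prop]
theorem powEntry_idx (hf : PolyTime f) : PolyTime fun x => (f x).idx := hf.powEntryFields.fst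

@[fun_prop]
theorem powEntry_exp (hf : PolyTime f) : PolyTime fun x => (f x).exp := hf.powEntryFields.snd.fst

@[fun_prop]
theorem powEntry_gap (hf : PolyTime f) : PolyTime fun x => (f x).gap := hf.powEntryFields.snd.snd

@[fun_prop]
theorem powEntry_mk {i j k : α → ℕ} (hi : PolyTime i) (hj : PolyTime j) (hk : PolyTime k) :
    PolyTime fun x => PowEntry.mk (i x) (j x) (k x) :=
  (comp (f := fun p : ℕ × ℕ × ℕ => PowEntry.mk p.1 p.2.1 p.2.2)
    (of_enc_eq fun _ => rfl) (hi.prodMk (hj.prodMk hk)) :)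

end PowEntry

section Term

variable {f : α → Term}

theorem termFields (hf : PolyTime f) : PolyTime fun x => ((f x).idx, (f x).gap, (f x).coef) :=
  comp (f := fun r : Term => (r.idx, r.gap, r.coef)) (of_enc_eq fun _ => rfl) hf

@[fun_prop]
theorem term_idx (hf : PolyTime f) : PolyTime fun x => (f x).idx := hf.termFields.fst

@[fun_prop]
theorem term_gap (hf : PolyTime f) : PolyTime fun x => (f x).gap := hf.termFields.snd.fst

@[fun_prop]
theorem term_coef (hf : PolyTime f) : PolyTime fun x => (f x).coef := hf.termFields.snd.snd

@[fun_prop]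
theorem term_mk {i j : α → ℕ} {k : α → ℕ × ℕ} (hi : PolyTime i) (hj : PolyTime j)
    (hk : PolyTime k) : PolyTime fun x => Term.mk (i x) (j x) (k x) :=
  (comp (f := fun p : ℕ × ℕ × ℕ × ℕ => Term.mk p.1 p.2.1 p.2.2)
    (of_enc_eq fun _ => rfl) (hi.prodMk (hj.prodMk hk)) :)

end Term

end PolyTime

/-! ### Elimination of linear variables -/

/-- The contribution of a term to the linear combination, after the linear combination has been
multiplied by `r.den` and `c * r.den * x_idx` has been replaced by `c * (a * x_j + b * x_k)`. -/
def Row.substTerm (r : Row) (c : ℕ × ℕ) (t : Term) : Term :=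
  ⟨t.idx, t.gap, pairAdd (pairAdd (pairScale r.den t.coef)
    (bif decide (t.idx = r.j) then pairMul r.a c else (0, 0)))
    (bif decide (t.idx = r.k) then pairMul r.b c else (0, 0))⟩

/-- Elimination of the variable of the linear row `r`, which is that of the first term.  The first
component of the state is the factor by which the linear combination has been multiplied. -/
def elimStep (s : ℕ × List Term) (r : Row) : ℕ × List Term :=
  (r.den * s.1, s.2.tail.map (r.substTerm (s.2.headD ⟨0, 0, 0, 0⟩).coef))

/-- A factor by which the elimination of a linear row multiplies bounds on coefficients. -/
def Row.norm (r : Row) : ℕ := r.den + (r.a.1 + r.a.2) + (r.b.1 + r.b.2)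

/-- All numbers that matter for the size of the coefficients are at most `M`. -/
def CoefBdd (M : ℕ) (s : ℕ × List Term) : Prop :=
  s.1 ≤ M ∧ ∀ t ∈ s.2, t.coef.1 ≤ M ∧ t.coef.2 ≤ M

theorem CoefBdd.elimStep {M : ℕ} {s : ℕ × List Term} (h : CoefBdd M s) (r : Row) :
    CoefBdd (M * r.norm) (elimStep s r) := by
  obtain ⟨h₁, h₂⟩ := h
  have hc : (s.2.headD ⟨0, 0, 0, 0⟩).coef.1 ≤ M ∧ (s.2.headD ⟨0, 0, 0, 0⟩).coef.2 ≤ M := by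
    rcases s with ⟨D, _ | ⟨t, l⟩⟩
    · simp
    · exact h₂ t (by simp)
  refine ⟨?_, fun t ht => ?_⟩
  · rw [Row.norm, mul_comm M]
    exact Nat.mul_le_mul (by omega) h₁
  · obtain ⟨u, hu, rfl⟩ := List.mem_map.1 ht
    obtain ⟨h₃, h₄⟩ := h₂ u (List.mem_of_mem_tail hu)
    set c := (s.2.headD ⟨0, 0, 0, 0⟩).coef
    obtain ⟨hc₁, hc₂⟩ := hc
    have key (a : ℕ × ℕ) (b : Bool) : (bif b then pairMul a c else (0, 0)).1 ≤ (a.1 + a.2) * M ∧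
        (bif b then pairMul a c else (0, 0)).2 ≤ (a.1 + a.2) * M := by
      cases b
      · simp
      · simp only [pairMul, cond_true, add_mul]
        constructor <;> gcongr
    have h₅ := key r.a (decide (u.idx = r.j))
    have h₆ := key r.b (decide (u.idx = r.k))
    have h₇ := Nat.mul_le_mul_left r.den h₃
    have h₈ := Nat.mul_le_mul_left r.den h₄
    have e : M * r.norm = r.den * M + (r.a.1 + r.a.2) * M + (r.b.1 + r.b.2) * M := by
      rw [Row.norm]; ring
    rw [e]
    simp only [Row.substTerm, pairAdd, pairScale]
    constructor <;> omega

theorem CoefBdd.foldl {M : ℕ} {s : ℕ × List Term} (h : CoefBdd M s) (l : List Row) :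
    CoefBdd (M * (l.map Row.norm).prod) (l.foldl _root_.elimStep s) := by
  induction l generalizing M s with
  | nil => simpa using h
  | cons r l ih => simpa [mul_assoc] using ih (h.elimStep r)

theorem length_foldl_elimStep_le (l : List Row) (s : ℕ × List Term) :
    (l.foldl elimStep s).2.length ≤ s.2.length := by
  induction l generalizing s with
  | nil => simp
  | cons r l ih =>
    refine (ih _).trans ?_
    simp [elimStep]

theorem exists_of_mem_foldl_elimStep {l : List Row} {s : ℕ × List Term} {t : Term}
    (ht : t ∈ (l.foldl elimStep s).2) : ∃ u ∈ s.2, u.idx = t.idx ∧ u.gap = t.gap := by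
  induction l generalizing s with
  | nil => exact ⟨t, ht, rfl, rfl⟩
  | cons r l ih =>
    obtain ⟨u, hu, h⟩ := ih ht
    obtain ⟨w, hw, rfl⟩ := List.mem_map.1 hu
    exact ⟨w, List.mem_of_mem_tail hw, h⟩

theorem add_le_two_pow {m n k l : ℕ} (hm : m < 2 ^ k) (hn : n < 2 ^ l) : m + n ≤ 2 ^ (k + l) := by
  rw [pow_add]
  nlinarith

theorem Row.norm_le (r : Row) : r.norm ≤ 2 ^ codeSize r := by
  have e (c : ℕ × ℕ) : c.1 + c.2 < 2 ^ codeSize c := by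
    have := add_le_two_pow (lt_two_pow_codeSize c.1) (lt_two_pow_codeSize c.2)
    rw [codeSize_prod, pow_succ]
    have := Nat.two_pow_pos (codeSize c.1 + codeSize c.2)
    omega
  have h₁ := add_le_two_pow (lt_two_pow_codeSize r.den) (e r.a)
  have h₂ : r.den + (r.a.1 + r.a.2) < 2 ^ (codeSize r.den + codeSize r.a + 1) := by
    rw [pow_succ]
    have := Nat.two_pow_pos (codeSize r.den + codeSize r.a)
    omega
  refine (add_le_two_pow h₂ (e r.b)).trans (Nat.pow_le_pow_right (by norm_num) ?_)
  rw [codeSize_row]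
  omega

theorem prod_norm_le (l : List Row) : (l.map Row.norm).prod ≤ 2 ^ codeSize l := by
  induction l with
  | nil => simp
  | cons r l ih =>
    simp only [List.map_cons, List.prod_cons, codeSize_cons]
    refine (Nat.mul_le_mul r.norm_le ih).trans ?_
    rw [← pow_add]
    exact Nat.pow_le_pow_right (by norm_num) (by omega)

theorem codeSize_pair_le {c : ℕ × ℕ} {k : ℕ} (h₁ : c.1 < 2 ^ k) (h₂ : c.2 < 2 ^ k) :
    codeSize c ≤ 8 * k + 3 := by
  have := codeSize_nat_le h₁
  have := codeSize_nat_le h₂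
  rw [codeSize_prod]
  omega

theorem coefBdd_codeSize (s : ℕ × List Term) : CoefBdd (2 ^ codeSize s) s := by
  have key {n : ℕ} (h : codeSize n ≤ codeSize s) : n ≤ 2 ^ codeSize s :=
    (lt_two_pow_codeSize n).le.trans (Nat.pow_le_pow_right (by norm_num) h)
  refine ⟨key (by rw [codeSize_prod s]; omega), fun t ht => ?_⟩
  have h₁ := codeSize_le_of_mem ht
  have h₂ := codeSize_prod t.coef
  rw [codeSize_term] at h₁
  constructor <;> refine key ?_ <;> rw [codeSize_prod s] <;> omega

namespace PolyTime

variable {α : Type} [TreeCode α]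

theorem substTerm {r : α → Row} {c : α → ℕ × ℕ} {t : α → Term} (hr : PolyTime r) (hc : PolyTime c)
    (ht : PolyTime t) : PolyTime fun x => (r x).substTerm (c x) (t x) := by
  unfold Row.substTerm
  fun_prop

@[fun_prop]
theorem elimStep {s : α → ℕ × List Term} {r : α → Row} (hs : PolyTime s) (hr : PolyTime r) :
    PolyTime fun x => elimStep (s x) (r x) := by
  unfold _root_.elimStep
  refine (hr.row_den.mul hs.fst).prodMk (map ?_ (by fun_prop))
  exact substTerm (comp hr (by fun_prop)) (term_coef (headD (snd (comp hs (by fun_prop)))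
    (const _))) (by fun_prop)

@[fun_prop]
theorem foldl_elimStep {s : α → ℕ × List Term} {l : α → List Row} (hs : PolyTime s)
    (hl : PolyTime l) : PolyTime fun x => (l x).foldl _root_.elimStep (s x) := by
  -- With `K` the total size of the input, all coefficients stay below `2 ^ (K + 1)`.
  let K : α → ℕ := fun x => codeSize (s x) + codeSize (l x)
  have hK : PolyBdd K := hs.polyBdd.add hl.polyBdd
  refine foldl (S := fun x => 4 * (K x + 1) + 1 + (K x * (K x + K x + (8 * (K x + 1) + 3) + 2 + 1)
    + 1) + 1) (f := fun _ => _root_.elimStep) (by fun_prop) hs hl ?_ fun x l₁ l₂ hx => ?_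
  · have h₁ := hK.add (.const 1)
    exact (((((PolyBdd.const 4).mul h₁).add (.const 1))).add ((hK.mul (((((hK.add hK).add
      ((((PolyBdd.const 8).mul h₁).add (.const 3)))).add (.const 2)).add (.const 1)))).add
        (.const 1))).add (.const 1)
  · have h₁ := (coefBdd_codeSize (s x)).foldl l₁
    set M := 2 ^ codeSize (s x) * (l₁.map Row.norm).prod
    have hM : M < 2 ^ (K x + 1) := by
      refine (Nat.mul_le_mul_left _ (prod_norm_le l₁)).trans_lt ?_
      rw [← pow_add]
      refine Nat.pow_lt_pow_right (by norm_num) ?_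
      have := codeSize_append l₁ l₂
      have := one_le_codeSize l₂
      simp only [K, hx]
      omega
    obtain ⟨h₂, h₃⟩ := h₁
    rw [codeSize_prod]
    have h₄ := codeSize_nat_le (h₂.trans_lt hM)
    have h₅ : codeSize (l₁.foldl _root_.elimStep (s x)).2 ≤
        K x * (K x + K x + (8 * (K x + 1) + 3) + 2 + 1) + 1 := by
      refine (codeSize_list_le (B := K x + K x + (8 * (K x + 1) + 3) + 2) fun t ht => ?_).trans ?_
      · obtain ⟨u, hu, hi, hg⟩ := exists_of_mem_foldl_elimStep ht
        obtain ⟨h₅, h₆⟩ := h₃ t ht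
        have h₇ := codeSize_pair_le (h₅.trans_lt hM) (h₆.trans_lt hM)
        have h₈ := codeSize_le_of_mem hu
        have h₉ := codeSize_prod (s x)
        rw [codeSize_term] at h₈ ⊢
        simp only [K] at *
        rw [← hi, ← hg]
        omega
      · gcongr
        refine (length_foldl_elimStep_le _ _).trans ((length_le_codeSize _).trans ?_)
        have h₉ := codeSize_prod (s x)
        simp only [K]
        omega
    omega

end PolyTime

/-! ### Comparison of two variables -/

/-- The power of two whose exponent is the length of the list. -/
def twoPow (l : List Unit) : ℕ := l.foldl (fun c _ => c + c) 1

theorem twoPow_eq (l : List Unit) : twoPow l = 2 ^ l.length := by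
  have key : ∀ (l : List Unit) (c : ℕ), l.foldl (fun c _ => c + c) c = c * 2 ^ l.length := by
    intro l
    induction l with
    | nil => simp
    | cons u l ih => intro c; rw [List.foldl_cons, ih, List.length_cons, pow_succ]; ring
  rw [twoPow, key, one_mul]

/-- One step of the evaluation of a linear combination of powers of two by Horner's scheme.  Once a
nonzero value meets a gap that has been cut off at `Q`, the value is not changed any more, and the
Boolean component of the state is `true`. -/
def hornerStep (Q : ℕ) (s : Bool × ℕ × ℕ) (t : Term) : Bool × ℕ × ℕ :=
  bif s.1 || (decide (t.gap = Q) && !decide (s.2.1 = s.2.2)) then (true, s.2)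
  else (false, pairAdd (pairScale t.gap s.2) t.coef)

/-- Doubles the second component while the multiple `s.1` of `D` is less than `v`. -/
def gapStep (D : ℕ) (v : ℕ × ℕ) (s : ℕ × ℕ) : ℕ × ℕ :=
  bif decide (v.2 + s.1 < v.1) then (s.1 + D, s.2 + s.2) else s

/-- The power of two with exponent `v / D`, cut off at `2 ^ l.length`. -/
def gapOf (D : ℕ) (v : ℕ × ℕ) (l : List Unit) : ℕ :=
  (l.foldl (fun s _ => gapStep D v s) (0, 1)).2

/-- The linear combination `x_p - x_q` of the variables that occur in a table. -/
def diffTerms (tbl : List Row) (pows : List PowEntry) (p q : ℕ) : List Term :=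
  tbl.map (fun r => ⟨r.idx, 1, bif decide (r.idx = p) then 1 else 0,
    bif decide (r.idx = q) then 1 else 0⟩) ++
  pows.map (fun e => ⟨e.idx, e.gap, bif decide (e.idx = p) then 1 else 0,
    bif decide (e.idx = q) then 1 else 0⟩)

/-- A comparison of `x_p` and `x_q`: whether `x_q ≤ x_p`, and in this case the power of two with
exponent `x_p - x_q`, cut off at `2 ^ fuel.length`. -/
def compareVars (fuel : List Unit) (tbl : List Row) (pows : List PowEntry) (p q : ℕ) : Bool × ℕ :=
  let s := tbl.foldl elimStep (1, diffTerms tbl pows p q)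
  let h := s.2.foldl (hornerStep (twoPow fuel)) (false, 0, 0)
  (decide (h.2.2 ≤ h.2.1), bif h.1 then twoPow fuel else gapOf s.1 h.2 fuel)

/-- One step of the insertion of the power `x_i = 2 ^ x_v` into the sorted list of powers.  The
state consists of the exponent of the preceding entry, of a Boolean telling whether the new power
has been inserted, and of the part of the new list that has been built, in reverse order. -/
def insertStep (fuel : List Unit) (tbl : List Row) (pows : List PowEntry) (i v : ℕ)
    (s : ℕ × Bool × List PowEntry) (e : PowEntry) : ℕ × Bool × List PowEntry :=
  bif !s.2.1 && (compareVars fuel tbl pows v e.exp).1 then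
    (e.exp, true, ⟨e.idx, e.exp, (compareVars fuel tbl pows v e.exp).2⟩ ::
      ⟨i, v, (compareVars fuel tbl pows s.1 v).2⟩ :: s.2.2)
  else (e.exp, s.2.1, e :: s.2.2)

/-- The sorted list of powers after the insertion of `x_i = 2 ^ x_v`. -/
def insertPow (fuel : List Unit) (tbl : List Row) (pows : List PowEntry) (i v : ℕ) :
    List PowEntry :=
  (pows.foldl (insertStep fuel tbl pows i v) (v, false, [])).2.2.reverse

/-- The treatment of a row: the state consists of the linear rows, in reverse order, and of the
sorted list of powers. -/
def rowStep (fuel : List Unit) (s : List Row × List PowEntry) (r : Row) :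
    List Row × List PowEntry :=
  bif r.isExp then (s.1, insertPow fuel s.1 s.2 r.idx r.j) else (r :: s.1, s.2)

/-- Whether `x_p ≥ x_1`, for a list of rows.  The variable `x_1` is meant to be `0`, and the initial
list of powers consists of the constant `x_0 = 2 ^ x_1`. -/
def rowsNonneg (fuel : List Unit) (rows : List Row) (p : ℕ) : Bool :=
  let s := rows.foldl (rowStep fuel) ([], [⟨0, 1, 1⟩])
  (compareVars fuel s.1 s.2 p 1).1

theorem gapOf_aux (D : ℕ) (v : ℕ × ℕ) (l : List Unit) :
    (l.foldl (fun s _ => gapStep D v s) (0, 1)).1 ≤ l.length * D ∧ gapOf D v l ≤ 2 ^ l.length := by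
  induction l using List.reverseRecOn with
  | nil => simp [gapOf]
  | append_singleton l u ih =>
    obtain ⟨h₁, h₂⟩ := ih
    simp only [gapOf] at h₂ ⊢
    rw [List.foldl_append, List.foldl_cons, List.foldl_nil, List.length_append,
      List.length_singleton, add_mul, one_mul, pow_succ]
    generalize l.foldl (fun s _ => gapStep D v s) (0, 1) = s at *
    unfold gapStep
    cases decide (v.2 + s.1 < v.1)
    · exact ⟨by simp only [cond_false]; omega, by simp only [cond_false]; omega⟩
    · exact ⟨by simp only [cond_true]; omega, by simp only [cond_true]; omega⟩

theorem compareVars_snd_le (fuel : List Unit) (tbl : List Row) (pows : List PowEntry) (p q : ℕ) :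
    (compareVars fuel tbl pows p q).2 ≤ 2 ^ fuel.length := by
  simp only [compareVars]
  cases (List.foldl (hornerStep (twoPow fuel)) (false, 0, 0)
    (List.foldl elimStep (1, diffTerms tbl pows p q) tbl).2).1
  · exact (gapOf_aux _ _ _).2
  · exact (twoPow_eq fuel).le

theorem codeSize_compareVars_snd (fuel : List Unit) (tbl : List Row) (pows : List PowEntry)
    (p q : ℕ) : codeSize (compareVars fuel tbl pows p q).2 ≤ 4 * (codeSize fuel + 1) + 1 := by
  refine codeSize_nat_le ((compareVars_snd_le fuel tbl pows p q).trans_lt ?_)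
  refine Nat.pow_lt_pow_right (by norm_num) ?_
  have := length_le_codeSize fuel
  omega

theorem hornerStep_le {Q : ℕ} {s : Bool × ℕ × ℕ} {t : Term} {k : ℕ}
    (h : s.2.1 ≤ 2 ^ k ∧ s.2.2 ≤ 2 ^ k) : (hornerStep Q s t).2.1 ≤ 2 ^ (k + codeSize t) ∧
      (hornerStep Q s t).2.2 ≤ 2 ^ (k + codeSize t) := by
  have hk : 1 ≤ 2 ^ k := Nat.one_le_two_pow
  have key : ∀ m n : ℕ, m ≤ 2 ^ k → codeSize n ≤ codeSize t.coef →
      t.gap * m + n ≤ 2 ^ (k + codeSize t) := by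
    intro m n hm hn
    have h₁ := lt_two_pow_codeSize n
    have h₂ : n < 2 ^ codeSize t.coef := h₁.trans_le (Nat.pow_le_pow_right (by norm_num) hn)
    have h₃ := add_le_two_pow (lt_two_pow_codeSize t.gap) h₂
    calc t.gap * m + n ≤ t.gap * 2 ^ k + n * 2 ^ k := by gcongr; exact Nat.le_mul_of_pos_right _ hk
      _ = (t.gap + n) * 2 ^ k := by ring
      _ ≤ 2 ^ (codeSize t.gap + codeSize t.coef) * 2 ^ k := by gcongr
      _ ≤ 2 ^ (k + codeSize t) := by
        rw [← pow_add]
        exact Nat.pow_le_pow_right (by norm_num) (by rw [codeSize_term]; omega)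
  have hp := codeSize_prod t.coef
  unfold hornerStep
  cases s.1 || (decide (t.gap = Q) && !decide (s.2.1 = s.2.2))
  · exact ⟨key _ _ h.1 (by omega), key _ _ h.2 (by omega)⟩
  · have : 2 ^ k ≤ 2 ^ (k + codeSize t) := Nat.pow_le_pow_right (by norm_num) (by omega)
    exact ⟨h.1.trans this, h.2.trans this⟩

namespace PolyTime

variable {α : Type} [TreeCode α]

@[fun_prop]
theorem twoPow {l : α → List Unit} (hl : PolyTime l) : PolyTime fun x => twoPow (l x) := by
  unfold _root_.twoPow
  refine foldl (S := fun x => 4 * (codeSize (l x) + 1) + 1) (f := fun _ c _ => c + c)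
    (b := fun _ => 1) (by fun_prop) (by fun_prop) hl
    (((PolyBdd.const 4).mul (hl.polyBdd.add (.const 1))).add (.const 1)) fun x l₁ l₂ hx => ?_
  refine codeSize_nat_le ?_
  change _root_.twoPow l₁ < _
  rw [twoPow_eq]
  refine Nat.pow_lt_pow_right (by norm_num) ?_
  have := length_le_codeSize (l x)
  rw [hx, List.length_append] at this
  rw [hx]
  omega

@[fun_prop]
theorem foldl_hornerStep {Q : α → ℕ} {l : α → List Term} (hQ : PolyTime Q) (hl : PolyTime l) :
    PolyTime fun x => (l x).foldl (hornerStep (Q x)) (false, 0, 0) := by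
  refine foldl (S := fun x => 8 * (codeSize (l x) + 1) + 3 + 4) (f := fun x => hornerStep (Q x))
    (b := fun _ => (false, 0, 0)) ?_ (by fun_prop) hl
    ((((PolyBdd.const 8).mul (hl.polyBdd.add (.const 1))).add (.const 3)).add (.const 4))
    fun x l₁ l₂ hx => ?_
  · unfold hornerStep
    have : PolyTime fun p : α × (Bool × ℕ × ℕ) × Term => Q p.1 := comp hQ (by fun_prop)
    fun_prop
  · have h : ∀ l₁ : List Term,
        (l₁.foldl (hornerStep (Q x)) (false, 0, 0)).2.1 ≤ 2 ^ (codeSize l₁) ∧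
        (l₁.foldl (hornerStep (Q x)) (false, 0, 0)).2.2 ≤ 2 ^ (codeSize l₁) := by
      intro l₁
      induction l₁ using List.reverseRecOn with
      | nil => simp
      | append_singleton l₁ t ih =>
        rw [List.foldl_append, List.foldl_cons, List.foldl_nil]
        have h₁ := hornerStep_le (Q := Q x) (t := t) ih
        have h₂ : codeSize l₁ + codeSize t ≤ codeSize (l₁ ++ [t]) := by
          have := codeSize_append l₁ [t]
          simp only [codeSize_cons, codeSize_nil] at this
          omega
        have h₃ := Nat.pow_le_pow_right (n := 2) (by norm_num) h₂
        exact ⟨h₁.1.trans h₃, h₁.2.trans h₃⟩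
    have hlt : 2 ^ codeSize l₁ < 2 ^ (codeSize (l x) + 1) := by
      refine Nat.pow_lt_pow_right (by norm_num) ?_
      have := codeSize_append l₁ l₂
      have := one_le_codeSize l₂
      rw [hx]
      omega
    have h₁ := codeSize_pair_le ((h l₁).1.trans_lt hlt) ((h l₁).2.trans_lt hlt)
    have h₂ := codeSize_bool_le (l₁.foldl (hornerStep (Q x)) (false, 0, 0)).1
    rw [codeSize_prod]
    omega

@[fun_prop]
theorem gapOf {D : α → ℕ} {v : α → ℕ × ℕ} {l : α → List Unit} (hD : PolyTime D) (hv : PolyTime v)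
    (hl : PolyTime l) : PolyTime fun x => gapOf (D x) (v x) (l x) := by
  unfold _root_.gapOf
  refine snd (foldl (S := fun x => 8 * (codeSize (l x) + codeSize (D x) + 1) + 3)
    (f := fun x s _ => gapStep (D x) (v x) s)
    (b := fun _ => (0, 1)) ?_ (by fun_prop) hl
    (((PolyBdd.const 8).mul ((hl.polyBdd.add hD.polyBdd).add (.const 1))).add (.const 3))
    fun x l₁ l₂ hx => ?_)
  · unfold gapStep
    have h₁ : PolyTime fun p : α × (ℕ × ℕ) × Unit => D p.1 := comp hD (by fun_prop)
    have h₂ : PolyTime fun p : α × (ℕ × ℕ) × Unit => v p.1 := comp hv (by fun_prop)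
    fun_prop
  · obtain ⟨h₁, h₂⟩ := gapOf_aux (D x) (v x) l₁
    have h₃ : l₁.length ≤ codeSize (l x) := by
      have := length_le_codeSize (l x)
      rw [hx, List.length_append] at this
      rw [hx]
      omega
    have h₄ : 2 ^ l₁.length < 2 ^ (codeSize (l x) + codeSize (D x) + 1) :=
      Nat.pow_lt_pow_right (by norm_num) (by omega)
    refine codeSize_pair_le (h₁.trans_lt ?_) (h₂.trans_lt h₄)
    calc l₁.length * D x < 2 ^ (l₁.length + 1) * 2 ^ codeSize (D x) :=
          Nat.mul_lt_mul_of_lt_of_le (Nat.lt_two_pow_self.trans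
            (Nat.pow_lt_pow_right (by norm_num) (by omega))) (lt_two_pow_codeSize _).le
            (Nat.two_pow_pos _)
      _ ≤ 2 ^ (codeSize (l x) + codeSize (D x) + 1) := by
        rw [← pow_add]
        exact Nat.pow_le_pow_right (by norm_num) (by omega)

@[fun_prop]
theorem diffTerms {tbl : α → List Row} {pows : α → List PowEntry} {p q : α → ℕ}
    (ht : PolyTime tbl) (hl : PolyTime pows) (hp : PolyTime p) (hq : PolyTime q) :
    PolyTime fun x => diffTerms (tbl x) (pows x) (p x) (q x) := by
  unfold _root_.diffTerms
  refine append (map ?_ ht) (map ?_ hl)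
  · have h₁ : PolyTime fun y : α × Row => p y.1 := comp hp (by fun_prop)
    have h₂ : PolyTime fun y : α × Row => q y.1 := comp hq (by fun_prop)
    fun_prop
  · have h₁ : PolyTime fun y : α × PowEntry => p y.1 := comp hp (by fun_prop)
    have h₂ : PolyTime fun y : α × PowEntry => q y.1 := comp hq (by fun_prop)
    fun_prop

@[fun_prop]
theorem compareVars {fuel : α → List Unit} {tbl : α → List Row} {pows : α → List PowEntry}
    {p q : α → ℕ} (hf : PolyTime fuel) (ht : PolyTime tbl) (hl : PolyTime pows) (hp : PolyTime p)
    (hq : PolyTime q) :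
    PolyTime fun x => compareVars (fuel x) (tbl x) (pows x) (p x) (q x) := by
  unfold _root_.compareVars
  have h₁ : PolyTime fun x => (tbl x).foldl _root_.elimStep
    (1, _root_.diffTerms (tbl x) (pows x) (p x) (q x)) := by fun_prop
  have h₂ := foldl_hornerStep hf.twoPow h₁.snd
  exact (decide_le h₂.snd.snd h₂.snd.fst).prodMk (cond h₂.fst hf.twoPow (gapOf h₁.fst h₂.snd hf))

@[fun_prop]
theorem insertPow {fuel : α → List Unit} {tbl : α → List Row} {pows : α → List PowEntry}
    {i v : α → ℕ} (hf : PolyTime fuel) (ht : PolyTime tbl) (hl : PolyTime pows) (hi : PolyTime i)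
    (hv : PolyTime v) :
    PolyTime fun x => insertPow (fuel x) (tbl x) (pows x) (i x) (v x) := by
  unfold _root_.insertPow
  refine reverse (snd (snd (foldl_of_le_add (S := fun x => codeSize (pows x) +
    codeSize (i x) + codeSize (v x) + 8 * (codeSize (fuel x) + 1) + 20)
    (f := fun x => insertStep (fuel x) (tbl x) (pows x) (i x) (v x))
    (b := fun x => (v x, false, [])) ?_ (by fun_prop) hl ?_ fun x s e he => ?_)))
  · unfold insertStep
    have h₁ : PolyTime fun y : α × (ℕ × Bool × List PowEntry) × PowEntry => fuel y.1 :=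
      comp hf (by fun_prop)
    have h₂ : PolyTime fun y : α × (ℕ × Bool × List PowEntry) × PowEntry => tbl y.1 :=
      comp ht (by fun_prop)
    have h₃ : PolyTime fun y : α × (ℕ × Bool × List PowEntry) × PowEntry => pows y.1 :=
      comp hl (by fun_prop)
    have h₄ : PolyTime fun y : α × (ℕ × Bool × List PowEntry) × PowEntry => i y.1 :=
      comp hi (by fun_prop)
    have h₅ : PolyTime fun y : α × (ℕ × Bool × List PowEntry) × PowEntry => v y.1 :=
      comp hv (by fun_prop)
    fun_prop
  · exact ((((hl.polyBdd.add hi.polyBdd).add hv.polyBdd).add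
      ((PolyBdd.const 8).mul (hf.polyBdd.add (.const 1))))).add (.const 20)
  · have h₁ := codeSize_le_of_mem he
    have h₂ := codeSize_compareVars_snd (fuel x) (tbl x) (pows x) (v x) e.exp
    have h₃ := codeSize_compareVars_snd (fuel x) (tbl x) (pows x) s.1 (v x)
    have h₄ := codeSize_bool_le true
    rw [codeSize_powEntry] at h₁
    obtain ⟨a, b, c⟩ := s
    have h₅ := codeSize_bool_le b
    unfold insertStep
    cases !b && (_root_.compareVars (fuel x) (tbl x) (pows x) (v x) e.exp).1 <;>
    simp only [cond_true, cond_false, codeSize_mk, codeSize_cons, codeSize_powEntry] at * <;> omega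

end PolyTime

theorem codeSize_insertPow_le (fuel : List Unit) (tbl : List Row) (pows : List PowEntry)
    (i v : ℕ) : codeSize (insertPow fuel tbl pows i v) ≤
      codeSize pows + (codeSize i + codeSize v + 8 * (codeSize fuel + 1) + 20) := by
  have key : ∀ (l : List PowEntry) (s : ℕ × Bool × List PowEntry),
      codeSize (l.foldl (insertStep fuel tbl pows i v) s).2.2 + 1 ≤
        codeSize s.2.2 + codeSize l +
        bif s.2.1 then 0 else codeSize i + codeSize v + 8 * (codeSize fuel + 1) + 20 := by
    intro l
    induction l with
    | nil => intro s; simp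
    | cons e l ih =>
      intro s
      refine (ih _).trans ?_
      have h₂ := codeSize_compareVars_snd fuel tbl pows v e.exp
      have h₃ := codeSize_compareVars_snd fuel tbl pows s.1 v
      obtain ⟨a, b, c⟩ := s
      unfold insertStep
      cases b <;> cases (compareVars fuel tbl pows v e.exp).1 <;>
      simp only [Bool.not_true, Bool.not_false, Bool.and_true, Bool.and_false, cond_true,
        cond_false, codeSize_cons, codeSize_powEntry] at * <;> omega
  have := key pows (v, false, [])
  simp only [codeSize_nil, cond_false] at this
  rw [insertPow, codeSize_reverse]
  omega

namespace PolyTime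

variable {α : Type} [TreeCode α]

theorem rowsNonneg {fuel : α → List Unit} {rows : α → List Row} {p : α → ℕ} (hf : PolyTime fuel)
    (hr : PolyTime rows) (hp : PolyTime p) :
    PolyTime fun x => rowsNonneg (fuel x) (rows x) (p x) := by
  unfold _root_.rowsNonneg
  have h : PolyTime fun x => (rows x).foldl (rowStep (fuel x)) ([], [⟨0, 1, 1⟩]) := by
    refine foldl_of_le_add (S := fun x => 8 * (codeSize (fuel x) + 1) + 20)
      (f := fun x => rowStep (fuel x)) (b := fun _ => ([], [⟨0, 1, 1⟩])) ?_ (by fun_prop) hr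
      (((PolyBdd.const 8).mul (hf.polyBdd.add (.const 1))).add (.const 20)) fun x s r _ => ?_
    · unfold rowStep
      have : PolyTime fun y : α × (List Row × List PowEntry) × Row => fuel y.1 :=
        comp hf (by fun_prop)
      fun_prop
    · have h₁ := codeSize_row r
      have h₂ := codeSize_insertPow_le (fuel x) s.1 s.2 r.idx r.j
      obtain ⟨t, q⟩ := s
      unfold rowStep
      cases r.isExp <;>
      simp only [cond_true, cond_false, codeSize_mk, codeSize_cons] at * <;> omega
  fun_prop

end PolyTime

/-! ### Parsing of programs -/

/-- A numbering of the alphabet. -/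
def LESLPSymbol.code : LESLPSymbol → ℕ
  | var => 0
  | tick => 1
  | assign => 2
  | nought => 3
  | plus => 4
  | pow => 5
  | minus => 6
  | slash => 7
  | times => 8
  | bit false => 9
  | bit true => 10
  | semicolon => 11

theorem LESLPSymbol.code_injective : Function.Injective LESLPSymbol.code := by
  intro a b h
  rcases a with _ | _ | _ | _ | _ | _ | _ | _ | _ | (_ | _) | _ <;>
  rcases b with _ | _ | _ | _ | _ | _ | _ | _ | _ | (_ | _) | _ <;> simp_all [code]

instance : TreeCode LESLPSymbol := ⟨fun s => enc s.code⟩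

/-- The state of the parser: the rows that have been read, the last one coming first, and the parts
of the statement being read, namely the index of its left-hand side, the last two variables, the
absolute value of the numerator, the digits of the number being read, the last one coming first,
the sign, and the symbol that tells the kind of expression. -/
structure ParseState where
  rows : List Row
  idx : ℕ
  fst : ℕ
  snd : ℕ
  num : ℕ
  bits : List Bool
  neg : Bool
  op : LESLPSymbol

instance : TreeCode ParseState :=
  ⟨fun s => enc (s.rows, s.idx, s.fst, s.snd, s.num, s.bits, s.neg, s.op)⟩

theorem codeSize_parseState (s : ParseState) : codeSize s = codeSize s.rows + codeSize s.idx +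
    codeSize s.fst + codeSize s.snd + codeSize s.num + codeSize s.bits + codeSize s.neg +
    codeSize s.op + 7 := by
  change codeSize (s.rows, s.idx, s.fst, s.snd, s.num, s.bits, s.neg, s.op) = _
  simp only [codeSize_mk]
  omega

namespace PolyTime

variable {α : Type} [TreeCode α]

@[fun_prop]
theorem decide_symbol_eq {f : α → LESLPSymbol} (hf : PolyTime f) (c : LESLPSymbol) :
    PolyTime fun x => decide (f x = c) := by
  have h : PolyTime fun x => (f x).code :=
    comp (f := LESLPSymbol.code) (of_enc_eq fun _ => rfl) hf
  simp only [← LESLPSymbol.code_injective.eq_iff]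
  fun_prop

section ParseState

variable {f : α → ParseState}

theorem parseFields (hf : PolyTime f) : PolyTime fun x => ((f x).rows, (f x).idx, (f x).fst,
    (f x).snd, (f x).num, (f x).bits, (f x).neg, (f x).op) :=
  comp (f := fun s : ParseState => (s.rows, s.idx, s.fst, s.snd, s.num, s.bits, s.neg, s.op))
    (of_enc_eq fun _ => rfl) hf

@[fun_prop]
theorem parse_rows (hf : PolyTime f) : PolyTime fun x => (f x).rows := hf.parseFields.fst

@[fun_prop]
theorem parse_idx (hf : PolyTime f) : PolyTime fun x => (f x).idx := hf.parseFields.snd.fst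

@[fun_prop]
theorem parse_fst (hf : PolyTime f) : PolyTime fun x => (f x).fst := hf.parseFields.snd.snd.fst

@[fun_prop]
theorem parse_snd (hf : PolyTime f) : PolyTime fun x => (f x).snd :=
  hf.parseFields.snd.snd.snd.fst

@[fun_prop]
theorem parse_num (hf : PolyTime f) : PolyTime fun x => (f x).num :=
  hf.parseFields.snd.snd.snd.snd.fst

@[fun_prop]
theorem parse_bits (hf : PolyTime f) : PolyTime fun x => (f x).bits :=
  hf.parseFields.snd.snd.snd.snd.snd.fst

@[fun_prop]
theorem parse_neg (hf : PolyTime f) : PolyTime fun x => (f x).neg :=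
  hf.parseFields.snd.snd.snd.snd.snd.snd.fst

@[fun_prop]
theorem parse_op (hf : PolyTime f) : PolyTime fun x => (f x).op :=
  hf.parseFields.snd.snd.snd.snd.snd.snd.snd

@[fun_prop]
theorem parse_mk {r : α → List Row} {i u v n : α → ℕ} {b : α → List Bool} {s : α → Bool}
    {o : α → LESLPSymbol} (hr : PolyTime r) (hi : PolyTime i) (hu : PolyTime u) (hv : PolyTime v)
    (hn : PolyTime n) (hb : PolyTime b) (hs : PolyTime s) (ho : PolyTime o) :
    PolyTime fun x => ParseState.mk (r x) (i x) (u x) (v x) (n x) (b x) (s x) (o x) :=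
  (comp (f := fun p : List Row × ℕ × ℕ × ℕ × ℕ × List Bool × Bool × LESLPSymbol =>
    ParseState.mk p.1 p.2.1 p.2.2.1 p.2.2.2.1 p.2.2.2.2.1 p.2.2.2.2.2.1 p.2.2.2.2.2.2.1
      p.2.2.2.2.2.2.2) (of_enc_eq fun _ => rfl)
    (hr.prodMk (hi.prodMk (hu.prodMk (hv.prodMk (hn.prodMk (hb.prodMk (hs.prodMk ho))))))) :)

end ParseState

end PolyTime

/-- The row of the statement that has been read. In the rows, the index of the variable `x_i` of
the program is `i + 1`, the index `0` being that of the constant `1`. -/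
def ParseState.row (s : ParseState) : Row :=
  bif decide (s.op = .plus) then ⟨s.idx, false, s.fst, (1, 0), s.snd, (1, 0), 1⟩
  else bif decide (s.op = .pow) then ⟨s.idx, true, s.snd, (0, 0), 0, (0, 0), 1⟩
  else bif decide (s.op = .times) then ⟨s.idx, false, s.snd,
    bif s.neg then (0, s.num) else (s.num, 0), 0, (0, 0), bitsVal s.bits.reverse⟩
  else ⟨s.idx, false, 0, (0, 0), 0, (0, 0), 1⟩

/-- The state of the parser after a symbol has been read. -/
def parseStep (s : ParseState) : LESLPSymbol → ParseState
  | .var => ⟨s.rows, s.idx, s.snd, 1, s.num, s.bits, s.neg, s.op⟩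
  | .tick => ⟨s.rows, s.idx, s.fst, s.snd + 1, s.num, s.bits, s.neg, s.op⟩
  | .assign => ⟨s.rows, s.snd, s.fst, 0, s.num, s.bits, s.neg, s.op⟩
  | .minus => ⟨s.rows, s.idx, s.fst, s.snd, s.num, s.bits, true, s.op⟩
  | .slash => ⟨s.rows, s.idx, s.fst, s.snd, bitsVal s.bits.reverse, [], s.neg, s.op⟩
  | .bit b => ⟨s.rows, s.idx, s.fst, s.snd, s.num, b :: s.bits, s.neg, s.op⟩
  | .semicolon => ⟨s.row :: s.rows, 0, 0, 0, 0, [], false, .nought⟩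
  | .nought => ⟨s.rows, s.idx, s.fst, s.snd, s.num, s.bits, s.neg, .nought⟩
  | .plus => ⟨s.rows, s.idx, s.fst, s.snd, s.num, s.bits, s.neg, .plus⟩
  | .pow => ⟨s.rows, s.idx, s.fst, s.snd, s.num, s.bits, s.neg, .pow⟩
  | .times => ⟨s.rows, s.idx, s.fst, s.snd, s.num, s.bits, s.neg, .times⟩

/-- The rows of a program, the last one coming first. -/
def parseRows (w : List LESLPSymbol) : List Row :=
  (w.foldl parseStep ⟨[], 0, 0, 0, 0, [], false, .nought⟩).rows

/-- Whether the last variable of a program that assigns integers to all variables is nonnegative.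
With `L` the length of the word, all coefficients in the comparisons are at most `2 ^ L`, and the
cut-off at `2 ^ (4 * L)` is large enough for them. -/
def lastNonneg (w : List LESLPSymbol) : Bool :=
  rowsNonneg ((w ++ (w ++ (w ++ w))).map fun _ => ()) (parseRows w).reverse
    ((parseRows w).headD ⟨0, false, 0, 0, 0, 0, 0⟩).idx

theorem codeSize_succ_le (n : ℕ) : codeSize (n + 1) ≤ codeSize n + 4 := by
  have hc (b : Bool) (m : ℕ) (h : m = 0 → b = true) :
      codeSize (Nat.bit b m) = codeSize b + codeSize m + 1 := by
    change codeSize (Nat.bit b m).bits = codeSize b + codeSize m.bits + 1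
    rw [Nat.bits_append_bit _ _ h, codeSize_cons]
  have h0 : codeSize 0 = 1 := rfl
  have ht : codeSize true = 3 := rfl
  have hf : codeSize false = 1 := rfl
  induction n using Nat.binaryRec' with
  | zero =>
    have := hc true 0 (by simp)
    simp only [Nat.bit_true, Nat.mul_zero, Nat.zero_add] at this
    simp only [Nat.zero_add, this]
    omega
  | bit b m h ih =>
    rw [hc b m h]
    cases b
    · have e : Nat.bit false m + 1 = Nat.bit true m := by simp [Nat.bit_val]
      rw [e, hc true m (by simp)]
      omega
    · have e : Nat.bit true m + 1 = Nat.bit false (m + 1) := by simp [Nat.bit_val]; ring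
      rw [e, hc false (m + 1) (by simp)]
      omega

theorem codeSize_bitsVal_le (l : List Bool) : codeSize (bitsVal l) ≤ codeSize l := by
  induction l with
  | nil => exact le_rfl
  | cons b l ih =>
    by_cases h : bitsVal l = 0 → b = true
    · change codeSize (Nat.bit b (bitsVal l)).bits ≤ _
      change codeSize (bitsVal l).bits ≤ _ at ih
      rw [Nat.bits_append_bit _ _ h, codeSize_cons, codeSize_cons]
      omega
    · have e : bitsVal (b :: l) = 0 := by
        rw [bitsVal_cons]
        simp_all
      rw [e]
      exact one_le_codeSize _

theorem codeSize_symbol_le (c : LESLPSymbol) : codeSize c ≤ 17 := by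
  refine codeSize_nat_le (n := c.code) (k := 4) ?_
  rcases c with _ | _ | _ | _ | _ | _ | _ | _ | _ | (_ | _) | _ <;> simp [LESLPSymbol.code]

theorem codeSize_parseStep_le (s : ParseState) (c : LESLPSymbol) :
    codeSize (parseStep s c) ≤ codeSize s + 80 := by
  have h₀ : codeSize 0 = 1 := rfl
  have h₁ : codeSize 1 = 5 := rfl
  have hop := codeSize_symbol_le
  have hb (b : Bool) := codeSize_bool_le b
  have hrow : codeSize s.row ≤ codeSize s.idx + codeSize s.fst + codeSize s.snd + codeSize s.num +
      codeSize s.bits + 40 := by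
    have h₂ := codeSize_bitsVal_le s.bits.reverse
    rw [codeSize_reverse] at h₂
    have h₃ := hb true
    have h₄ := hb false
    have h₅ := one_le_codeSize s.fst
    have h₆ := one_le_codeSize s.snd
    have h₇ := one_le_codeSize s.num
    have h₈ := one_le_codeSize s.bits
    unfold ParseState.row
    cases decide (s.op = .plus) <;> cases decide (s.op = .pow) <;>
    cases decide (s.op = .times) <;> cases s.neg <;>
    simp only [cond_true, cond_false, codeSize_row, codeSize_mk, h₀, h₁] <;> omega
  have h₂ := codeSize_succ_le s.snd
  have h₃ := codeSize_bitsVal_le s.bits.reverse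
  rw [codeSize_reverse] at h₃
  have h₄ := hb s.neg
  have h₅ := hop s.op
  have i₁ := one_le_codeSize s.idx
  have i₂ := one_le_codeSize s.fst
  have i₃ := one_le_codeSize s.snd
  have i₄ := one_le_codeSize s.num
  have i₅ := one_le_codeSize s.bits
  have i₆ := one_le_codeSize s.neg
  have i₇ := one_le_codeSize s.op
  have o₁ := hop .nought
  have o₂ := hop .plus
  have o₃ := hop .pow
  have o₄ := hop .times
  have b₁ := hb true
  have b₂ := hb false
  cases c with
  | bit b =>
    have := hb b
    rw [codeSize_parseState, codeSize_parseState s]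
    simp only [parseStep, codeSize_cons]
    omega
  | _ =>
    rw [codeSize_parseState, codeSize_parseState s]
    simp only [parseStep, codeSize_cons, codeSize_nil, h₀, h₁]
    omega

namespace PolyTime

variable {α : Type} [TreeCode α]

@[fun_prop]
theorem parseState_row {f : α → ParseState} (hf : PolyTime f) : PolyTime fun x => (f x).row := by
  unfold ParseState.row
  fun_prop

theorem parseStep {f : α → ParseState} {c : α → LESLPSymbol} (hf : PolyTime f) (hc : PolyTime c) :
    PolyTime fun x => parseStep (f x) (c x) := by
  have e (s : ParseState) (c : LESLPSymbol) : _root_.parseStep s c =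
      bif decide (c = .var) then ⟨s.rows, s.idx, s.snd, 1, s.num, s.bits, s.neg, s.op⟩
      else bif decide (c = .tick) then
        ⟨s.rows, s.idx, s.fst, s.snd + 1, s.num, s.bits, s.neg, s.op⟩
      else bif decide (c = .assign) then ⟨s.rows, s.snd, s.fst, 0, s.num, s.bits, s.neg, s.op⟩
      else bif decide (c = .minus) then ⟨s.rows, s.idx, s.fst, s.snd, s.num, s.bits, true, s.op⟩
      else bif decide (c = .slash) then
        ⟨s.rows, s.idx, s.fst, s.snd, _root_.bitsVal s.bits.reverse, [], s.neg, s.op⟩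
      else bif decide (c = .bit true) || decide (c = .bit false) then
        ⟨s.rows, s.idx, s.fst, s.snd, s.num, decide (c = .bit true) :: s.bits, s.neg, s.op⟩
      else bif decide (c = .semicolon) then ⟨s.row :: s.rows, 0, 0, 0, 0, [], false, .nought⟩
      else ⟨s.rows, s.idx, s.fst, s.snd, s.num, s.bits, s.neg, c⟩ := by
    rcases c with _ | _ | _ | _ | _ | _ | _ | _ | _ | (_ | _) | _ <;> rfl
  simp only [e]
  fun_prop

@[fun_prop]
theorem parseRows {w : α → List LESLPSymbol} (hw : PolyTime w) :
    PolyTime fun x => parseRows (w x) := by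
  unfold _root_.parseRows
  refine parse_rows (foldl_of_le_add (f := fun _ => _root_.parseStep) (S := fun _ => 80)
    (b := fun _ => ⟨[], 0, 0, 0, 0, [], false, .nought⟩) (parseStep (by fun_prop) (by fun_prop))
    (by fun_prop) hw (.const 80) fun x s c _ => ?_)
  have := codeSize_parseStep_le s c
  omega

theorem lastNonneg : PolyTime lastNonneg := by
  unfold _root_.lastNonneg
  refine rowsNonneg (map (by fun_prop) (by fun_prop)) (by fun_prop) (by fun_prop)

end PolyTime

/-! ### Correctness of the comparison -/

/-- The value of a linear combination of the variables. -/
def termSum (x : ℕ → ℤ) (l : List Term) : ℤ := (l.map fun t => pairVal t.coef * x t.idx).sum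

/-- The linear rows `tbl` hold under the valuation `x`, and each of them expresses its variable by
the variables of the rows behind it and the variables in `O`. -/
def LinTable (x : ℕ → ℤ) (O : List ℕ) : List Row → Prop
  | [] => True
  | r :: t => 1 ≤ r.den ∧ r.j ∈ t.map Row.idx ++ O ∧ r.k ∈ t.map Row.idx ++ O ∧
      r.den * x r.idx = pairVal r.a * x r.j + pairVal r.b * x r.k ∧ LinTable x O t

/-- The entries are sorted by decreasing exponents that are at most `v`, the last exponent being
`0`, and the gaps are the quotients of neighboring powers, where `2 ^ v` stands in front of the
first one, cut off at `2 ^ B`. -/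
def PowTable (x : ℕ → ℤ) (B : ℕ) : ℕ → List PowEntry → Prop
  | v, [] => v = 0
  | v, e :: l => ∃ u : ℕ, x e.exp = u ∧ u ≤ v ∧ x e.idx = 2 ^ u ∧ e.gap = 2 ^ min (v - u) B ∧
      PowTable x B u l

@[simp] theorem pairVal_add (c d : ℕ × ℕ) : pairVal (pairAdd c d) = pairVal c + pairVal d := by
  simp only [pairVal, pairAdd]; push_cast; ring

@[simp] theorem pairVal_scale (g : ℕ) (c : ℕ × ℕ) : pairVal (pairScale g c) = g * pairVal c := by
  simp only [pairVal, pairScale]; push_cast; ring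

@[simp] theorem pairVal_mul (c d : ℕ × ℕ) : pairVal (pairMul c d) = pairVal c * pairVal d := by
  simp only [pairVal, pairMul]; push_cast; ring

@[simp] theorem pairVal_zero : pairVal (0, 0) = 0 := rfl

theorem sum_map_ite_eq {α : Type} (l : List α) (f : α → ℕ) (h : (l.map f).Nodup) {j : ℕ}
    (hj : j ∈ l.map f) (x : ℕ → ℤ) (d : ℤ) :
    (l.map fun t => (if f t = j then d else 0) * x (f t)).sum = d * x j := by
  induction l with
  | nil => simp at hj
  | cons t l ih =>
    simp only [List.map_cons, List.nodup_cons, List.mem_cons, List.sum_cons] at *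
    by_cases e : f t = j
    · have h0 : (l.map fun t => (if f t = j then d else 0) * x (f t)).sum = 0 := by
        refine List.sum_eq_zero fun y hy => ?_
        obtain ⟨u, hu, rfl⟩ := List.mem_map.1 hy
        rw [if_neg, zero_mul]
        rintro rfl
        exact h.1 (List.mem_map.2 ⟨u, hu, e.symm⟩)
      rw [h0, if_pos e, e, add_zero]
    · rw [if_neg e, ih h.2 (hj.resolve_left (Ne.symm e)), zero_mul, zero_add]

/-- Substituting the row for its variable in a linear combination multiplies the value by `r.den`.
-/
theorem termSum_substTerm {x : ℕ → ℤ} {r : Row} {t : Term} {l : List Term}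
    (hn : (l.map Term.idx).Nodup) (hj : r.j ∈ l.map Term.idx) (hk : r.k ∈ l.map Term.idx)
    (ht : t.idx = r.idx) (hr : r.den * x r.idx = pairVal r.a * x r.j + pairVal r.b * x r.k) :
    termSum x (l.map (r.substTerm t.coef)) = r.den * termSum x (t :: l) := by
  have e : termSum x (l.map (r.substTerm t.coef)) = r.den * termSum x l +
      (l.map fun u => (if u.idx = r.j then pairVal r.a * pairVal t.coef else 0) * x u.idx).sum +
      (l.map fun u => (if u.idx = r.k then pairVal r.b * pairVal t.coef else 0) * x u.idx).sum := by
    clear hn hj hk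
    induction l with
    | nil => simp [termSum]
    | cons u l ih =>
      simp only [termSum, List.map_cons, List.sum_cons] at *
      rw [ih]
      simp only [Row.substTerm, pairVal_add, pairVal_scale, Bool.cond_decide, apply_ite pairVal,
        pairVal_mul, pairVal_zero]
      ring
  rw [e, sum_map_ite_eq l Term.idx hn hj, sum_map_ite_eq l Term.idx hn hk]
  simp only [termSum, List.map_cons, List.sum_cons, ht]
  linear_combination - pairVal t.coef * hr

/-- Elimination of all linear rows multiplies the linear combination by a positive factor and
leaves one term for each power of two. -/
theorem foldl_elimStep_spec {x : ℕ → ℤ} {O : List (ℕ × ℕ)} {tbl : List Row}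
    (h : LinTable x (O.map Prod.fst) tbl)
    (hn : (tbl.map Row.idx ++ O.map Prod.fst).Nodup) {D : ℕ} {l : List Term}
    (hl : l.map (fun t => (t.idx, t.gap)) = tbl.map (fun r => (r.idx, 1)) ++ O) (hD : 1 ≤ D) :
    (tbl.foldl elimStep (D, l)).2.map (fun t => (t.idx, t.gap)) = O ∧
    1 ≤ (tbl.foldl elimStep (D, l)).1 ∧
    D * termSum x (tbl.foldl elimStep (D, l)).2 = (tbl.foldl elimStep (D, l)).1 * termSum x l := by
  induction tbl generalizing D l with
  | nil => exact ⟨by simpa using hl, hD, rfl⟩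
  | cons r tbl ih =>
    obtain ⟨hd, hj, hk, hr, h⟩ := h
    rcases l with _ | ⟨t, l⟩
    · simp at hl
    simp only [List.map_cons, List.cons_append, List.cons.injEq, Prod.mk.injEq,
      List.nodup_cons] at hl hn
    have hidx : l.map Term.idx = tbl.map Row.idx ++ O.map Prod.fst := by
      have := congrArg (List.map Prod.fst) hl.2
      simpa [Function.comp_def] using this
    rw [← hidx] at hj hk hn
    have hs := termSum_substTerm hn.2 hj hk hl.1.1 hr
    obtain ⟨i₁, i₂, i₃⟩ := ih h (hidx ▸ hn.2) (D := r.den * D) (l := l.map (r.substTerm t.coef))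
      (by simpa [Function.comp_def, Row.substTerm] using hl.2) (Nat.mul_pos hd hD)
    refine ⟨i₁, i₂, ?_⟩
    simp only [List.foldl_cons, elimStep, List.tail_cons, List.headD_cons]
    rw [hs] at i₃
    have : (r.den : ℤ) ≠ 0 := by exact_mod_cast (by omega : r.den ≠ 0)
    refine mul_left_cancel₀ this ?_
    push_cast at i₃
    linear_combination i₃

theorem termSum_diffTerms (x : ℕ → ℤ) {tbl : List Row} {pows : List PowEntry} {p q : ℕ}
    (hn : (tbl.map Row.idx ++ pows.map PowEntry.idx).Nodup)
    (hp : p ∈ tbl.map Row.idx ++ pows.map PowEntry.idx)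
    (hq : q ∈ tbl.map Row.idx ++ pows.map PowEntry.idx) :
    termSum x (diffTerms tbl pows p q) = x p - x q := by
  set L := tbl.map Row.idx ++ pows.map PowEntry.idx with hL
  have e : termSum x (diffTerms tbl pows p q) =
      (L.map fun i => (if i = p then 1 else 0) * x i).sum +
      (L.map fun i => (if i = q then -1 else 0) * x i).sum := by
    have : (fun i => (if i = p then (1 : ℤ) else 0) * x i + (if i = q then -1 else 0) * x i) =
        fun i => pairVal (bif decide (i = p) then 1 else 0, bif decide (i = q) then 1 else 0) *
          x i := by
      funext i
      simp only [Bool.cond_decide, pairVal]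
      split_ifs <;> simp
    rw [← List.sum_map_add, this, hL]
    simp [termSum, diffTerms, Function.comp_def]
  have h₁ := sum_map_ite_eq L id (by simpa using hn) (by simpa using hp) x 1
  have h₂ := sum_map_ite_eq L id (by simpa using hn) (by simpa using hq) x (-1)
  simp only [id] at h₁ h₂
  rw [e, h₁, h₂]
  ring

/-- The sum of the absolute values of the coefficients. -/
def coefSum (l : List Term) : ℤ := (l.map fun t => |pairVal t.coef|).sum

theorem coefSum_nonneg (l : List Term) : 0 ≤ coefSum l :=
  List.sum_nonneg fun y hy => by
    obtain ⟨t, _, rfl⟩ := List.mem_map.1 hy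
    exact abs_nonneg _

theorem abs_termSum_le {x : ℕ → ℤ} {B v : ℕ} {pows : List PowEntry} (h : PowTable x B v pows)
    {l : List Term}
    (hl : l.map (fun t => (t.idx, t.gap)) = pows.map fun e => (e.idx, e.gap)) :
    |termSum x l| ≤ coefSum l * 2 ^ v := by
  induction pows generalizing v l with
  | nil =>
    obtain rfl : l = [] := by simpa using hl
    simp [termSum, coefSum]
  | cons e pows ih =>
    rcases l with _ | ⟨t, l⟩
    · simp at hl
    simp only [List.map_cons, List.cons.injEq, Prod.mk.injEq] at hl
    obtain ⟨u, _, huv, hu, _, h⟩ := h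
    have h₁ := ih h hl.2
    have h₂ : (2 : ℤ) ^ u ≤ 2 ^ v := pow_le_pow_right₀ (by norm_num) huv
    have h₃ := coefSum_nonneg l
    simp only [termSum, coefSum, List.map_cons, List.sum_cons] at *
    refine (abs_add_le _ _).trans ?_
    rw [hl.1.1, hu, abs_mul, abs_of_nonneg (by positivity : (0 : ℤ) ≤ 2 ^ u), add_mul]
    exact add_le_add (mul_le_mul_of_nonneg_left h₂ (abs_nonneg _))
      (h₁.trans (mul_le_mul_of_nonneg_left h₂ h₃))

theorem foldl_hornerStep_true (Q : ℕ) (c : ℕ × ℕ) (l : List Term) :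
    l.foldl (hornerStep Q) (true, c) = (true, c) := by
  induction l with
  | nil => rfl
  | cons t l ih => rw [List.foldl_cons, hornerStep]; exact ih

/-- Horner's scheme computes the linear combination, or it stops with a value of the same sign, in
which case the linear combination is large, since the remaining powers are smaller by the factor
`2 ^ B` at least. -/
theorem foldl_hornerStep_spec {x : ℕ → ℤ} {B v : ℕ} {pows : List PowEntry}
    (h : PowTable x B v pows) {l : List Term}
    (hl : l.map (fun t => (t.idx, t.gap)) = pows.map fun e => (e.idx, e.gap))
    (hC : coefSum l ≤ 2 ^ B) (c : ℕ × ℕ) :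
    let s := l.foldl (hornerStep (2 ^ B)) (false, c)
    let T := pairVal c * 2 ^ v + termSum x l
    (s.1 = false → pairVal s.2 = T) ∧
    (s.1 = true → 0 < pairVal s.2 ∧ 2 ^ B - coefSum l ≤ T ∨
      pairVal s.2 < 0 ∧ T ≤ -(2 ^ B - coefSum l)) := by
  induction pows generalizing v l c with
  | nil =>
    obtain rfl : l = [] := by simpa using hl
    obtain rfl : v = 0 := h
    simp [termSum]
  | cons e pows ih =>
    rcases l with _ | ⟨t, l⟩
    · simp at hl
    obtain ⟨u, hx, huv, hu, hg, h⟩ := h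
    simp only [List.map_cons, List.cons.injEq, Prod.mk.injEq] at hl
    obtain ⟨⟨hl₁, hl₂⟩, hl⟩ := hl
    have hT : termSum x (t :: l) = pairVal t.coef * 2 ^ u + termSum x l := by
      rw [termSum, List.map_cons, List.sum_cons, hl₁, hu, termSum]
    have hCc : coefSum (t :: l) = |pairVal t.coef| + coefSum l := by simp [coefSum]
    have hc0 : c.1 = c.2 ↔ pairVal c = 0 := by rw [pairVal]; omega
    simp only [List.foldl_cons]
    by_cases hs : t.gap = 2 ^ B ∧ pairVal c ≠ 0
    · -- The scheme stops: the gap is at least `B` and the value `c` is nonzero.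
      have e₁ : hornerStep (2 ^ B) (false, c) t = (true, c) := by
        simp [hornerStep, hs.1, hc0, hs.2]
      rw [e₁, foldl_hornerStep_true]
      refine ⟨by simp, fun _ => ?_⟩
      have hB : u + B ≤ v := by
        have := hs.1
        rw [hl₂, hg] at this
        have := Nat.pow_right_injective le_rfl this
        omega
      have hb : |termSum x (t :: l)| ≤ coefSum (t :: l) * 2 ^ u := by
        refine abs_termSum_le (B := B) (v := u) (pows := ⟨e.idx, e.exp, 2 ^ min (u - u) B⟩ :: pows)
          (l := ⟨t.idx, 2 ^ min (u - u) B, t.coef⟩ :: l) ⟨u, hx, le_rfl, hu, rfl, h⟩ ?_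
        simp [hl₁, hl]
      have h2v : (2 : ℤ) ^ u * 2 ^ B ≤ 2 ^ v := by
        rw [← pow_add]
        exact pow_le_pow_right₀ (by norm_num) hB
      have h2u : (1 : ℤ) ≤ 2 ^ u := one_le_pow₀ (by norm_num)
      have h2v' : (0 : ℤ) ≤ 2 ^ v := by positivity
      have hab := abs_le.1 hb
      have hbig : 2 ^ B - coefSum (t :: l) ≤ (2 ^ B - coefSum (t :: l)) * 2 ^ u :=
        le_mul_of_one_le_right (by omega) h2u
      rcases lt_or_gt_of_ne hs.2 with hneg | hpos
      · right
        refine ⟨hneg, ?_⟩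
        have : pairVal c * 2 ^ v ≤ -1 * 2 ^ v := mul_le_mul_of_nonneg_right (by omega) h2v'
        nlinarith
      · left
        refine ⟨hpos, ?_⟩
        have : 1 * 2 ^ v ≤ pairVal c * 2 ^ v := mul_le_mul_of_nonneg_right (by omega) h2v'
        nlinarith
    · -- The scheme goes on: the gap is exact, or it is multiplied by `0`.
      have e₁ : hornerStep (2 ^ B) (false, c) t =
          (false, pairAdd (pairScale t.gap c) t.coef) := by
        have : (decide (t.gap = 2 ^ B) && !decide (c.1 = c.2)) = false := by
          rw [Bool.and_eq_false_iff]
          by_cases h₁ : t.gap = 2 ^ B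
          · right
            simp only [not_and, not_not] at hs
            simp [hc0, hs h₁]
          · left; simp [h₁]
        simp only [hornerStep, this, Bool.or_false, cond_false]
      have e₂ : pairVal c * 2 ^ v = pairVal c * t.gap * 2 ^ u := by
        by_cases h₁ : pairVal c = 0
        · simp [h₁]
        · have h₂ : t.gap ≠ 2 ^ B := fun h₂ => hs ⟨h₂, h₁⟩
          rw [hl₂, hg] at h₂
          have h₃ : min (v - u) B = v - u := by
            rcases min_choice (v - u) B with h₃ | h₃
            · exact h₃
            · exact absurd (by rw [h₃]) h₂
          rw [hl₂, hg, h₃, mul_assoc]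
          push_cast
          rw [← pow_add, Nat.sub_add_cancel huv]
      have := ih h hl (by have := abs_nonneg (pairVal t.coef); omega)
        (pairAdd (pairScale t.gap c) t.coef)
      simp only [pairVal_add, pairVal_scale] at this
      rw [e₁]
      have e₃ : pairVal c * 2 ^ v + termSum x (t :: l) =
          (t.gap * pairVal c + pairVal t.coef) * 2 ^ u + termSum x l := by
        rw [hT, e₂]; ring
      simp only [e₃]
      refine ⟨this.1, fun h₁ => ?_⟩
      have hab := abs_nonneg (pairVal t.coef)
      rcases this.2 h₁ with h₂ | h₂
      · left; exact ⟨h₂.1, by omega⟩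
      · right; exact ⟨h₂.1, by omega⟩

theorem gapOf_eq {D u : ℕ} {v : ℕ × ℕ} (hD : 1 ≤ D) (hv : pairVal v = D * u) (l : List Unit) :
    gapOf D v l = 2 ^ min u l.length := by
  have hv' : v.1 = D * u + v.2 := by rw [pairVal] at hv; push_cast [← Nat.cast_inj (R := ℤ)]; omega
  have key : l.foldl (fun s _ => gapStep D v s) (0, 1) =
      (min u l.length * D, 2 ^ min u l.length) := by
    induction l using List.reverseRecOn with
    | nil => simp
    | append_singleton l a ih =>
      rw [List.foldl_append, ih, List.foldl_cons, List.foldl_nil, List.length_append,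
        List.length_singleton, gapStep]
      rcases lt_or_ge l.length u with h | h
      · have e₁ : min u l.length = l.length := by omega
        have e₂ : min u (l.length + 1) = l.length + 1 := by omega
        have : v.2 + l.length * D < v.1 := by
          rw [hv']
          have : l.length * D < u * D := Nat.mul_lt_mul_of_pos_right h hD
          have := mul_comm u D
          omega
        simp only [e₁, e₂, this, decide_true, cond_true, Prod.mk.injEq]
        constructor <;> ring
      · have e₁ : min u l.length = u := by omega
        have e₂ : min u (l.length + 1) = u := by omega
        have : ¬ v.2 + u * D < v.1 := by
          rw [hv']
          have := mul_comm u D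
          omega
        simp only [e₁, e₂, this, decide_false, cond_false]
  rw [gapOf, key]

theorem coefSum_le {M : ℕ} {s : ℕ × List Term} (h : CoefBdd M s) :
    coefSum s.2 ≤ s.2.length * M := by
  rw [coefSum, ← nsmul_eq_mul]
  have := List.sum_le_card_nsmul (s.2.map fun t => |pairVal t.coef|) (M : ℤ) fun y hy => by
    obtain ⟨t, ht, rfl⟩ := List.mem_map.1 hy
    have := h.2 t ht
    rw [pairVal, abs_le]
    omega
  rwa [List.length_map] at this

theorem coefBdd_diffTerms (tbl : List Row) (pows : List PowEntry) (p q : ℕ) :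
    CoefBdd 1 (1, diffTerms tbl pows p q) := by
  have h (b : Bool) : (bif b then 1 else 0) ≤ 1 := by cases b <;> simp
  refine ⟨le_rfl, fun t ht => ?_⟩
  simp only [diffTerms, List.mem_append, List.mem_map] at ht
  rcases ht with ⟨r, _, rfl⟩ | ⟨r, _, rfl⟩ <;> exact ⟨h _, h _⟩

/-- The outcome `c` of a comparison of two numbers is right, up to the cut-off at `2 ^ B`. -/
def CompareSpec (B : ℕ) (y z : ℤ) (c : Bool × ℕ) : Prop :=
  c.1 = decide (z ≤ y) ∧ ∀ u : ℕ, y = z + u → c.2 = 2 ^ min u B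

/-- The bound on the norms of the rows ensures that `2 ^ B` is at least `D * B` plus the sum of the
absolute values of the coefficients, so that the difference of the variables is at least `B` in
absolute value if Horner's scheme stops early. -/
theorem compareVars_spec {x : ℕ → ℤ} {fuel : List Unit} {tbl : List Row} {pows : List PowEntry}
    {v p q : ℕ} (ht : LinTable x (pows.map PowEntry.idx) tbl)
    (hP : PowTable x fuel.length v pows)
    (hn : (tbl.map Row.idx ++ pows.map PowEntry.idx).Nodup)
    (hB : (tbl.map Row.norm).prod * (pows.length + fuel.length) ≤ 2 ^ fuel.length)
    (hB0 : 1 ≤ fuel.length)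
    (hp : p ∈ tbl.map Row.idx ++ pows.map PowEntry.idx)
    (hq : q ∈ tbl.map Row.idx ++ pows.map PowEntry.idx) :
    CompareSpec fuel.length (x p) (x q) (compareVars fuel tbl pows p q) := by
  have hO : (pows.map fun e => (e.idx, e.gap)).map Prod.fst = pows.map PowEntry.idx := by simp
  obtain ⟨h₁, h₂, h₃⟩ := foldl_elimStep_spec (x := x) (O := pows.map fun e => (e.idx, e.gap))
    (tbl := tbl) (by rwa [hO]) (by rwa [hO]) (D := 1) (l := diffTerms tbl pows p q)
    (by simp [diffTerms, Function.comp_def]) le_rfl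
  have h₄ := (coefBdd_diffTerms tbl pows p q).foldl tbl
  rw [termSum_diffTerms x hn hp hq, Nat.cast_one, one_mul] at h₃
  simp only [compareVars]
  set s := tbl.foldl elimStep (1, diffTerms tbl pows p q)
  set M := (tbl.map Row.norm).prod
  set B := fuel.length
  have h₅ := coefSum_le h₄
  have h₆ : s.2.length = pows.length := by simpa using congrArg List.length h₁
  have h₇ := h₄.1
  rw [one_mul] at h₅ h₇
  have h₈ : coefSum s.2 + s.1 * B ≤ 2 ^ B := by
    have : (M : ℤ) * (pows.length + B) ≤ 2 ^ B := by exact_mod_cast hB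
    have h₉ : (s.1 : ℤ) * B ≤ M * B := by exact_mod_cast Nat.mul_le_mul_right B h₇
    rw [h₆] at h₅
    linarith
  have h₉ : (1 : ℤ) ≤ s.1 * B := by exact_mod_cast Nat.mul_pos h₂ hB0
  have hH := foldl_hornerStep_spec hP h₁ (by omega) (0, 0)
  rw [twoPow_eq]
  simp only [pairVal_zero, zero_mul, zero_add, h₃] at hH
  set h := s.2.foldl (hornerStep (2 ^ B)) (false, 0, 0)
  have hs1 : (0 : ℤ) < s.1 := by exact_mod_cast h₂
  have hle : h.2.2 ≤ h.2.1 ↔ 0 ≤ pairVal h.2 := by rw [pairVal]; omega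
  rcases hb : h.1 with _ | _
  · have hv := hH.1 hb
    refine ⟨?_, fun u hu => ?_⟩
    · simp only [hle, hv, mul_nonneg_iff_of_pos_left hs1, sub_nonneg]
    · refine gapOf_eq h₂ ?_ _
      rw [hv, hu]
      ring
  · rcases hH.2 hb with ⟨h₁₀, h₁₁⟩ | ⟨h₁₀, h₁₁⟩
    · have h₁₂ : (s.1 : ℤ) * B ≤ s.1 * (x p - x q) := by linarith
      have h₁₃ := le_of_mul_le_mul_left h₁₂ hs1
      refine ⟨?_, fun u hu => ?_⟩
      · simp only [hle, h₁₀.le, decide_true]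
        symm
        rw [decide_eq_true_iff]
        omega
      · have : min u B = B := by omega
        rw [this, cond_true]
    · have h₁₂ : (s.1 : ℤ) * (x p - x q) < 0 := by linarith
      have h₁₃ := (pos_iff_neg_of_mul_neg h₁₂).1 hs1
      refine ⟨?_, fun u hu => ?_⟩
      · simp only [hle, not_le.2 h₁₀, decide_false]
        symm
        rw [decide_eq_false_iff_not]
        omega
      · omega

/-! ### Correctness of the insertion of a power -/

theorem foldl_insertStep_true (fuel : List Unit) (tbl : List Row) (pows : List PowEntry)
    (i v : ℕ) (l : List PowEntry) (a : ℕ) (acc : List PowEntry) :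
    (l.foldl (insertStep fuel tbl pows i v) (a, true, acc)).2.2 = l.reverse ++ acc := by
  induction l generalizing a acc with
  | nil => rfl
  | cons e l ih => simp [insertStep, ih]

section Insert

variable {x : ℕ → ℤ} {fuel : List Unit} {tbl : List Row} {pows : List PowEntry} {i v : ℕ}

theorem powTable_insert_head {u a w : ℕ} {e : PowEntry} {l : List PowEntry}
    (hv : x v = u) (hi : x i = 2 ^ u) (hu : u ≤ a) {g g' : ℕ} (hg : g = 2 ^ min (a - u) fuel.length)
    (hw : x e.exp = w) (hwu : w ≤ u) (he : x e.idx = 2 ^ w)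
    (hg' : g' = 2 ^ min (u - w) fuel.length)
    (h : PowTable x fuel.length w l) :
    PowTable x fuel.length a (⟨i, v, g⟩ :: ⟨e.idx, e.exp, g'⟩ :: l) :=
  ⟨u, hv, hu, hi, hg, w, hw, hwu, he, hg', h⟩

/-- The steps of the insertion behind an entry whose exponent `x_a` is greater than `x_v`. The end
of the list is not reached without an insertion, since the last exponent is `0`. -/
theorem foldl_insertStep_spec {u : ℕ} (hv : x v = u) (hi : x i = 2 ^ u) {a b : ℕ}
    (ha : x a = b) (hab : u < b) {l acc : List PowEntry} (hl : PowTable x fuel.length b l)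
    (hc : ∀ y z, (y = a ∨ y = v ∨ ∃ e ∈ l, y = e.exp) → (z = a ∨ z = v ∨ ∃ e ∈ l, z = e.exp) →
      CompareSpec fuel.length (x y) (x z) (compareVars fuel tbl pows y z)) :
    ∃ l', (l.foldl (insertStep fuel tbl pows i v) (a, false, acc)).2.2 = l'.reverse ++ acc ∧
      PowTable x fuel.length b l' ∧ (l'.map PowEntry.idx).Perm (i :: l.map PowEntry.idx) ∧
      ∀ e ∈ l', e.exp = v ∨ ∃ e' ∈ l, e.exp = e'.exp := by
  induction l generalizing a b acc with
  | nil =>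
    obtain rfl : b = 0 := hl
    omega
  | cons e l ih =>
    obtain ⟨w, hw, hwb, he, hg, hl⟩ := hl
    have h₁ := hc v e.exp (by simp) (.inr (.inr ⟨e, by simp, rfl⟩))
    have h₂ := hc a v (by simp) (by simp)
    rcases le_or_gt w u with h | h
    · have e₁ : (compareVars fuel tbl pows v e.exp).1 = true := by
        rw [h₁.1, hv, hw, decide_eq_true_iff]
        exact_mod_cast h
      refine ⟨⟨i, v, (compareVars fuel tbl pows a v).2⟩ ::
        ⟨e.idx, e.exp, (compareVars fuel tbl pows v e.exp).2⟩ :: l, ?_,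
        powTable_insert_head hv hi hab.le (h₂.2 _ ?_) hw h he (h₁.2 _ ?_) hl, ?_, ?_⟩
      · simp [insertStep, e₁, foldl_insertStep_true]
      · rw [ha, hv]; omega
      · rw [hv, hw]; omega
      · simp
      · simp only [List.mem_cons]
        rintro f (rfl | rfl | hf)
        · exact .inl rfl
        · exact .inr ⟨e, .inl rfl, rfl⟩
        · exact .inr ⟨f, .inr hf, rfl⟩
    · have e₁ : (compareVars fuel tbl pows v e.exp).1 = false := by
        rw [h₁.1, hv, hw, decide_eq_false_iff_not]
        push Not
        exact_mod_cast h
      obtain ⟨l', i₁, i₂, i₃, i₄⟩ := ih (acc := e :: acc) hw h hl (by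
        intro y z hy hz
        refine hc y z ?_ ?_
        · rcases hy with rfl | rfl | ⟨f, hf, rfl⟩
          · exact .inr (.inr ⟨e, by simp, rfl⟩)
          · simp
          · exact .inr (.inr ⟨f, by simp [hf], rfl⟩)
        · rcases hz with rfl | rfl | ⟨f, hf, rfl⟩
          · exact .inr (.inr ⟨e, by simp, rfl⟩)
          · simp
          · exact .inr (.inr ⟨f, by simp [hf], rfl⟩))
      refine ⟨e :: l', ?_, ⟨w, hw, hwb, he, hg, i₂⟩, ?_, ?_⟩
      · simp [insertStep, e₁, i₁]
      · exact (i₃.cons e.idx).trans (List.Perm.swap _ _ _)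
      · simp only [List.mem_cons]
        rintro f (rfl | hf)
        · exact .inr ⟨f, .inl rfl, rfl⟩
        · rcases i₄ f hf with h | ⟨e', h, h'⟩
          · exact .inl h
          · exact .inr ⟨e', .inr h, h'⟩

theorem insertPow_spec {u b : ℕ} (hv : x v = u) (hi : x i = 2 ^ u) (hne : pows ≠ [])
    (hl : PowTable x fuel.length b pows)
    (hc : ∀ y z, (y = v ∨ ∃ e ∈ pows, y = e.exp) → (z = v ∨ ∃ e ∈ pows, z = e.exp) →
      CompareSpec fuel.length (x y) (x z) (compareVars fuel tbl pows y z)) :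
    ∃ b, PowTable x fuel.length b (insertPow fuel tbl pows i v) ∧
      ((insertPow fuel tbl pows i v).map PowEntry.idx).Perm (i :: pows.map PowEntry.idx) ∧
      ∀ e ∈ insertPow fuel tbl pows i v, e.exp = v ∨ ∃ e' ∈ pows, e.exp = e'.exp := by
  rw [insertPow]
  generalize hF : insertStep fuel tbl pows i v = F
  rcases pows with _ | ⟨e, l⟩
  · exact absurd rfl hne
  obtain ⟨w, hw, hwb, he, hg, hl⟩ := hl
  have h₁ := hc v e.exp (by simp) (.inr ⟨e, by simp, rfl⟩)
  have h₂ := hc v v (by simp) (by simp)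
  rcases le_or_gt w u with h | h
  · have e₁ : (compareVars fuel tbl (e :: l) v e.exp).1 = true := by
      rw [h₁.1, hv, hw, decide_eq_true_iff]
      exact_mod_cast h
    have e₂ : ((e :: l).foldl F (v, false, [])).2.2.reverse =
        ⟨i, v, (compareVars fuel tbl (e :: l) v v).2⟩ ::
        ⟨e.idx, e.exp, (compareVars fuel tbl (e :: l) v e.exp).2⟩ :: l := by
      rw [← hF, List.foldl_cons]
      conv in (insertStep _ _ _ _ _ _ _) => rw [insertStep]
      simp [e₁, foldl_insertStep_true]
    rw [e₂]
    refine ⟨u, powTable_insert_head hv hi le_rfl (h₂.2 _ ?_) hw h he (h₁.2 _ ?_) hl, ?_, ?_⟩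
    · omega
    · rw [hv, hw]; omega
    · simp
    · simp only [List.mem_cons]
      rintro f (rfl | rfl | hf)
      · exact .inl rfl
      · exact .inr ⟨e, .inl rfl, rfl⟩
      · exact .inr ⟨f, .inr hf, rfl⟩
  · have e₁ : (compareVars fuel tbl (e :: l) v e.exp).1 = false := by
      rw [h₁.1, hv, hw, decide_eq_false_iff_not]
      push Not
      exact_mod_cast h
    obtain ⟨l', i₁, i₂, i₃, i₄⟩ := foldl_insertStep_spec (acc := [e]) (pows := e :: l) (tbl := tbl)
      (a := e.exp) hv hi hw h hl (by
        intro y z hy hz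
        refine hc y z ?_ ?_
        · rcases hy with rfl | rfl | ⟨f, hf, rfl⟩
          · exact .inr ⟨e, by simp, rfl⟩
          · simp
          · exact .inr ⟨f, by simp [hf], rfl⟩
        · rcases hz with rfl | rfl | ⟨f, hf, rfl⟩
          · exact .inr ⟨e, by simp, rfl⟩
          · simp
          · exact .inr ⟨f, by simp [hf], rfl⟩)
    have e₂ : ((e :: l).foldl F (v, false, [])).2.2.reverse = e :: l' := by
      rw [← hF, List.foldl_cons]
      conv in (insertStep _ _ _ _ _ _ _) => rw [insertStep]
      simp [e₁, i₁]
    rw [e₂]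
    refine ⟨b, ⟨w, hw, hwb, he, hg, i₂⟩, ?_, ?_⟩
    · exact (i₃.cons e.idx).trans (List.Perm.swap _ _ _)
    · simp only [List.mem_cons]
      rintro f (rfl | hf)
      · exact .inr ⟨f, .inl rfl, rfl⟩
      · rcases i₄ f hf with h | ⟨e', h, h'⟩
        · exact .inl h
        · exact .inr ⟨e', .inr h, h'⟩

end Insert

/-! ### Correctness of the treatment of the rows -/

/-- The row `r` is that of the variable with index `s`; it refers to variables of smaller index,
and it holds under the valuation `x`. -/
def Row.Valid (x : ℕ → ℤ) (s : ℕ) (r : Row) : Prop :=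
  r.idx = s ∧ r.j < s ∧ r.k < s ∧ 1 ≤ r.den ∧
    if r.isExp then ∃ u : ℕ, x r.j = u ∧ x s = 2 ^ u
    else r.den * x s = pairVal r.a * x r.j + pairVal r.b * x r.k

theorem LinTable.mono {x : ℕ → ℤ} {O O' : List ℕ} (h : O ⊆ O') {tbl : List Row}
    (ht : LinTable x O tbl) : LinTable x O' tbl := by
  induction tbl with
  | nil => trivial
  | cons r t ih =>
    obtain ⟨h₁, h₂, h₃, h₄, h₅⟩ := ht
    have hs : t.map Row.idx ++ O ⊆ t.map Row.idx ++ O' := 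
      List.append_subset.2 ⟨List.subset_append_left _ _,
        List.Subset.trans h (List.subset_append_right _ _)⟩
    exact ⟨h₁, hs h₂, hs h₃, h₄, ih h₅⟩

/-- If the linear rows and the powers for the indices below `s` satisfy the invariants, then so
they do after the treatment of the remaining rows, and the variables can be compared. -/
theorem foldl_rowStep_spec {x : ℕ → ℤ} {fuel : List Unit} (hB0 : 1 ≤ fuel.length)
    {rows : List Row} {s v : ℕ} {tbl : List Row} {pows : List PowEntry}
    (hr : ∀ i (h : i < rows.length), (rows[i]).Valid x (s + i))
    (ht : LinTable x (pows.map PowEntry.idx) tbl) (hP : PowTable x fuel.length v pows)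
    (hne : pows ≠ []) (he : ∀ e ∈ pows, e.exp < s)
    (hperm : (tbl.map Row.idx ++ pows.map PowEntry.idx).Perm (List.range s))
    (hB : (tbl.map Row.norm).prod * (rows.map Row.norm).prod *
      (pows.length + rows.length + fuel.length) ≤ 2 ^ fuel.length)
    {p q : ℕ} (hp : p < s + rows.length) (hq : q < s + rows.length) :
    let S := rows.foldl (rowStep fuel) (tbl, pows)
    (compareVars fuel S.1 S.2 p q).1 = decide (x q ≤ x p) := by
  have hpos (r : Row) (h : 1 ≤ r.den) : 1 ≤ r.norm := by rw [Row.norm]; omega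
  have hmem {y s : ℕ} {tbl : List Row} {pows : List PowEntry}
      (hperm : (tbl.map Row.idx ++ pows.map PowEntry.idx).Perm (List.range s)) (hy : y < s) :
      y ∈ tbl.map Row.idx ++ pows.map PowEntry.idx :=
    hperm.mem_iff.2 (List.mem_range.2 hy)
  induction rows generalizing s v tbl pows with
  | nil =>
    simp only [List.map_nil, List.prod_nil, mul_one, List.length_nil, add_zero] at hB hp hq
    exact (compareVars_spec ht hP (hperm.nodup_iff.2 List.nodup_range) hB hB0 (hmem hperm hp)
      (hmem hperm hq)).1
  | cons r rows ih =>
    have hr0 := hr 0 (by simp)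
    have hrs : ∀ i (h : i < rows.length), (rows[i]).Valid x (s + 1 + i) := fun i h => by
      have := hr (i + 1) (by simpa using h)
      rw [Nat.add_assoc, Nat.add_comm 1 i]
      simpa using this
    simp only [List.getElem_cons_zero, add_zero] at hr0
    obtain ⟨h₁, h₂, h₃, h₄, h₅⟩ := hr0
    have h₆ : 1 ≤ (rows.map Row.norm).prod := by
      refine List.one_le_prod fun y hy => ?_
      obtain ⟨w, hw, rfl⟩ := List.mem_map.1 hy
      obtain ⟨i, hi, rfl⟩ := List.mem_iff_getElem.1 hw
      exact hpos _ (hrs i hi).2.2.2.1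
    have h₇ := hpos r h₄
    simp only [List.length_cons] at hp hq hB
    rw [List.map_cons, List.prod_cons] at hB
    simp only [List.foldl_cons, rowStep]
    rcases hE : r.isExp with _ | _
    · rw [hE, if_neg (by simp), ← h₁] at h₅
      refine ih (s := s + 1) (v := v) hrs ?_ hP hne (fun e h => (he e h).trans (by omega)) ?_ ?_
        (by omega) (by omega)
      · exact ⟨h₄, hmem hperm h₂, hmem hperm h₃, h₅, ht⟩
      · simp only [List.map_cons, List.cons_append, h₁, List.range_succ]
        exact (hperm.cons s).trans (List.perm_append_singleton s _).symm
      · refine le_trans ?_ hB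
        rw [List.map_cons, List.prod_cons, mul_comm r.norm, mul_assoc (List.prod _) r.norm]
        gcongr
        omega
    · rw [hE, if_pos rfl] at h₅
      obtain ⟨u, h₈, h₉⟩ := h₅
      have hB' : (tbl.map Row.norm).prod * (pows.length + fuel.length) ≤ 2 ^ fuel.length := by
        refine le_trans ?_ hB
        have : 1 ≤ r.norm * (rows.map Row.norm).prod := Nat.mul_pos h₇ h₆
        gcongr
        · exact Nat.le_mul_of_pos_right _ this
        · omega
      have hlt {y : ℕ} (hy : y = r.j ∨ ∃ e ∈ pows, y = e.exp) : y < s := by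
        rcases hy with rfl | ⟨e, h, rfl⟩
        · exact h₂
        · exact he e h
      rw [← h₁] at h₉
      obtain ⟨b, i₁, i₂, i₃⟩ := insertPow_spec (tbl := tbl) h₈ h₉ hne hP fun y z hy hz =>
        compareVars_spec ht hP (hperm.nodup_iff.2 List.nodup_range) hB' hB0
          (hmem hperm (hlt hy)) (hmem hperm (hlt hz))
      refine ih (s := s + 1) (v := b) hrs (ht.mono ?_) i₁ ?_ ?_ ?_ ?_ (by omega) (by omega)
      · intro y hy
        exact i₂.mem_iff.2 (List.mem_cons_of_mem _ hy)
      · intro h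
        have := i₂.length_eq
        simp only [h, List.map_nil, List.length_nil, List.length_cons] at this
        omega
      · intro e h
        have : e.exp < s := by
          rcases i₃ e h with h | ⟨e', h, h'⟩
          · exact hlt (.inl h)
          · exact hlt (.inr ⟨e', h, h'⟩)
        omega
      · refine (i₂.append_left _).trans ?_
        rw [h₁, List.range_succ]
        exact List.perm_middle.trans ((hperm.cons s).trans (List.perm_append_singleton s _).symm)
      · have := i₂.length_eq
        simp only [List.length_map, List.length_cons] at this
        rw [this, Nat.add_assoc pows.length, Nat.add_comm 1]
        refine le_trans ?_ hB
        gcongr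
        exact Nat.le_mul_of_pos_left _ h₇

theorem rowsNonneg_eq {x : ℕ → ℤ} {fuel : List Unit} (hB0 : 1 ≤ fuel.length)
    (hx0 : x 0 = 1) (hx1 : x 1 = 0) {rows : List Row} (hne : rows ≠ [])
    (hr : ∀ i (h : i < rows.length), (rows[i]).Valid x (1 + i))
    (hE : (rows.head hne).isExp = false)
    (hB : (rows.map Row.norm).prod * (rows.length + fuel.length) ≤ 2 ^ fuel.length)
    {p : ℕ} (hp : p ≤ rows.length) :
    rowsNonneg fuel rows p = decide (0 ≤ x p) := by
  rcases rows with _ | ⟨r, rows⟩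
  · exact absurd rfl hne
  obtain ⟨h₁, h₂, h₃, h₄, h₅⟩ := hr 0 (by simp)
  simp only [List.getElem_cons_zero, add_zero, List.head_cons] at h₁ h₂ h₃ h₄ h₅ hE
  rw [hE, if_neg (by simp), ← h₁] at h₅
  simp only [List.length_cons] at hp
  -- The exponent of the initial power `x_0 = 2 ^ x_1` is the variable of the first row, so the
  -- invariants hold only once this row has been treated.
  rw [rowsNonneg, List.foldl_cons, rowStep, hE, ← hx1, cond_false]
  refine foldl_rowStep_spec hB0 (s := 2) (v := 0) ?_ ?_ ?_ (by simp) ?_ ?_ ?_ (by omega) (by omega)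
  · intro i h
    have := hr (i + 1) (by simpa using h)
    rw [show 1 + (i + 1) = 2 + i by omega] at this
    simpa using this
  · refine ⟨h₄, ?_, ?_, h₅, trivial⟩
    · simp; omega
    · simp; omega
  · exact ⟨0, by simpa using hx1, le_rfl, by simpa using hx0, by simp, rfl⟩
  · simp
  · simp only [List.map_cons, List.map_nil, h₁]
    decide
  · simpa [add_comm] using hB

/-! ### Correctness of the parser -/

/-- The row of the statement `x_i ← e`, with all indices of variables shifted by one. -/
def LESLPExpr.row {i : ℕ} : LESLPExpr i → Row
  | .zero => ⟨i + 1, false, 0, (0, 0), 0, (0, 0), 1⟩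
  | .add j k => ⟨i + 1, false, j + 1, (1, 0), k + 1, (1, 0), 1⟩
  | .scale m g j => ⟨i + 1, false, j + 1, bif decide (m < 0) then (0, m.natAbs) else (m.natAbs, 0),
      0, (0, 0), g⟩
  | .exp j => ⟨i + 1, true, j + 1, (0, 0), 0, (0, 0), 1⟩

open LESLPSymbol

theorem bitsVal_encodeNat (a : ℕ) : bitsVal (Computability.encodeNat a) = a := by
  have hp : ∀ p : PosNum, bitsVal (Computability.encodePosNum p) = p := by
    intro p
    induction p with
    | one => rfl
    | bit0 p ih =>
      rw [Computability.encodePosNum, bitsVal_cons, ih, PosNum.cast_bit0]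
      simp; ring
    | bit1 p ih =>
      rw [Computability.encodePosNum, bitsVal_cons, ih, PosNum.cast_bit1]
      simp; ring
  have hn : ∀ n : Num, bitsVal (Computability.encodeNum n) = n := by
    rintro (_ | p)
    · rfl
    · exact hp p
  rw [Computability.encodeNat, hn]
  exact Num.to_of_nat a

theorem lt_two_pow_length_encodeNat (a : ℕ) : a < 2 ^ (Computability.encodeNat a).length := by
  have := bitsVal_lt (Computability.encodeNat a)
  rwa [bitsVal_encodeNat] at this

theorem foldl_parseStep_writeVar (s : ParseState) (j : ℕ) : (writeVar j).foldl parseStep s =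
    ⟨s.rows, s.idx, s.snd, j + 1, s.num, s.bits, s.neg, s.op⟩ := by
  induction j with
  | zero => rfl
  | succ j ih =>
    have : writeVar (j + 1) = writeVar j ++ [tick] := by
      rw [writeVar, writeVar, List.replicate_succ', List.cons_append]
    rw [this, List.foldl_append, ih]
    rfl

theorem foldl_parseStep_bits (s : ParseState) (l : List Bool) : (l.map bit).foldl parseStep s =
    ⟨s.rows, s.idx, s.fst, s.snd, s.num, l.reverse ++ s.bits, s.neg, s.op⟩ := by
  induction l generalizing s with
  | nil => rfl
  | cons b l ih => rw [List.map_cons, List.foldl_cons, ih]; simp [parseStep]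

theorem foldl_parseStep_writeInt (s : ParseState) (m : ℤ) : (writeInt m).foldl parseStep s =
    ⟨s.rows, s.idx, s.fst, s.snd, s.num, (Computability.encodeNat m.natAbs).reverse ++ s.bits,
      decide (m < 0) || s.neg, s.op⟩ := by
  rw [writeInt, List.foldl_append, writeNat, foldl_parseStep_bits]
  by_cases h : m < 0 <;> simp [h, parseStep]

/-- The word of the statement `x_i ← e`. -/
def LESLPExpr.word {i : ℕ} (e : LESLPExpr i) : List LESLPSymbol :=
  writeVar i ++ assign :: (e.encode ++ [semicolon])

theorem foldl_parseStep_word {i : ℕ} (e : LESLPExpr i) (rows : List Row) :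
    e.word.foldl parseStep ⟨rows, 0, 0, 0, 0, [], false, .nought⟩ =
      ⟨e.row :: rows, 0, 0, 0, 0, [], false, .nought⟩ := by
  cases e <;> simp only [LESLPExpr.word, LESLPExpr.encode, writeNat, List.foldl_append,
    List.foldl_cons, List.foldl_nil, foldl_parseStep_writeVar, foldl_parseStep_writeInt,
    foldl_parseStep_bits]
  case scale m g j => simp [parseStep, ParseState.row, LESLPExpr.row, bitsVal_encodeNat]
  all_goals rfl

/-- The rows of a program. -/
def LESLP.rows (σ : LESLP) : List Row := List.ofFn fun i => (σ.ρ i).row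

theorem parseRows_encode (σ : LESLP) : parseRows σ.encode = σ.rows.reverse := by
  have key : ∀ (m : ℕ) (f : Fin m → ℕ) (e : (i : Fin m) → LESLPExpr (f i)) (rows : List Row),
      (List.ofFn fun i => (e i).word).flatten.foldl parseStep
        ⟨rows, 0, 0, 0, 0, [], false, .nought⟩ =
      ⟨(List.ofFn fun i => (e i).row).reverse ++ rows, 0, 0, 0, 0, [], false, .nought⟩ := by
    intro m
    induction m with
    | zero => intro f e rows; rfl
    | succ m ih =>
      intro f e rows
      rw [List.ofFn_succ, List.flatten_cons, List.foldl_append, foldl_parseStep_word,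
        ih (fun i => f i.succ) (fun i => e i.succ), List.ofFn_succ]
      simp
  have := key (σ.n + 1) (fun i => i) σ.ρ []
  rw [parseRows]
  change (List.foldl parseStep _ (List.ofFn fun i => (σ.ρ i).word).flatten).rows = _
  rw [this, List.append_nil]
  rfl

theorem LESLPExpr.norm_row_le {i : ℕ} (e : LESLPExpr i) : e.row.norm ≤ 2 ^ e.word.length := by
  have h : ∀ k, 2 ≤ k → 3 ≤ 2 ^ k := fun k hk =>
    le_trans (by norm_num) (Nat.pow_le_pow_right (n := 2) (by norm_num) hk)
  cases e with
  | scale m g j =>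
    have h₁ : (bif decide (m < 0) then (0, m.natAbs) else (m.natAbs, 0) : ℕ × ℕ).1 +
        (bif decide (m < 0) then (0, m.natAbs) else (m.natAbs, 0) : ℕ × ℕ).2 = m.natAbs := by
      cases decide (m < 0) <;> simp
    have h₂ := add_le_two_pow (lt_two_pow_length_encodeNat g)
      (lt_two_pow_length_encodeNat m.natAbs)
    simp only [row, Row.norm, h₁, add_zero]
    refine h₂.trans (Nat.pow_le_pow_right (by norm_num) ?_)
    simp [word, encode, writeInt, writeNat]
    omega
  | _ =>
    refine le_trans ?_ (h _ ?_)
    · simp [row, Row.norm]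
    · simp [word, encode]
      try omega

theorem LESLP.prod_norm_rows_le (σ : LESLP) :
    (σ.rows.map Row.norm).prod ≤ 2 ^ σ.encode.length ∧ 2 * σ.rows.length ≤ σ.encode.length := by
  have key : ∀ (m : ℕ) (f : Fin m → ℕ) (e : (i : Fin m) → LESLPExpr (f i)),
      ((List.ofFn fun i => (e i).row).map Row.norm).prod ≤
        2 ^ (List.ofFn fun i => (e i).word).flatten.length ∧
      2 * (List.ofFn fun i => (e i).row).length ≤
        (List.ofFn fun i => (e i).word).flatten.length := by
    intro m
    induction m with
    | zero => intro f e; simp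
    | succ m ih =>
      intro f e
      obtain ⟨h₁, h₂⟩ := ih (fun i => f i.succ) (fun i => e i.succ)
      rw [List.ofFn_succ, List.ofFn_succ, List.map_cons, List.prod_cons, List.flatten_cons,
        List.length_append, pow_add, List.length_cons]
      refine ⟨Nat.mul_le_mul (e 0).norm_row_le h₁, ?_⟩
      have : 2 ≤ (e 0).word.length := by simp [LESLPExpr.word]; omega
      omega
  exact key (σ.n + 1) (fun i => i) σ.ρ

/-- The values of the variables `x_i` of a program whose values are integers `z i`, with the index
shifted by one, together with the constant `1` at the index `0`. -/
def LESLP.valuation (σ : LESLP) (z : Fin (σ.n + 1) → ℤ) : ℕ → ℤ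
  | 0 => 1
  | i + 1 => if h : i < σ.n + 1 then z ⟨i, h⟩ else 0

theorem LESLP.valid_row {σ : LESLP} {z : Fin (σ.n + 1) → ℤ} (hz : ∀ i, σ.val i = z i)
    (i : Fin (σ.n + 1)) : (σ.ρ i).row.Valid (σ.valuation z) (1 + i) := by
  have hv (j : ℕ) (h : j < σ.n + 1) : σ.valuation z (j + 1) = z ⟨j, h⟩ := by
    rw [LESLP.valuation, dif_pos h]
  have hi := hv i i.2
  have e : σ.val i = z i := hz i
  rw [LESLP.val] at e
  rw [add_comm 1 (i : ℕ)]
  rcases h : σ.ρ i with _ | ⟨j, k⟩ | ⟨m, g, j⟩ | j <;> rw [h] at e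
  · simp only at e
    refine ⟨rfl, by simp [LESLPExpr.row], by simp [LESLPExpr.row], le_rfl, ?_⟩
    have : z i = 0 := by exact_mod_cast e.symm
    simp [LESLPExpr.row, hi, this]
  · simp only [hz] at e
    refine ⟨rfl, by simp [LESLPExpr.row], by simp [LESLPExpr.row], le_rfl, ?_⟩
    have e' : z ⟨j, j.2.trans i.2⟩ + z ⟨k, k.2.trans i.2⟩ = z i := by exact_mod_cast e
    simp [LESLPExpr.row, hi, hv j (j.2.trans i.2), hv k (k.2.trans i.2), ← e', pairVal]
  · simp only [hz] at e
    refine ⟨rfl, by simp [LESLPExpr.row], by simp [LESLPExpr.row], g.2, ?_⟩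
    have hg : ((g : ℕ) : ℝ) ≠ 0 := by exact_mod_cast g.ne_zero
    have e' : m * z ⟨j, j.2.trans i.2⟩ = g * z i := by
      field_simp at e
      exact_mod_cast e
    have hm : pairVal (bif decide (m < 0) then (0, m.natAbs) else (m.natAbs, 0)) = m := by
      rw [Bool.cond_decide]
      split_ifs <;> simp only [pairVal] <;> omega
    simp [LESLPExpr.row, hi, hv j (j.2.trans i.2), ← e', hm]
  · simp only [hz] at e
    refine ⟨rfl, by simp [LESLPExpr.row], by simp [LESLPExpr.row], le_rfl, ?_⟩
    have hj := hv j (j.2.trans i.2)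
    rw [Real.rpow_intCast] at e
    -- A power of two with a negative exponent is not an integer.
    have h0 : 0 ≤ z ⟨j, j.2.trans i.2⟩ := by
      by_contra hneg
      have h₁ : (2 : ℝ) ^ z ⟨j, j.2.trans i.2⟩ < 1 :=
        zpow_lt_one_of_neg₀ (by norm_num) (by omega)
      have h₂ : (0 : ℝ) < 2 ^ z ⟨j, j.2.trans i.2⟩ := by positivity
      rw [e] at h₁ h₂
      have h₃ : z i < 1 := by exact_mod_cast h₁
      have h₄ : 0 < z i := by exact_mod_cast h₂
      omega
    obtain ⟨u, hu⟩ := Int.eq_ofNat_of_zero_le h0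
    simp only [LESLPExpr.row, if_true]
    refine ⟨u, by rw [hj, hu], ?_⟩
    rw [hu, zpow_natCast] at e
    rw [hi]
    exact_mod_cast e.symm

theorem five_mul_le_eight_pow {L : ℕ} (h : 1 ≤ L) : 5 * L ≤ 8 ^ L := by
  induction L, h using Nat.le_induction with
  | base => norm_num
  | succ L h ih => rw [pow_succ]; omega

/-- The procedure on words is right for programs all of whose variables are integers. -/
theorem lastNonneg_encode (σ : LESLP) (h : σ.IsInteger) :
    lastNonneg σ.encode = true ↔ 0 ≤ σ.lastVal := by
  choose z hz using h
  obtain ⟨h₁, h₂⟩ := σ.prod_norm_rows_le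
  have hl : σ.rows.length = σ.n + 1 := by simp [LESLP.rows]
  have hne : σ.rows ≠ [] := by
    intro h
    simp [h] at hl
  have hidx : (σ.rows.reverse.headD ⟨0, false, 0, 0, 0, 0, 0⟩).idx = σ.n + 1 := by
    have : σ.rows = (List.ofFn fun i : Fin σ.n => (σ.ρ i.castSucc).row) ++
        [(σ.ρ (Fin.last σ.n)).row] := by
      rw [LESLP.rows, List.ofFn_succ_last]
    rw [this, List.reverse_append, List.reverse_singleton, List.singleton_append, List.headD_cons]
    exact (LESLP.valid_row hz (Fin.last σ.n)).1.trans (by simp [add_comm])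
  have hrow : ∀ i (h : i < σ.rows.length), (σ.rows[i]).Valid (σ.valuation z) (1 + i) := by
    intro i h
    have := LESLP.valid_row hz ⟨i, by omega⟩
    simp only [LESLP.rows, List.getElem_ofFn]
    exact this
  have hzero : σ.ρ 0 = .zero := by
    rcases h : σ.ρ 0 with _ | ⟨j, k⟩ | ⟨m, g, j⟩ | j
    · rfl
    all_goals exact (Nat.not_lt_zero _ j.2).elim
  have hz0 : z 0 = 0 := by
    have := hz 0
    rw [LESLP.val, hzero] at this
    simp only at this
    exact_mod_cast this.symm
  have hlast : σ.valuation z (σ.n + 1) = z (Fin.last σ.n) := by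
    rw [LESLP.valuation, dif_pos (Nat.lt_succ_self _)]
    rfl
  set L := σ.encode.length with hL
  rw [lastNonneg, parseRows_encode, List.reverse_reverse, hidx,
    rowsNonneg_eq (x := σ.valuation z) ?_ rfl ?_ hne hrow ?_ ?_ (by omega), decide_eq_true_iff,
    hlast, LESLP.lastVal, hz, Int.cast_nonneg_iff]
  · simp only [List.length_map, List.length_append, ← hL]
    omega
  · rw [LESLP.valuation, dif_pos (by omega)]
    exact hz0
  · simp [LESLP.rows, List.ofFn_succ, hzero, LESLPExpr.row]
  · -- The product of the norms is at most `2 ^ L`, and the other factor at most `5 * L`.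
    simp only [List.length_map, List.length_append, ← hL]
    calc (σ.rows.map Row.norm).prod * (σ.rows.length + (L + (L + (L + L))))
        ≤ 2 ^ L * 8 ^ L := by
          refine Nat.mul_le_mul h₁ ((?_ : _ ≤ 5 * L).trans (five_mul_le_eight_pow ?_)) <;> omega
      _ = 2 ^ (L + (L + (L + L))) := by
        rw [show 8 = 2 ^ 3 by norm_num, ← pow_mul, ← pow_add]
        congr 1
        ring

/-! ### The Turing machine -/

namespace WorkProg

open StackProg PolyTime

/-- Pop a symbol of the input into the register. -/
def popSymbol : WorkProg := .pop none fun v x => (x, v.2)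

/-- Whether the last `popSymbol` has found a symbol. -/
def hasSymbol (v : Register) : Bool := v.1.isSome

/-- The symbols of the alphabet. -/
def symbols : List LESLPSymbol :=
  [.var, .tick, .assign, .nought, .plus, .pow, .minus, .slash, .times, .bit false, .bit true,
    .semicolon]

theorem mem_symbols (c : LESLPSymbol) : c ∈ symbols := by
  rcases c with _ | _ | _ | _ | _ | _ | _ | _ | _ | (_ | _) | _ <;> simp [symbols]

/-- Push the tree of the input symbol in the register, provided that it occurs in the list. -/
def pushSymbol (l : List LESLPSymbol) : WorkProg :=
  l.foldr (fun c p => .ite (fun v => decide (v.1 = some c)) (pushTree (enc c)) p) (.load id)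

theorem run_popSymbol {v : Register} {i : List LESLPSymbol} {s : WorkStack → List Bool} :
    Run popSymbol v (stackFam i s) (i.head?, v.2) (stackFam i.tail s) 1 := by
  rw [← update_stackFam_none i s i.tail]
  exact ⟨1, le_rfl, .pop⟩

theorem run_pushSymbol {c : LESLPSymbol} {l : List LESLPSymbol} (hc : c ∈ l) (b : Option Bool)
    (i : List LESLPSymbol) (m : List Bool) : ∃ v', Run (pushSymbol l) (some c, b)
      (stackFam i (work m [] [] [])) v' (stackFam i (work ((enc c).word ++ m) [] [] []))
      (17 + l.length) := by
  induction l with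
  | nil => simp at hc
  | cons d l ih =>
    by_cases h : c = d
    · subst h
      obtain ⟨v', h⟩ := turns_pushTree (enc c) (some c, b) i m
      have := codeSize_symbol_le c
      exact ⟨v', (Run.ite_true (by simp) h).mono (by rw [codeSize] at this; simp; omega)⟩
    · obtain ⟨v', h'⟩ := ih ((List.mem_cons.1 hc).resolve_left h)
      exact ⟨v', Run.ite_false (by simp [h]) h'⟩

/-- Push the tree of the input word, in reverse order. -/
def readInput : WorkProg :=
  .seq (pushBit .main false) (.seq popSymbol (.loop hasSymbol
    (.seq (pushSymbol symbols) (.seq (pushBit .main true) popSymbol))))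

theorem run_readInput (v : Register) (w : List LESLPSymbol) : ∃ v', Run readInput v
    (stackFam w (work [] [] [] [])) v' (stackFam [] (work (enc w.reverse).word [] [] []))
    (32 * w.length + 3) := by
  have loop : ∀ (w acc : List LESLPSymbol) (b : Option Bool), ∃ v', Run (.loop hasSymbol
      (.seq (pushSymbol symbols) (.seq (pushBit .main true) popSymbol)))
      (w.head?, b) (stackFam w.tail (work (enc acc).word [] [] [])) v'
      (stackFam [] (work (enc (w.reverse ++ acc)).word [] [] [])) (32 * w.length + 1) := by
    intro w
    induction w with
    | nil => intro acc b; exact ⟨_, Run.loop_false rfl⟩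
    | cons c w ih =>
      intro acc b
      obtain ⟨v₁, h₁⟩ := run_pushSymbol (mem_symbols c) b w (enc acc).word
      have h₂ := run_pushBit_main (v := v₁) (i := w) (m := (enc c).word ++ (enc acc).word)
        (d := []) (u := []) (c := []) true
      obtain ⟨v', h₃⟩ := ih (c :: acc) v₁.2
      refine ⟨v', ?_⟩
      have e : (c :: w).reverse ++ acc = w.reverse ++ c :: acc := by simp
      rw [e]
      refine (Run.loop_true rfl (h₁.seq (h₂.seq run_popSymbol)) h₃).mono ?_
      have : symbols.length = 12 := rfl
      rw [List.length_cons]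
      omega
  obtain ⟨v', h⟩ := loop w [] v.2
  rw [List.append_nil] at h
  refine ⟨v', ((run_pushBit_main false).seq (run_popSymbol.seq h)).mono ?_⟩
  omega

/-- Turn the tree of a Boolean into a single symbol. -/
def writeOutput : WorkProg :=
  Turns.popIte (.seq (popBit .main) (.seq (popBit .main) (pushBit .main true)))
    (pushBit .main false)

theorem turns_writeOutput (b : Bool) : Turns writeOutput (enc b).word [b] 5 := by
  cases b
  · exact (Turns.popIte_false _ (Turns.push false [])).mono (by norm_num)
  · exact Turns.popIte_true _ ((Turns.pop false [false]).seq ((Turns.pop false []).seq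
      (Turns.push true [])))

/-- The Turing machine that executes a program, clears the register and halts. The label `none` is
that of the final statement. -/
noncomputable def machine (p : WorkProg) : Turing.FinTM2 where
  K := Option WorkStack
  k₀ := none
  k₁ := some .main
  Γ := StackAlphabet
  Λ := Option p.Label
  main := some p.entry
  ΛFin := Fintype.ofFinite _
  σ := Register
  initialState := (none, none)
  Γk₀Fin := inferInstanceAs (Fintype LESLPSymbol)
  m
    | none => .load (fun _ => (none, none)) .halt
    | some l => p.code some none l

theorem initList_machine (p : WorkProg) (w : List LESLPSymbol) :
    Turing.initList (machine p) w =
      ⟨some (some p.entry), (none, none), stackFam w (work [] [] [] [])⟩ := by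
  refine congrArg (Turing.TM2.Cfg.mk _ _) (funext fun k => ?_)
  rcases k with _ | (_ | _ | _ | _) <;> rfl

theorem haltList_machine (p : WorkProg) (l : List Bool) :
    Turing.haltList (machine p) l = ⟨none, (none, none), stackFam [] (work l [] [] [])⟩ := by
  refine congrArg (Turing.TM2.Cfg.mk _ _) (funext fun k => ?_)
  rcases k with _ | (_ | _ | _ | _) <;> rfl

theorem Run.outputs {p : WorkProg} {w : List LESLPSymbol} {l : List Bool} {v : Register} {T : ℕ}
    (h : Run p (none, none) (stackFam w (work [] [] [] [])) v (stackFam [] (work l [] [] [])) T) :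
    Nonempty (Turing.TM2OutputsInTime (machine p) w (some l) (T + 1)) := by
  obtain ⟨t, ht, h⟩ := h
  refine ⟨{ steps := t + 1, evals_in_steps := ?_, steps_le_m := Nat.succ_le_succ ht }⟩
  have h₁ := h.iterate_step (machine p).m some none fun _ => rfl
  rw [Function.iterate_succ_apply']
  exact (congrArg (fun c => flip bind (machine p).step ((flip bind (machine p).step)^[t] (some c)))
    (initList_machine p w)).trans ((congrArg (flip bind (machine p).step) h₁).trans
      (congrArg some (haltList_machine p l).symm))

end WorkProg

open WorkProg in
/-- A decision procedure on words that is computable in polynomial time in terms of trees gives rise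
to a Turing machine that runs in polynomial time. -/
theorem PolyTime.decidableInPolyTime {f : List LESLPSymbol → Bool} (hf : PolyTime f) {α : Type}
    {e : α → List LESLPSymbol} {P : α → Prop} (h : ∀ a, f (e a) = true ↔ P a) :
    DecidableInPolyTime e P := by
  classical
  obtain ⟨p, Q, hp⟩ := comp (f := f) hf (reverse id)
  have run (w : List LESLPSymbol) : ∃ v, Run (.seq readInput (.seq p writeOutput)) (none, none)
      (stackFam w (work [] [] [] [])) v (stackFam [] (work [f w] [] [] []))
      (32 * w.length + 3 + (Q.eval (18 * w.length + 1) + 5)) := by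
    obtain ⟨v₁, h₁⟩ := run_readInput (none, none) w
    obtain ⟨v₂, h₂⟩ := ((hp w.reverse).seq (turns_writeOutput _)) v₁ [] []
    simp only [List.reverse_reverse] at h₂
    refine ⟨v₂, (h₁.seq (by simpa using h₂)).mono ?_⟩
    have h₃ : codeSize w.reverse ≤ 18 * w.length + 1 := by
      have := codeSize_list_le (l := w) fun c _ => codeSize_symbol_le c
      rw [codeSize_reverse]
      omega
    have := Q.eval_mono_nat h₃
    simp only at this
    omega
  refine ⟨⟨⟨machine (.seq readInput (.seq p writeOutput)), Equiv.refl _, Equiv.refl _⟩,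
    32 * .X + 3 + (Q.comp (18 * .X + 1) + 5) + 1, fun a => Classical.choice ?_⟩⟩
  obtain ⟨v, hv⟩ := run (e a)
  have hfa : f (e a) = decide (P a) := by
    rw [Bool.eq_iff_iff, h, decide_eq_true_iff]
  rw [hfa] at hv
  have hT (n : ℕ) : (32 * .X + 3 + (Q.comp (18 * .X + 1) + 5) + 1 : Polynomial ℕ).eval n =
      32 * n + 3 + (Q.eval (18 * n + 1) + 5) + 1 := by
    simp
  rw [hT]
  have hmap : List.map (Equiv.refl LESLPSymbol).invFun (e a) = e a := List.map_id _
  have hout : ∀ w', w' = e a → Nonempty (Turing.TM2OutputsInTime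
      (machine (.seq readInput (.seq p writeOutput))) w' (some [decide (P a)])
      (32 * (e a).length + 3 + (Q.eval (18 * (e a).length + 1) + 5) + 1)) := by
    rintro _ rfl
    exact hv.outputs
  exact hout _ hmap

theorem mainTheorem2 :
    DecidableInPolyTime (fun σ : ILESLP => σ.1.encode) PosILESLP :=
  PolyTime.lastNonneg.decidableInPolyTime fun σ => lastNonneg_encode σ.1 σ.2
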